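/- Let $n\ge 1$ be an integer and $C_c^2=C_c^2(\mathbb{R}^n)$ the space of real-valued, compactly supported $C^2$ functions on $\mathbb{R}^n$. For $0<s<1$, $u\in C_c^2$ and $x\in\mathbb{R}^n$ put $$(-\Delta)^su(x)=c_{n,s}\,\mathrm{P.V.}\!\int_{\mathbb{R}^n}\frac{u(x)-u(y)}{|x-y|^{n+2s}}\,dy,\qquad c_{n,s}=2^{2s}\pi^{-n/2}s\,\frac{\Gamma(\frac{n+2s}{2})}{\Gamma(1-s)},$$ where $\mathrm{P.V.}\int_{\mathbb{R}^n}=\lim_{\varepsilon\to0^+}\int_{|x-y|>\varepsilon}$, and $$\mathcal L_1u(x)=\mathrm{P.V.}\!\int_{\mathbb{R}^n}\frac{u(x)-u(y)}{|x-y|^{n+2s}}\,(-2\ln|x-y|)\,dy,\qquad b_{n,s}=\ln4+\frac1s+\psi(1-s)+\psi\Big(\frac{n+2s}{2}\Big),\quad \psi=\frac{\Gamma'}{\Gamma}.$$ The fractional-logarithmic Laplacian is $(-\Delta)^{s+\mathrm{Log}}u(x):=\frac{d}{dt}(-\Delta)^tu(x)\big|_{t=s}$. The logarithmic Laplacian $\mathrm{Log}(-\Delta)u$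 of $u\in C_c^2$ is the almost everywhere unique function such that $\mathrm{Log}(-\Delta)u\in L^p(\mathbb{R}^n)$ and $(-\Delta)^tu=u+t\,\mathrm{Log}(-\Delta)u+o(t)$ in $L^p(\mathbb{R}^n)$ as $t\to0^+$, for every $1<p\le\infty$. Let $\mathcal F u(\xi)=\widehat u(\xi)=(2\pi)^{-n/2}\int_{\mathbb{R}^n} e^{-i\xi\cdot x}u(x)\,dx$. Let $\mathcal Z$ be the space of complex-valued Schwartz functions $\varphi$ on $\mathbb{R}^n$ with $\partial^\alpha\widehat\varphi(0)=0$ for all multi-indices $\alpha$, with the topology induced by the Schwartz space, and let $\mathcal Z'$ be its topological dual. On $\mathcal Z'$ the operators $(-\Delta)^s$, $\mathrm{Log}(-\Delta)$ and $(-\Delta)^{s+\mathrm{Log}}$ are defined by $\langle A(D)u,\varphi\rangle=\langle u,\mathcal F^{-1}(a\,\widehat\varphi)\rangle$, $\varphi\in\mathcal Z$, with $a(\xi)=|\xi|^{2s}$, $2\ln|\xi|$ and $|\xi|^{2s}\,2\ln|\xi|$, respectively. **Theorem.** Let $0<s<1$. All the above objects are well defined: the principal values and the derivative in $t$ exist at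 every $x$ for every $u\in C_c^2$; $\mathrm{Log}(-\Delta)u$ exists; and for each of the three symbols $a$ the map $\varphi\mapsto\mathcal F^{-1}(a\,\widehat\varphi)$ is a continuous linear map $\mathcal Z\to\mathcal Z$. Moreover: 1. For all $u\in C_c^2$ and $x\in\mathbb{R}^n$, $(-\Delta)^{s+\mathrm{Log}}u(x)=c_{n,s}\,\mathcal L_1u(x)+b_{n,s}\,(-\Delta)^su(x)$. 2. For all $u\in C_c^2$ and $x\in\mathbb{R}^n$, $(-\Delta)^{s+\mathrm{Log}}u(x)=\mathrm{P.V.}\int_{\mathbb{R}^n}(u(x)-u(y))\,\mathbf K_{s+\mathrm{Log}}(|x-y|)\,dy$, where $\mathbf K_{s+\mathrm{Log}}(r)=c_{n,s}\,(b_{n,s}-2\ln r)\,r^{-n-2s}$ for $r>0$. 3. For all $u\in C_c^2$, $(-\Delta)^{s+\mathrm{Log}}u\in L^1(\mathbb{R}^n)$ and $\mathcal F[(-\Delta)^{s+\mathrm{Log}}u](\xi)=|\xi|^{2s}\,(2\ln|\xi|)\,\widehat u(\xi)$ for all $\xi\in\mathbb{R}^n$ (the right-hand side being $0$ at $\xi=0$).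 4. For all $u\in\mathcal Z'$, $(-\Delta)^{s+\mathrm{Log}}u=(-\Delta)^s(\mathrm{Log}(-\Delta)u)=\mathrm{Log}(-\Delta)((-\Delta)^su)$ in $\mathcal Z'$. 5. For all $u\in C_c^2$, $(-\Delta)^{s+\mathrm{Log}}u\in L^\infty(\mathbb{R}^n)$, and $(-\Delta)^{s+\mathrm{Log}}u\to\mathrm{Log}(-\Delta)u$ in $L^\infty(\mathbb{R}^n)$ as $s\to0^+$. -/

import Mathlib

open MeasureTheory Filter Topology
open scoped ENNReal SchwartzMap

noncomputable section

/-- The space `ℝⁿ` with its Euclidean norm. -/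
abbrev Rn (n : ℕ) : Type := EuclideanSpace ℝ (Fin n)

/-- `u ∈ C_c²(ℝⁿ)`: twice continuously differentiable with compact support. -/
def IsCc2 {n : ℕ} (u : Rn n → ℝ) : Prop :=
  ContDiff ℝ 2 u ∧ HasCompactSupport u

/-! ### Principal value integrals -/

/-- The truncated integral `∫_{|x - y| > ε} f(y) dy`. -/
def truncInt {n : ℕ} (x : Rn n) (f : Rn n → ℝ) (ε : ℝ) : ℝ :=
  ∫ y in {y : Rn n | ε < ‖x - y‖}, f y

/-- The principal value integral of `f` with respect to the singular point `x` exists and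
equals `I`: `f` is integrable away from every ball around `x`, and the truncated integrals
converge to `I`. -/
def HasPV {n : ℕ} (x : Rn n) (f : Rn n → ℝ) (I : ℝ) : Prop :=
  (∀ ε : ℝ, 0 < ε → IntegrableOn f {y : Rn n | ε < ‖x - y‖}) ∧
    Tendsto (truncInt x f) (𝓝[>] (0 : ℝ)) (𝓝 I)

/-- The value of the principal value integral `P.V. ∫ f(y) dy` around `x`
(meaningful when it exists, in the sense of `HasPV`). -/
def pv {n : ℕ} (x : Rn n) (f : Rn n → ℝ) : ℝ :=
  limUnder (𝓝[>] (0 : ℝ)) (truncInt x f)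

/-! ### Constants and kernels -/

/-- The digamma function `ψ = Γ' / Γ` on the reals. -/
def psi (x : ℝ) : ℝ := deriv Real.Gamma x / Real.Gamma x

/-- `c_{n,s} = 2^{2s} π^{-n/2} s Γ((n+2s)/2) / Γ(1-s)`. -/
def cConst (n : ℕ) (s : ℝ) : ℝ :=
  2 ^ (2 * s) * Real.pi ^ (-(n : ℝ) / 2) * s *
    (Real.Gamma (((n : ℝ) + 2 * s) / 2) / Real.Gamma (1 - s))

/-- `b_{n,s} = ln 4 + 1/s + ψ(1-s) + ψ((n+2s)/2)`, the logarithmic derivative of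
`s ↦ c_{n,s}`. -/
def bConst (n : ℕ) (s : ℝ) : ℝ :=
  Real.log 4 + 1 / s + psi (1 - s) + psi (((n : ℝ) + 2 * s) / 2)

/-- The integrand of the fractional Laplacian at `x`:
`(u(x) - u(y)) / |x - y|^{n+2s}`. -/
def fracIntegrand {n : ℕ} (s : ℝ) (u : Rn n → ℝ) (x y : Rn n) : ℝ :=
  (u x - u y) / ‖x - y‖ ^ ((n : ℝ) + 2 * s)

/-- The integrand of `L₁` at `x`:
`(u(x) - u(y)) / |x - y|^{n+2s} * (-2 ln |x - y|)`. -/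
def logIntegrand {n : ℕ} (s : ℝ) (u : Rn n → ℝ) (x y : Rn n) : ℝ :=
  (u x - u y) / ‖x - y‖ ^ ((n : ℝ) + 2 * s) * (-2 * Real.log ‖x - y‖)

/-- The kernel `K_{s+Log}(r) = c_{n,s} (b_{n,s} - 2 ln r) r^{-n-2s}`. -/
def kernelSLog (n : ℕ) (s r : ℝ) : ℝ :=
  cConst n s * (bConst n s - 2 * Real.log r) * r ^ (-(n : ℝ) - 2 * s)

/-! ### The operators on `C_c²(ℝⁿ)` -/

/-- The fractional Laplacian
`(-Δ)^s u(x) = c_{n,s} P.V. ∫ (u(x) - u(y)) / |x - y|^{n+2s} dy`. -/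
def fracLap {n : ℕ} (s : ℝ) (u : Rn n → ℝ) (x : Rn n) : ℝ :=
  cConst n s * pv x (fracIntegrand s u x)

/-- The operator
`L₁ u(x) = P.V. ∫ (u(x) - u(y)) / |x - y|^{n+2s} * (-2 ln |x - y|) dy`. -/
def opL1 {n : ℕ} (s : ℝ) (u : Rn n → ℝ) (x : Rn n) : ℝ :=
  pv x (logIntegrand s u x)

/-- The fractional-logarithmic Laplacian
`(-Δ)^{s+Log} u(x) = d/dt (-Δ)^t u(x)` at `t = s`. -/
def fracLogLap {n : ℕ} (s : ℝ) (u : Rn n → ℝ) (x : Rn n) : ℝ :=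
  deriv (fun t : ℝ => fracLap t u x) s

/-- `v = Log(-Δ) u`, the logarithmic Laplacian of `u`, that is,
`(-Δ)^t u = u + t v + o(t)` in `L^p(ℝⁿ)` as `t → 0⁺`, for every `1 < p ≤ ∞`.
This determines `v` almost everywhere. -/
def IsLogLap {n : ℕ} (u v : Rn n → ℝ) : Prop :=
  ∀ p : ℝ≥0∞, 1 < p → MemLp v p ∧
    Tendsto (fun t : ℝ => eLpNorm (fun x => (fracLap t u x - u x) / t - v x) p volume)
      (𝓝[>] (0 : ℝ)) (𝓝 0)

/-! ### The Fourier transform and Lizorkin distributions -/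

/-- The Fourier transform `(2π)^{-n/2} ∫ e^{-i ξ·x} f(x) dx`. -/
def fourierT {n : ℕ} (f : Rn n → ℂ) (ξ : Rn n) : ℂ :=
  (((2 * Real.pi) ^ (-(n : ℝ) / 2) : ℝ) : ℂ) *
    ∫ x : Rn n, Complex.exp (-Complex.I * (inner ℝ ξ x : ℝ)) * f x

/-- The inverse Fourier transform `(2π)^{-n/2} ∫ e^{i x·ξ} g(ξ) dξ`. -/
def invFourierT {n : ℕ} (g : Rn n → ℂ) (x : Rn n) : ℂ :=
  (((2 * Real.pi) ^ (-(n : ℝ) / 2) : ℝ) : ℂ) *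
    ∫ ξ : Rn n, Complex.exp (Complex.I * (inner ℝ x ξ : ℝ)) * g ξ

/-- The present normalization in terms of the one of Mathlib. -/
theorem fourierT_eq {n : ℕ} (f : Rn n → ℂ) (ξ : Rn n) :
    fourierT f ξ = (((2 * Real.pi) ^ (-(n : ℝ) / 2) : ℝ) : ℂ) *
      FourierTransform.fourier f ((2 * Real.pi)⁻¹ • ξ) := by
  unfold fourierT
  rw [Real.fourier_eq']
  congr 1
  refine integral_congr_ae (Filter.Eventually.of_forall fun x => ?_)
  have hpi : (Real.pi : ℂ) ≠ 0 := by exact_mod_cast Real.pi_ne_zero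
  simp only [smul_eq_mul, inner_smul_right, real_inner_comm x ξ]
  congr 2
  push_cast
  field_simp

theorem fourierT_add {n : ℕ} (φ ψ : 𝓢(Rn n, ℂ)) :
    fourierT (⇑(φ + ψ)) = fourierT φ + fourierT ψ := by
  funext ξ
  have h : FourierTransform.fourier (⇑(φ + ψ)) =
      FourierTransform.fourier (⇑φ) + FourierTransform.fourier (⇑ψ) := by
    simp only [← SchwartzMap.fourier_coe, FourierTransform.fourier_add]
    rfl
  simp only [Pi.add_apply, fourierT_eq, h, mul_add]

theorem fourierT_smul {n : ℕ} (c : ℂ) (φ : 𝓢(Rn n, ℂ)) :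
    fourierT (⇑(c • φ)) = c • fourierT φ := by
  funext ξ
  have h : FourierTransform.fourier (⇑(c • φ)) = c • FourierTransform.fourier (⇑φ) := by
    simp only [← SchwartzMap.fourier_coe, FourierTransform.fourier_smul]
    rfl
  simp only [Pi.smul_apply, fourierT_eq, h, smul_eq_mul]
  ring

theorem contDiff_fourierT {n : ℕ} (φ : 𝓢(Rn n, ℂ)) (k : ℕ) :
    ContDiff ℝ k (fourierT φ) := by
  have h : fourierT φ = fun ξ => (((2 * Real.pi) ^ (-(n : ℝ) / 2) : ℝ) : ℂ) *
      (FourierTransform.fourier φ : 𝓢(Rn n, ℂ)) ((2 * Real.pi)⁻¹ • ξ) := by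
    funext ξ
    rw [fourierT_eq, SchwartzMap.fourier_coe]
  rw [h]
  exact contDiff_const.mul
    (((FourierTransform.fourier φ : 𝓢(Rn n, ℂ)).smooth k).comp (contDiff_id.const_smul _))

/-- The Lizorkin space `Z(ℝⁿ)`: the Schwartz functions whose Fourier transform vanishes at the
origin together with all its derivatives, with the topology induced by the Schwartz space. -/
def lizorkin (n : ℕ) : Submodule ℂ 𝓢(Rn n, ℂ) where
  carrier := {φ | ∀ k : ℕ, iteratedFDeriv ℝ k (fourierT φ) 0 = 0}
  zero_mem' := by
    intro k
    have h : fourierT (⇑(0 : 𝓢(Rn n, ℂ))) = fun _ => 0 := by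
      funext ξ
      simp [fourierT]
    rw [h]
    simp
  add_mem' := by
    intro φ ψ hφ hψ k
    rw [fourierT_add, iteratedFDeriv_add_apply (contDiff_fourierT φ k).contDiffAt
      (contDiff_fourierT ψ k).contDiffAt, hφ k, hψ k, add_zero]
  smul_mem' := by
    intro c φ hφ k
    rw [fourierT_smul, iteratedFDeriv_const_smul_apply (contDiff_fourierT φ k).contDiffAt,
      hφ k, smul_zero]

/-- The space `Z'(ℝⁿ)` of continuous linear functionals on the Lizorkin space. -/
abbrev LizorkinDual (n : ℕ) : Type := lizorkin n →L[ℂ] ℂ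

/-- `T : Z(ℝⁿ) → Z(ℝⁿ)` is the Fourier multiplier `φ ↦ F⁻¹(a φ̂)` with symbol `a`. -/
def IsMultiplier {n : ℕ} (a : Rn n → ℝ) (T : lizorkin n →L[ℂ] lizorkin n) : Prop :=
  ∀ (φ : lizorkin n) (x : Rn n),
    (T φ : 𝓢(Rn n, ℂ)) x =
      invFourierT (fun ξ => (a ξ : ℂ) * fourierT (φ : 𝓢(Rn n, ℂ)) ξ) x

open Classical in
/-- The Fourier multiplier `φ ↦ F⁻¹(a φ̂)` on the Lizorkin space, whenever it is a
continuous linear map of the Lizorkin space into itself (and zero otherwise). -/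
def multiplier {n : ℕ} (a : Rn n → ℝ) : lizorkin n →L[ℂ] lizorkin n :=
  if h : ∃ T : lizorkin n →L[ℂ] lizorkin n, IsMultiplier a T then h.choose else 0

/-- The operator `A(D) : Z'(ℝⁿ) → Z'(ℝⁿ)` with symbol `a`, defined by duality:
`⟨A(D) u, φ⟩ = ⟨u, F⁻¹(a φ̂)⟩`. -/
def opD {n : ℕ} (a : Rn n → ℝ) : LizorkinDual n →L[ℂ] LizorkinDual n :=
  ContinuousLinearMap.precomp ℂ (multiplier a)

/-- The symbol `|ξ|^{2s}` of `(-Δ)^s`. -/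
def symFrac {n : ℕ} (s : ℝ) (ξ : Rn n) : ℝ := ‖ξ‖ ^ (2 * s)

/-- The symbol `2 ln |ξ|` of `Log(-Δ)`. -/
def symLog {n : ℕ} (ξ : Rn n) : ℝ := 2 * Real.log ‖ξ‖

/-- The symbol `|ξ|^{2s} (2 ln |ξ|)` of `(-Δ)^{s+Log}`. -/
def symFracLog {n : ℕ} (s : ℝ) (ξ : Rn n) : ℝ := ‖ξ‖ ^ (2 * s) * (2 * Real.log ‖ξ‖)

end

/-! Everything rests on one absolutely convergent integral. Averaging over h and -h turns a
principal value with an even kernel K into ½ ∫ D(x,h) K(h) dh, where D is the second difference, and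
|D(x,h)| ≤ C min(1, |h|²) because u is C² with compact support (`hasPV_of_even_kernel`). For K =
|h|^{-n-2t} (-2 ln |h|)^k with 0 < t < 1 this converges. A power of the logarithm costs only an
arbitrarily small power of |h|, so near a given t all these kernels are dominated by two pure
powers, and differentiating under the integral raises k by one
(`integrable_and_hasDerivAt_integral_powKernel`). Together with c' = b c (`hasDerivAt_cConst`), the
product rule gives items 1 and 2.

For item 3, D is also bounded in L¹(dx) by a multiple of min(1, |h|²), so Fubini applies and the
Fourier transform of ½ ∫ D K is û(ξ) ∫ (1 - cos ξ·h) K(h) dh. For the pure power kernel the last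
integral is found by writing |h|^{-n-2s} as a superposition of Gaussians
(`cConst_mul_integral_one_sub_cos`); differentiating the resulting identity in s yields the
logarithmic symbol.

For item 5, as t → 0⁺ the integral over |h| > 1 of the kernel diverges like 1/t, while c_{n,t}
vanishes like t. Cutting at |h| = 1 isolates this cancellation: (-Δ)^t u = A(t) (u + t Z_t), where
A(0) = 1 and both A and Z_t are smooth in t across 0 (`fracLap_eq_expansion`). Bounding the second
t-derivative shows that the difference quotient at 0 and the derivative at t have the same limit,
both with error at most t C (1 + |x|)^{-(n-δ)}. That weight lies in L^p for some small δ as soon as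
p > 1, so this limit is Log(-Δ)u, and uniqueness carries the convergence over to every
representative.

For item 4, the Fourier transform carries Z to the Schwartz functions that are flat at the origin.
The symbols and their derivatives grow at most polynomially in |ξ| and 1/|ξ|, and flatness absorbs
any power of 1/|ξ|, so multiplication is continuous on flat functions (`smulFlatCLM`). Composition
of multipliers multiplies symbols, and duality transfers the two factorizations to Z'. -/

noncomputable section

/-! ### Second differences of `C_c²` functions -/

/-- The second difference `2u(x) - u(x+h) - u(x-h)`. -/
def secondDiff {n : ℕ} (u : Rn n → ℝ) (x h : Rn n) : ℝ :=
  2 * u x - u (x + h) - u (x - h)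

theorem IsCc2.continuous {n : ℕ} {u : Rn n → ℝ} (hu : IsCc2 u) : Continuous u :=
  hu.1.continuous

theorem IsCc2.integrable {n : ℕ} {u : Rn n → ℝ} (hu : IsCc2 u) : Integrable u :=
  hu.continuous.integrable_of_hasCompactSupport hu.2

theorem IsCc2.exists_bound {n : ℕ} {u : Rn n → ℝ} (hu : IsCc2 u) :
    ∃ M : ℝ, 0 < M ∧ ∀ x, |u x| ≤ M := by
  obtain ⟨C, hC⟩ := hu.2.exists_bound_of_continuous hu.continuous
  refine ⟨max C 1, by positivity, fun x => ?_⟩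
  exact (hC x).trans (le_max_left _ _)

theorem IsCc2.exists_radius {n : ℕ} {u : Rn n → ℝ} (hu : IsCc2 u) :
    ∃ R : ℝ, 0 < R ∧ ∀ x, R < ‖x‖ → u x = 0 := by
  obtain ⟨R, hR⟩ := hu.2.isCompact.isBounded.subset_closedBall (0 : Rn n)
  refine ⟨max R 1, by positivity, fun x hx => ?_⟩
  by_contra h
  have := hR (subset_tsupport u h)
  rw [mem_closedBall_zero_iff] at this
  exact absurd hx (not_lt.2 (this.trans (le_max_left _ _)))

theorem continuous_secondDiff {n : ℕ} {u : Rn n → ℝ} (hu : Continuous u) :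
    Continuous (fun p : Rn n × Rn n => secondDiff u p.1 p.2) := by
  unfold secondDiff
  fun_prop

theorem continuous_secondDiff_right {n : ℕ} {u : Rn n → ℝ} (hu : Continuous u) (x : Rn n) :
    Continuous (secondDiff u x) := by
  unfold secondDiff
  fun_prop

/-- Mean value inequality on [0,1] for τ ↦ u(x + τh) + u(x - τh): its derivative is (Du(x + τh) -
Du(x - τh))h, and Du, being C¹ with compact support, is globally Lipschitz. -/
theorem IsCc2.abs_secondDiff_le_sq {n : ℕ} {u : Rn n → ℝ} (hu : IsCc2 u) :
    ∃ L : ℝ, 0 ≤ L ∧ ∀ x h, |secondDiff u x h| ≤ L * ‖h‖ ^ 2 := by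
  have hd : ContDiff ℝ 1 (fderiv ℝ u) := hu.1.fderiv_right (by norm_num)
  obtain ⟨L, hL⟩ := hd.lipschitzWith_of_hasCompactSupport (hu.2.fderiv ℝ) (by norm_num)
  refine ⟨2 * L, by positivity, fun x h => ?_⟩
  have hdiff : Differentiable ℝ u := hu.1.differentiable (by norm_num)
  have key := norm_image_sub_le_of_norm_deriv_le_segment_01'
    (f := fun τ : ℝ => u (x + τ • h) + u (x - τ • h))
    (f' := fun τ : ℝ => fderiv ℝ u (x + τ • h) h - fderiv ℝ u (x - τ • h) h)
    (C := 2 * L * ‖h‖ ^ 2) ?_ ?_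
  · simp only [one_smul, zero_smul, add_zero, sub_zero, Real.norm_eq_abs] at key
    rw [secondDiff, ← abs_neg]
    convert key using 2
    ring
  · intro τ _
    have h1 : HasDerivAt (fun τ : ℝ => x + τ • h) h τ := by
      simpa using ((hasDerivAt_id τ).smul_const h).const_add x
    have h2 : HasDerivAt (fun τ : ℝ => x - τ • h) (-h) τ := by
      simpa using ((hasDerivAt_id τ).smul_const h).const_sub x
    have h3 := (hdiff (x + τ • h)).hasFDerivAt.comp_hasDerivAt τ h1
    have h4 := (hdiff (x - τ • h)).hasFDerivAt.comp_hasDerivAt τ h2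
    refine ((h3.add h4).congr_deriv ?_).hasDerivWithinAt
    rw [map_neg]
    exact (sub_eq_add_neg _ _).symm
  · intro τ hτ
    have h1 := hL.dist_le_mul (x + τ • h) (x - τ • h)
    rw [dist_eq_norm, dist_eq_norm] at h1
    have h2 : x + τ • h - (x - τ • h) = (2 * τ) • h := by
      rw [mul_smul, two_smul]; abel
    rw [h2, norm_smul, Real.norm_eq_abs, abs_of_nonneg (by linarith [hτ.1])] at h1
    calc ‖fderiv ℝ u (x + τ • h) h - fderiv ℝ u (x - τ • h) h‖
        ≤ ‖fderiv ℝ u (x + τ • h) - fderiv ℝ u (x - τ • h)‖ * ‖h‖ :=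
          (fderiv ℝ u (x + τ • h) - fderiv ℝ u (x - τ • h)).le_opNorm h
      _ ≤ (L * (2 * τ * ‖h‖)) * ‖h‖ := by gcongr
      _ ≤ (L * (2 * 1 * ‖h‖)) * ‖h‖ := by gcongr; exact hτ.2.le
      _ = 2 * L * ‖h‖ ^ 2 := by ring

theorem IsCc2.abs_secondDiff_le {n : ℕ} {u : Rn n → ℝ} (hu : IsCc2 u) :
    ∃ C : ℝ, 0 ≤ C ∧ ∀ x h, |secondDiff u x h| ≤ C * min 1 (‖h‖ ^ 2) := by
  obtain ⟨L, hL0, hL⟩ := hu.abs_secondDiff_le_sq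
  obtain ⟨M, hM0, hM⟩ := hu.exists_bound
  refine ⟨max L (4 * M), by positivity, fun x h => ?_⟩
  rw [mul_min_of_nonneg _ _ (by positivity)]
  refine le_min ?_ ((hL x h).trans (by gcongr; exact le_max_left _ _))
  rw [mul_one]
  refine le_trans ?_ (le_max_right _ _)
  have h1 := abs_le.1 (hM x)
  have h2 := abs_le.1 (hM (x + h))
  have h3 := abs_le.1 (hM (x - h))
  rw [secondDiff, abs_le]
  constructor <;> linarith

/-! ### Principal values with even kernels -/

theorem integrable_mul_of_le_min {n : ℕ} {f K : Rn n → ℝ} {C : ℝ}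
    (hf : AEStronglyMeasurable f) (hK : AEStronglyMeasurable K)
    (hfC : ∀ h, |f h| ≤ C * min 1 (‖h‖ ^ 2))
    (hKi : Integrable fun h => min 1 (‖h‖ ^ 2) * K h) :
    Integrable fun h => f h * K h := by
  refine (hKi.norm.const_mul C).mono' (hf.mul hK) (Eventually.of_forall fun h => ?_)
  have h0 : (0 : ℝ) ≤ min 1 (‖h‖ ^ 2) := by positivity
  rw [norm_mul, norm_mul, Real.norm_of_nonneg h0, ← mul_assoc]
  exact mul_le_mul_of_nonneg_right (hfC h) (norm_nonneg _)

theorem integrableOn_of_integrable_min {n : ℕ} {K : Rn n → ℝ} (hK : AEStronglyMeasurable K)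
    (hKi : Integrable fun h => min 1 (‖h‖ ^ 2) * K h) {ε : ℝ} (hε : 0 < ε) :
    IntegrableOn K {h | ε < ‖h‖} := by
  have h0 : 0 < min 1 (ε ^ 2) := by positivity
  refine Integrable.mono' (hKi.norm.const_mul (min 1 (ε ^ 2))⁻¹).integrableOn hK.restrict ?_
  have hm : MeasurableSet {h : Rn n | ε < ‖h‖} := measurableSet_lt measurable_const measurable_norm
  filter_upwards [ae_restrict_mem hm] with h hh
  have h1 : (0 : ℝ) ≤ min 1 (‖h‖ ^ 2) := by positivity
  rw [norm_mul, Real.norm_of_nonneg h1, ← mul_assoc]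
  have : min 1 (ε ^ 2) ≤ min 1 (‖h‖ ^ 2) := by
    have : ε < ‖h‖ := hh
    gcongr
  refine le_mul_of_one_le_left (norm_nonneg _) ?_
  rw [inv_mul_eq_div, one_le_div h0]
  exact this

/-- The reflection h ↦ -h preserves both K and the truncation region, so each truncated integral is
half that of the second difference. The latter is integrable up to the singularity, and dominated
convergence removes the truncation. -/
theorem hasPV_of_even_kernel {n : ℕ} {u K : Rn n → ℝ} (hu : IsCc2 u)
    (hK : AEStronglyMeasurable K) (hKe : ∀ h, K (-h) = K h)
    (hKi : Integrable fun h => min 1 (‖h‖ ^ 2) * K h) (x : Rn n) :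
    HasPV x (fun y => (u x - u y) * K (x - y)) ((∫ h, secondDiff u x h * K h) / 2) := by
  obtain ⟨C, hC0, hC⟩ := hu.abs_secondDiff_le
  obtain ⟨M, hM0, hM⟩ := hu.exists_bound
  have hcont := hu.continuous
  have hm : ∀ ε : ℝ, MeasurableSet {h : Rn n | ε < ‖h‖} := fun ε =>
    measurableSet_lt measurable_const measurable_norm
  have hint1 : ∀ ε : ℝ, 0 < ε → IntegrableOn (fun h => (u x - u (x - h)) * K h) {h | ε < ‖h‖} := by
    intro ε hε
    refine (integrableOn_of_integrable_min hK hKi hε).bdd_mul (c := 2 * M)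
      (Continuous.aestronglyMeasurable (by fun_prop)) (Eventually.of_forall fun h => ?_)
    have h1 := abs_le.1 (hM x)
    have h2 := abs_le.1 (hM (x - h))
    rw [Real.norm_eq_abs, abs_le]
    constructor <;> linarith
  have hind : ∀ ε : ℝ, (fun y => ({h : Rn n | ε < ‖h‖}).indicator
      (fun h => (u x - u (x - h)) * K h) (x - y)) =
      ({y : Rn n | ε < ‖x - y‖}).indicator (fun y => (u x - u y) * K (x - y)) := by
    intro ε
    funext y
    simp only [Set.indicator, Set.mem_ofPred_eq, sub_sub_cancel]
  have hmx : ∀ ε : ℝ, MeasurableSet {y : Rn n | ε < ‖x - y‖} := fun ε =>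
    measurableSet_lt measurable_const (by fun_prop)
  have htrunc : ∀ ε : ℝ, 0 < ε → truncInt x (fun y => (u x - u y) * K (x - y)) ε =
      (∫ h in {h | ε < ‖h‖}, secondDiff u x h * K h) / 2 := by
    intro ε hε
    have e1 : truncInt x (fun y => (u x - u y) * K (x - y)) ε =
        ∫ h in {h | ε < ‖h‖}, (u x - u (x - h)) * K h := by
      rw [truncInt, ← integral_indicator (hmx ε), ← hind ε,
        integral_sub_left_eq_self (μ := volume) (fun h => ({h : Rn n | ε < ‖h‖}).indicator
          (fun h => (u x - u (x - h)) * K h) h) x, integral_indicator (hm ε)]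
    have hneg : (fun h => ({h : Rn n | ε < ‖h‖}).indicator
        (fun h => (u x - u (x - h)) * K h) (-h)) =
        ({h : Rn n | ε < ‖h‖}).indicator (fun h => (u x - u (x + h)) * K h) := by
      funext h
      simp only [Set.indicator, Set.mem_ofPred_eq, norm_neg, sub_neg_eq_add, hKe]
    have e2 : ∫ h in {h | ε < ‖h‖}, (u x - u (x - h)) * K h =
        ∫ h in {h | ε < ‖h‖}, (u x - u (x + h)) * K h := by
      rw [← integral_indicator (hm ε), ← integral_neg_eq_self, hneg, integral_indicator (hm ε)]
    have hint2 : IntegrableOn (fun h => (u x - u (x + h)) * K h) {h | ε < ‖h‖} := by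
      have := ((integrable_indicator_iff (hm ε)).2 (hint1 ε hε)).comp_neg
      rw [hneg] at this
      exact (integrable_indicator_iff (hm ε)).1 this
    have e3 : ∫ h in {h | ε < ‖h‖}, secondDiff u x h * K h =
        (∫ h in {h | ε < ‖h‖}, (u x - u (x - h)) * K h) +
        ∫ h in {h | ε < ‖h‖}, (u x - u (x + h)) * K h := by
      rw [← integral_add (hint1 ε hε) hint2]
      congr 1
      funext h
      rw [secondDiff]
      ring
    rw [e1, e3, ← e2]
    ring
  refine ⟨fun ε hε => ?_, ?_⟩
  · have := ((integrable_indicator_iff (hm ε)).2 (hint1 ε hε)).comp_sub_left x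
    rw [hind ε] at this
    exact (integrable_indicator_iff (hmx ε)).1 this
  · have hDi : Integrable fun h => secondDiff u x h * K h :=
      integrable_mul_of_le_min (continuous_secondDiff_right hcont x).aestronglyMeasurable hK
        (hC x) hKi
    have hlim : Tendsto (fun ε : ℝ => ∫ h in {h : Rn n | ε < ‖h‖}, secondDiff u x h * K h)
        (𝓝[>] 0) (𝓝 (∫ h, secondDiff u x h * K h)) := by
      have : ∀ ε : ℝ, ∫ h in {h : Rn n | ε < ‖h‖}, secondDiff u x h * K h =
          ∫ h, ({h : Rn n | ε < ‖h‖}).indicator (fun h => secondDiff u x h * K h) h :=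
        fun ε => (integral_indicator (hm ε)).symm
      simp_rw [this]
      refine tendsto_integral_filter_of_dominated_convergence _
        (Eventually.of_forall fun ε => hDi.aestronglyMeasurable.indicator (hm ε))
        (Eventually.of_forall fun ε => Eventually.of_forall fun h =>
          norm_indicator_le_norm_self _ _) hDi.norm (Eventually.of_forall fun h => ?_)
      -- The origin is the one point that no truncated region ever contains; the second difference
      -- vanishes there, so no hypothesis on K at 0 is needed.
      by_cases hh : h = 0
      · subst hh
        have h0 : secondDiff u x 0 = 0 := by simp [secondDiff, two_mul]
        simp [Set.indicator, h0]
      · have hp : 0 < ‖h‖ := norm_pos_iff.2 hh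
        refine tendsto_const_nhds.congr' ?_
        filter_upwards [nhdsWithin_le_nhds (Iio_mem_nhds hp)] with ε hε
        rw [Set.indicator_of_mem]
        exact hε
    refine (hlim.div_const 2).congr' ?_
    filter_upwards [self_mem_nhdsWithin] with ε hε
    exact (htrunc ε hε).symm

theorem HasPV.pv_eq {n : ℕ} {x : Rn n} {f : Rn n → ℝ} {I : ℝ} (h : HasPV x f I) : pv x f = I :=
  h.2.limUnder_eq

/-! ### Power kernels with logarithmic factors -/

/-- The kernel `|h|^{-n-2t} (-2 ln |h|)^k`, the `k`-th derivative in `t` of `|h|^{-n-2t}`. -/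
def powKernel (n k : ℕ) (t : ℝ) (h : Rn n) : ℝ :=
  ‖h‖ ^ (-(n : ℝ) - 2 * t) * (-2 * Real.log ‖h‖) ^ k

theorem powKernel_neg {n k : ℕ} (t : ℝ) (h : Rn n) : powKernel n k t (-h) = powKernel n k t h := by
  simp [powKernel]

theorem measurable_powKernel (n k : ℕ) (t : ℝ) : Measurable (powKernel n k t) := by
  unfold powKernel
  fun_prop

theorem powKernel_zero_nonneg {n : ℕ} (t : ℝ) (h : Rn n) : 0 ≤ powKernel n 0 t h := by
  unfold powKernel
  positivity

theorem rpow_le_rpow_add_rpow {r p q s : ℝ} (hr : 0 < r) (hpq : p ≤ q) (hqs : q ≤ s) :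
    r ^ q ≤ r ^ p + r ^ s := by
  have h1 := Real.rpow_pos_of_pos hr p
  have h2 := Real.rpow_pos_of_pos hr s
  rcases le_total 1 r with h | h
  · linarith [Real.rpow_le_rpow_of_exponent_le h hqs]
  · linarith [Real.rpow_le_rpow_of_exponent_ge hr h hpq]

/-- From ln r ≤ r^η / η with η = ε/(k+1); dividing by k+1 instead of k keeps η meaningful for k = 0
and still gives total exponent kη ≤ ε. -/
theorem two_mul_log_pow_le {k : ℕ} {ε r : ℝ} (hε : 0 < ε) (hr : 1 ≤ r) :
    (2 * Real.log r) ^ k ≤ (2 * (k + 1) / ε) ^ k * r ^ ε := by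
  have hr0 : 0 < r := by linarith
  have hδ : 0 < ε / (k + 1) := by positivity
  have h1 : 2 * Real.log r ≤ 2 * (k + 1) / ε * r ^ (ε / (k + 1)) := by
    have := Real.log_le_rpow_div hr0.le hδ
    calc 2 * Real.log r ≤ 2 * (r ^ (ε / (k + 1)) / (ε / (k + 1))) := by gcongr
      _ = _ := by field_simp
  have h0 : 0 ≤ 2 * Real.log r := by have := Real.log_nonneg hr; positivity
  calc (2 * Real.log r) ^ k ≤ (2 * (k + 1) / ε * r ^ (ε / (k + 1))) ^ k := by gcongr
    _ = (2 * (k + 1) / ε) ^ k * r ^ (ε / (k + 1) * k) := by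
      rw [mul_pow, ← Real.rpow_natCast (r ^ (ε / (k + 1))), ← Real.rpow_mul hr0.le]
    _ ≤ _ := by
      gcongr 1
      refine Real.rpow_le_rpow_of_exponent_le hr ?_
      · rw [div_mul_eq_mul_div, div_le_iff₀ (by positivity)]
        gcongr
        linarith

theorem abs_log_pow_le {k : ℕ} {ε r : ℝ} (hε : 0 < ε) (hr : 0 < r) :
    |(-2 * Real.log r) ^ k| ≤ (2 * (k + 1) / ε) ^ k * (r ^ ε + r ^ (-ε)) := by
  have h1 := Real.rpow_pos_of_pos hr ε
  have h2 := Real.rpow_pos_of_pos hr (-ε)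
  rw [abs_pow]
  rcases le_total 1 r with h | h
  · have : |-2 * Real.log r| = 2 * Real.log r := by
      rw [neg_mul, abs_neg, abs_of_nonneg]
      have := Real.log_nonneg h
      positivity
    rw [this]
    refine (two_mul_log_pow_le hε h).trans ?_
    gcongr
    linarith
  · have : |-2 * Real.log r| = 2 * Real.log r⁻¹ := by
      rw [Real.log_inv, abs_of_nonneg]
      · ring
      · linarith [Real.log_nonpos hr.le h]
    rw [this]
    refine (two_mul_log_pow_le hε ((one_le_inv₀ hr).2 h)).trans ?_
    gcongr
    rw [Real.inv_rpow hr.le, ← Real.rpow_neg hr.le]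
    linarith

/-- The logarithm shifts the exponent -n-2t by at most ε either way, which leaves it between -n-2b
and -n-2a; an intermediate power is at most the sum of the two extreme ones. The bound no longer
depends on t, as a dominating function must not. -/
theorem abs_powKernel_le {n k : ℕ} {a b ε t : ℝ} (hε : 0 < ε) (hat : a + ε ≤ t) (htb : t + ε ≤ b)
    {h : Rn n} (hh : h ≠ 0) :
    |powKernel n k t h| ≤
      2 * (2 * (k + 1) / ε) ^ k * (powKernel n 0 a h + powKernel n 0 b h) := by
  have hr : 0 < ‖h‖ := norm_pos_iff.2 hh
  simp only [powKernel, pow_zero, mul_one]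
  rw [abs_mul, abs_of_nonneg (by positivity)]
  calc ‖h‖ ^ (-(n : ℝ) - 2 * t) * |(-2 * Real.log ‖h‖) ^ k|
      ≤ ‖h‖ ^ (-(n : ℝ) - 2 * t) *
        ((2 * (k + 1) / ε) ^ k * (‖h‖ ^ ε + ‖h‖ ^ (-ε))) := by
        gcongr
        exact abs_log_pow_le hε hr
    _ = (2 * (k + 1) / ε) ^ k *
        (‖h‖ ^ (-(n : ℝ) - 2 * t + ε) + ‖h‖ ^ (-(n : ℝ) - 2 * t + -ε)) := by
        rw [Real.rpow_add hr, Real.rpow_add hr]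
        ring
    _ ≤ (2 * (k + 1) / ε) ^ k *
        ((‖h‖ ^ (-(n : ℝ) - 2 * b) + ‖h‖ ^ (-(n : ℝ) - 2 * a)) +
        (‖h‖ ^ (-(n : ℝ) - 2 * b) + ‖h‖ ^ (-(n : ℝ) - 2 * a))) := by
        gcongr
        · exact rpow_le_rpow_add_rpow hr (by linarith) (by linarith)
        · exact rpow_le_rpow_add_rpow hr (by linarith) (by linarith)
    _ = _ := by ring

theorem hasDerivAt_powKernel {n k : ℕ} {t : ℝ} {h : Rn n} (hh : h ≠ 0) :
    HasDerivAt (fun τ => powKernel n k τ h) (powKernel n (k + 1) t h) t := by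
  have hr : 0 < ‖h‖ := norm_pos_iff.2 hh
  have h1 : HasDerivAt (fun τ : ℝ => -(n : ℝ) - 2 * τ) (-2) t := by
    simpa using ((hasDerivAt_id t).const_mul (2 : ℝ)).const_sub (-(n : ℝ))
  have h2 := (h1.const_rpow hr).mul_const ((-2 * Real.log ‖h‖) ^ k)
  refine h2.congr_deriv ?_
  simp only [powKernel]
  ring

theorem ae_ne_zero {n : ℕ} (hn : 1 ≤ n) : ∀ᵐ h : Rn n, h ≠ 0 := by
  have : Nonempty (Fin n) := ⟨⟨0, hn⟩⟩
  have : Nontrivial (Rn n) := inferInstance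
  exact Measure.ae_ne volume 0

/-- Differentiation of `∫ f(h) |h|^{-n-2t} (-2 ln |h|)^k dh` under the integral sign. -/
theorem integrable_and_hasDerivAt_integral_powKernel {n : ℕ} (hn : 1 ≤ n) {f : Rn n → ℝ}
    (hf : AEStronglyMeasurable f) {a b t : ℝ} (hat : a < t) (htb : t < b)
    (ha : Integrable fun h => f h * powKernel n 0 a h)
    (hb : Integrable fun h => f h * powKernel n 0 b h) (k : ℕ) :
    (Integrable fun h => f h * powKernel n k t h) ∧
      HasDerivAt (fun τ => ∫ h, f h * powKernel n k τ h)
        (∫ h, f h * powKernel n (k + 1) t h) t := by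
  -- The margin is 2ε: one ε for the neighbourhood of t in which τ varies, one for absorbing the
  -- logarithms.
  obtain ⟨ε, hε, h1, h2⟩ : ∃ ε : ℝ, 0 < ε ∧ a + 2 * ε ≤ t ∧ t + 2 * ε ≤ b := by
    refine ⟨min ((t - a) / 2) ((b - t) / 2), lt_min (by linarith) (by linarith), ?_, ?_⟩
    · linarith [min_le_left ((t - a) / 2) ((b - t) / 2)]
    · linarith [min_le_right ((t - a) / 2) ((b - t) / 2)]
  have hmeas : ∀ (k : ℕ) (τ : ℝ), AEStronglyMeasurable (fun h => f h * powKernel n k τ h) :=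
    fun k τ => hf.mul (measurable_powKernel n k τ).aestronglyMeasurable
  have hbd : ∀ (k : ℕ), ∀ᵐ h : Rn n, ∀ τ ∈ Set.Icc (t - ε) (t + ε),
      ‖f h * powKernel n k τ h‖ ≤ 2 * (2 * (k + 1) / ε) ^ k *
        (‖f h * powKernel n 0 a h‖ + ‖f h * powKernel n 0 b h‖) := by
    intro k
    filter_upwards [ae_ne_zero hn] with h hh τ hτ
    have := abs_powKernel_le (k := k) hε (a := a) (b := b) (t := τ) (by linarith [hτ.1])
      (by linarith [hτ.2]) hh
    rw [norm_mul, norm_mul, norm_mul, Real.norm_of_nonneg (powKernel_zero_nonneg a h),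
      Real.norm_of_nonneg (powKernel_zero_nonneg b h), Real.norm_eq_abs (powKernel n k τ h)]
    refine (mul_le_mul_of_nonneg_left this (norm_nonneg (f h))).trans_eq ?_
    ring
  have hdom : ∀ C : ℝ, Integrable (fun h => C *
      (‖f h * powKernel n 0 a h‖ + ‖f h * powKernel n 0 b h‖)) :=
    fun C => (ha.norm.add hb.norm).const_mul C
  have hint : Integrable fun h => f h * powKernel n k t h :=
    (hdom _).mono' (hmeas k t) ((hbd k).mono fun h hh => hh t ⟨by linarith, by linarith⟩)
  refine ⟨hint, (hasDerivAt_integral_of_dominated_loc_of_deriv_le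
    (Icc_mem_nhds (by linarith) (by linarith)) (Eventually.of_forall fun τ => hmeas k τ) hint
    (hmeas (k + 1) t) (hbd (k + 1)) (hdom _) ?_).2⟩
  filter_upwards [ae_ne_zero hn] with h hh τ _
  exact (hasDerivAt_powKernel hh).const_mul (f h)

/-- In polar coordinates the radial integrand is r^{1-2t} near 0, integrable since t < 1, and
r^{-1-2t} near infinity, integrable since t > 0. -/
theorem integrable_min_mul_powKernel_zero {n : ℕ} (hn : 1 ≤ n) {t : ℝ} (h0 : 0 < t) (h1 : t < 1) :
    Integrable fun h : Rn n => min 1 (‖h‖ ^ 2) * powKernel n 0 t h := by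
  have : Nonempty (Fin n) := ⟨⟨0, hn⟩⟩
  have : Nontrivial (Rn n) := inferInstance
  have key := (integrable_fun_norm_addHaar (volume : Measure (Rn n))
    (f := fun r : ℝ => min 1 (r ^ 2) * r ^ (-(n : ℝ) - 2 * t))).2 ?_
  · simpa [powKernel] using key
  rw [finrank_euclideanSpace, Fintype.card_fin]
  have hpow : ∀ r : ℝ, 0 < r → r ^ (n - 1) * r ^ (-(n : ℝ) - 2 * t) = r ^ (-1 - 2 * t) := by
    intro r hr
    rw [← Real.rpow_natCast, ← Real.rpow_add hr, Nat.cast_sub hn]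
    congr 1
    push_cast
    ring
  rw [← Set.Ioc_union_Ioi_eq_Ioi (zero_le_one' ℝ)]
  refine IntegrableOn.union ?_ ?_
  · have : IntegrableOn (fun r : ℝ => r ^ (1 - 2 * t)) (Set.Ioc 0 1) :=
      (intervalIntegrable_iff_integrableOn_Ioc_of_le zero_le_one).1
        (intervalIntegral.intervalIntegrable_rpow' (by linarith))
    refine this.congr_fun (fun r hr => ?_) measurableSet_Ioc
    have hr2 : r ^ 2 ≤ 1 := pow_le_one₀ hr.1.le hr.2
    simp only [smul_eq_mul]
    rw [min_eq_right hr2, mul_left_comm, hpow r hr.1, ← Real.rpow_natCast, ← Real.rpow_add hr.1]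
    congr 1
    push_cast
    ring
  · have : IntegrableOn (fun r : ℝ => r ^ (-1 - 2 * t)) (Set.Ioi 1) :=
      integrableOn_Ioi_rpow_of_lt (by linarith) zero_lt_one
    refine this.congr_fun (fun r hr => ?_) measurableSet_Ioi
    have hr1 : (1 : ℝ) < r := hr
    have hr2 : 1 ≤ r ^ 2 := one_le_pow₀ hr1.le
    simp only [smul_eq_mul]
    rw [min_eq_left hr2, one_mul, hpow r (by linarith)]

theorem aestronglyMeasurable_min {n : ℕ} :
    AEStronglyMeasurable (fun h : Rn n => min 1 (‖h‖ ^ 2)) :=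
  Continuous.aestronglyMeasurable (by fun_prop)

theorem integrable_min_mul_powKernel {n : ℕ} (hn : 1 ≤ n) (k : ℕ) {t : ℝ} (h0 : 0 < t)
    (h1 : t < 1) : Integrable fun h : Rn n => min 1 (‖h‖ ^ 2) * powKernel n k t h :=
  (integrable_and_hasDerivAt_integral_powKernel hn aestronglyMeasurable_min
    (a := t / 2) (b := (t + 1) / 2) (by linarith) (by linarith)
    (integrable_min_mul_powKernel_zero hn (by linarith) (by linarith))
    (integrable_min_mul_powKernel_zero hn (by linarith) (by linarith)) k).1

theorem hasDerivAt_integral_mul_powKernel {n : ℕ} (hn : 1 ≤ n) {f : Rn n → ℝ} {C : ℝ}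
    (hf : AEStronglyMeasurable f) (hfC : ∀ h, |f h| ≤ C * min 1 (‖h‖ ^ 2)) (k : ℕ) {t : ℝ}
    (h0 : 0 < t) (h1 : t < 1) :
    HasDerivAt (fun τ => ∫ h, f h * powKernel n k τ h) (∫ h, f h * powKernel n (k + 1) t h) t := by
  have hi : ∀ τ : ℝ, 0 < τ → τ < 1 → Integrable fun h => f h * powKernel n 0 τ h :=
    fun τ hτ0 hτ1 => integrable_mul_of_le_min hf (measurable_powKernel n 0 τ).aestronglyMeasurable
      hfC (integrable_min_mul_powKernel hn 0 hτ0 hτ1)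
  exact (integrable_and_hasDerivAt_integral_powKernel hn hf
    (a := t / 2) (b := (t + 1) / 2) (by linarith) (by linarith)
    (hi _ (by linarith) (by linarith)) (hi _ (by linarith) (by linarith)) k).2

/-! ### The constant `c_{n,s}` -/

/-- Logarithmic differentiation factor by factor: 2^{2s} gives 2 ln 2 = ln 4, s gives 1/s, and the
two Gamma factors give ψ((n+2s)/2) and ψ(1-s), the latter positive because the sign of 1-s and the
division cancel. -/
theorem hasDerivAt_cConst {n : ℕ} (hn : 1 ≤ n) {s : ℝ} (h0 : 0 < s) (h1 : s < 1) :
    HasDerivAt (cConst n) (bConst n s * cConst n s) s := by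
  have hn' : (1 : ℝ) ≤ n := by exact_mod_cast hn
  have hA : 0 < ((n : ℝ) + 2 * s) / 2 := by positivity
  have hB : 0 < 1 - s := by linarith
  have hGA := Real.Gamma_pos_of_pos hA
  have hGB := Real.Gamma_pos_of_pos hB
  have dA : HasDerivAt Real.Gamma (deriv Real.Gamma (((n : ℝ) + 2 * s) / 2))
      (((n : ℝ) + 2 * s) / 2) :=
    (Real.differentiableAt_Gamma fun m => by have : (0:ℝ) ≤ m := m.cast_nonneg; linarith).hasDerivAt
  have dB : HasDerivAt Real.Gamma (deriv Real.Gamma (1 - s)) (1 - s) :=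
    (Real.differentiableAt_Gamma fun m => by have : (0:ℝ) ≤ m := m.cast_nonneg; linarith).hasDerivAt
  have eA : HasDerivAt (fun s : ℝ => ((n : ℝ) + 2 * s) / 2) 1 s := by
    simpa using (((hasDerivAt_id s).const_mul (2 : ℝ)).const_add (n : ℝ)).div_const 2
  have eB : HasDerivAt (fun s : ℝ => 1 - s) (-1) s := by
    simpa using (hasDerivAt_id s).const_sub (1 : ℝ)
  have e2 : HasDerivAt (fun s : ℝ => 2 * s) 2 s := by
    simpa using (hasDerivAt_id s).const_mul (2 : ℝ)
  have d2 := e2.const_rpow (a := 2) (by norm_num)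
  have key := ((d2.mul_const (Real.pi ^ (-(n : ℝ) / 2))).mul (hasDerivAt_id s)).mul
    ((dA.comp s eA).div (dB.comp s eB) hGB.ne')
  refine key.congr_deriv ?_
  have hlog : Real.log 4 = 2 * Real.log 2 := by
    rw [show (4 : ℝ) = 2 ^ 2 by norm_num, Real.log_pow]
    norm_num
  simp only [bConst, cConst, psi, hlog, Function.comp_apply, id, Pi.mul_apply,
    Pi.div_apply]
  field_simp
  ring

/-! ### Integral representations -/

theorem fracIntegrand_eq {n : ℕ} (s : ℝ) (u : Rn n → ℝ) (x : Rn n) :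
    fracIntegrand s u x = fun y => (u x - u y) * powKernel n 0 s (x - y) := by
  funext y
  rw [fracIntegrand, powKernel, pow_zero, mul_one, div_eq_mul_inv, ← Real.rpow_neg (norm_nonneg _)]
  congr 2
  ring

theorem logIntegrand_eq {n : ℕ} (s : ℝ) (u : Rn n → ℝ) (x : Rn n) :
    logIntegrand s u x = fun y => (u x - u y) * powKernel n 1 s (x - y) := by
  funext y
  rw [logIntegrand, powKernel, pow_one, div_eq_mul_inv, ← Real.rpow_neg (norm_nonneg _), mul_assoc]
  congr 3
  ring

/-- The kernel `K_{s+Log}(|h|)`. -/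
theorem kernelSLog_norm {n : ℕ} (s : ℝ) (h : Rn n) :
    kernelSLog n s ‖h‖ =
      cConst n s * (bConst n s * powKernel n 0 s h + powKernel n 1 s h) := by
  simp only [kernelSLog, powKernel]
  ring

theorem hasPV_powKernel {n : ℕ} (hn : 1 ≤ n) {s : ℝ} (h0 : 0 < s) (h1 : s < 1)
    {u : Rn n → ℝ} (hu : IsCc2 u) (k : ℕ) (x : Rn n) :
    HasPV x (fun y => (u x - u y) * powKernel n k s (x - y))
      ((∫ h, secondDiff u x h * powKernel n k s h) / 2) :=
  hasPV_of_even_kernel hu (measurable_powKernel n k s).aestronglyMeasurable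
    (powKernel_neg s) (integrable_min_mul_powKernel hn k h0 h1) x

theorem fracLap_eq {n : ℕ} (hn : 1 ≤ n) {s : ℝ} (h0 : 0 < s) (h1 : s < 1)
    {u : Rn n → ℝ} (hu : IsCc2 u) (x : Rn n) :
    fracLap s u x = cConst n s * ((∫ h, secondDiff u x h * powKernel n 0 s h) / 2) := by
  rw [fracLap, fracIntegrand_eq, (hasPV_powKernel hn h0 h1 hu 0 x).pv_eq]

theorem opL1_eq {n : ℕ} (hn : 1 ≤ n) {s : ℝ} (h0 : 0 < s) (h1 : s < 1)
    {u : Rn n → ℝ} (hu : IsCc2 u) (x : Rn n) :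
    opL1 s u x = (∫ h, secondDiff u x h * powKernel n 1 s h) / 2 := by
  rw [opL1, logIntegrand_eq, (hasPV_powKernel hn h0 h1 hu 1 x).pv_eq]

/-- The product rule for the constant times the second-difference integral; differentiating the
kernel produces the factor -2 ln |h|, hence L₁. -/
theorem hasDerivAt_fracLap {n : ℕ} (hn : 1 ≤ n) {s : ℝ} (h0 : 0 < s) (h1 : s < 1)
    {u : Rn n → ℝ} (hu : IsCc2 u) (x : Rn n) :
    HasDerivAt (fun t => fracLap t u x)
      (cConst n s * opL1 s u x + bConst n s * fracLap s u x) s := by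
  obtain ⟨C, hC0, hC⟩ := hu.abs_secondDiff_le
  have hd := hasDerivAt_integral_mul_powKernel hn (n := n) (f := secondDiff u x)
    (continuous_secondDiff_right hu.continuous x).aestronglyMeasurable (hC x) 0 h0 h1
  have key := (hasDerivAt_cConst hn h0 h1).mul (hd.div_const 2)
  refine (key.congr_of_eventuallyEq ?_).congr_deriv ?_
  · filter_upwards [Ioo_mem_nhds h0 h1] with t ht
    exact fracLap_eq hn ht.1 ht.2 hu x
  · rw [opL1_eq hn h0 h1 hu x, fracLap_eq hn h0 h1 hu x]
    ring

theorem fracLogLap_eq {n : ℕ} (hn : 1 ≤ n) {s : ℝ} (h0 : 0 < s) (h1 : s < 1)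
    {u : Rn n → ℝ} (hu : IsCc2 u) (x : Rn n) :
    fracLogLap s u x = cConst n s * opL1 s u x + bConst n s * fracLap s u x :=
  (hasDerivAt_fracLap hn h0 h1 hu x).deriv

theorem integrable_min_mul_kernelSLog {n : ℕ} (hn : 1 ≤ n) {s : ℝ} (h0 : 0 < s) (h1 : s < 1) :
    Integrable fun h : Rn n => min 1 (‖h‖ ^ 2) * kernelSLog n s ‖h‖ := by
  have := (((integrable_min_mul_powKernel hn 0 h0 h1).const_mul (bConst n s)).add
    (integrable_min_mul_powKernel hn 1 h0 h1)).const_mul (cConst n s)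
  refine this.congr (Eventually.of_forall fun h => ?_)
  simp only [kernelSLog_norm, Pi.add_apply]
  ring

theorem measurable_kernelSLog {n : ℕ} (s : ℝ) :
    Measurable fun h : Rn n => kernelSLog n s ‖h‖ := by
  unfold kernelSLog
  fun_prop

theorem integral_mul_kernelSLog {n : ℕ} (hn : 1 ≤ n) {s : ℝ} (h0 : 0 < s) (h1 : s < 1)
    {f : Rn n → ℝ} {C : ℝ} (hf : AEStronglyMeasurable f)
    (hfC : ∀ h, |f h| ≤ C * min 1 (‖h‖ ^ 2)) :
    ∫ h, f h * kernelSLog n s ‖h‖ =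
      cConst n s * (bConst n s * (∫ h, f h * powKernel n 0 s h) +
        ∫ h, f h * powKernel n 1 s h) := by
  have hi : ∀ k, Integrable fun h => f h * powKernel n k s h :=
    fun k => integrable_mul_of_le_min hf (measurable_powKernel n k s).aestronglyMeasurable
      hfC (integrable_min_mul_powKernel hn k h0 h1)
  rw [← integral_const_mul, ← integral_add ((hi 0).const_mul _) (hi 1), ← integral_const_mul]
  congr 1
  funext h
  rw [kernelSLog_norm]
  ring

theorem fracLogLap_eq_integral {n : ℕ} (hn : 1 ≤ n) {s : ℝ} (h0 : 0 < s) (h1 : s < 1)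
    {u : Rn n → ℝ} (hu : IsCc2 u) (x : Rn n) :
    fracLogLap s u x = (∫ h, secondDiff u x h * kernelSLog n s ‖h‖) / 2 := by
  obtain ⟨C, hC0, hC⟩ := hu.abs_secondDiff_le
  rw [integral_mul_kernelSLog hn h0 h1
    (continuous_secondDiff_right hu.continuous x).aestronglyMeasurable (hC x),
    fracLogLap_eq hn h0 h1 hu, opL1_eq hn h0 h1 hu, fracLap_eq hn h0 h1 hu]
  ring

theorem hasPV_kernelSLog {n : ℕ} (hn : 1 ≤ n) {s : ℝ} (h0 : 0 < s) (h1 : s < 1)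
    {u : Rn n → ℝ} (hu : IsCc2 u) (x : Rn n) :
    HasPV x (fun y => (u x - u y) * kernelSLog n s ‖x - y‖) (fracLogLap s u x) := by
  rw [fracLogLap_eq_integral hn h0 h1 hu]
  exact hasPV_of_even_kernel hu (K := fun h => kernelSLog n s ‖h‖)
    (measurable_kernelSLog s).aestronglyMeasurable (fun h => by simp only [norm_neg])
    (integrable_min_mul_kernelSLog hn h0 h1) x

/-! ### The symbol of the fractional Laplacian -/

theorem abs_one_sub_cos_inner_le {n : ℕ} (ξ : Rn n) :
    ∃ C : ℝ, ∀ h : Rn n, |1 - Real.cos (inner ℝ ξ h)| ≤ C * min 1 (‖h‖ ^ 2) := by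
  refine ⟨max 2 (‖ξ‖ ^ 2 / 2), fun h => ?_⟩
  rw [mul_min_of_nonneg _ _ (by positivity), abs_of_nonneg (by linarith [Real.cos_le_one (inner ℝ ξ h)])]
  refine le_min ?_ ?_
  · rw [mul_one]
    exact le_trans (by linarith [Real.neg_one_le_cos (inner ℝ ξ h)]) (le_max_left _ _)
  · have h1 := Real.one_sub_sq_div_two_le_cos (x := inner ℝ ξ h)
    have h2 : (inner ℝ ξ h) ^ 2 ≤ (‖ξ‖ * ‖h‖) ^ 2 := sq_le_sq.2 (by
      rw [abs_of_nonneg (by positivity : 0 ≤ ‖ξ‖ * ‖h‖)]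
      exact abs_real_inner_le_norm ξ h)
    calc 1 - Real.cos (inner ℝ ξ h) ≤ ‖ξ‖ ^ 2 / 2 * ‖h‖ ^ 2 := by
          rw [mul_pow] at h2
          linarith
      _ ≤ _ := by gcongr; exact le_max_right _ _

theorem continuous_one_sub_cos_inner {n : ℕ} (ξ : Rn n) :
    Continuous fun h : Rn n => 1 - Real.cos (inner ℝ ξ h) := by
  fun_prop

theorem integral_cos_inner_mul_gaussian {n : ℕ} {τ : ℝ} (hτ : 0 < τ) (ξ : Rn n) :
    (Integrable fun h : Rn n => Real.cos (inner ℝ ξ h) * Real.exp (-(τ * ‖h‖ ^ 2))) ∧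
    ∫ h : Rn n, Real.cos (inner ℝ ξ h) * Real.exp (-(τ * ‖h‖ ^ 2)) =
      (Real.pi / τ) ^ ((n : ℝ) / 2) * Real.exp (-(‖ξ‖ ^ 2 / 4 / τ)) := by
  have hre : 0 < (τ : ℂ).re := by simpa using hτ
  have hi := GaussianFourier.integrable_cexp_neg_mul_sq_norm_add hre Complex.I ξ
  have key := GaussianFourier.integral_cexp_neg_mul_sq_norm_add hre Complex.I ξ
  have hpt : ∀ h : Rn n, (Complex.exp (-(τ : ℂ) * ‖h‖ ^ 2 + Complex.I * (inner ℝ ξ h : ℝ))).re =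
      Real.cos (inner ℝ ξ h) * Real.exp (-(τ * ‖h‖ ^ 2)) := by
    intro h
    rw [Complex.exp_add, mul_comm Complex.I,
      show (-(τ : ℂ) * ‖h‖ ^ 2) = ((-(τ * ‖h‖ ^ 2) : ℝ) : ℂ) by push_cast; ring,
      ← Complex.ofReal_exp, Complex.re_ofReal_mul, Complex.exp_ofReal_mul_I_re, mul_comm]
  refine ⟨hi.re.congr (Eventually.of_forall hpt), ?_⟩
  have h2 := congrArg Complex.re key
  rw [← RCLike.re_eq_complex_re, ← integral_re hi] at h2
  simp only [RCLike.re_eq_complex_re, hpt] at h2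
  rw [h2, finrank_euclideanSpace, Fintype.card_fin, Complex.I_sq,
    show ((-1 : ℂ) * ‖ξ‖ ^ 2 / (4 * τ)) = ((-(‖ξ‖ ^ 2 / 4 / τ) : ℝ) : ℂ) by
      push_cast; field_simp,
    show ((Real.pi : ℂ) / τ) ^ ((n : ℂ) / 2) = (((Real.pi / τ) ^ ((n : ℝ) / 2) : ℝ) : ℂ) by
      rw [Complex.ofReal_cpow (by positivity)]; push_cast; rfl,
    ← Complex.ofReal_exp, ← Complex.ofReal_mul, Complex.ofReal_re]

theorem integral_one_sub_cos_inner_mul_gaussian {n : ℕ} {τ : ℝ} (hτ : 0 < τ) (ξ : Rn n) :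
    ∫ h : Rn n, (1 - Real.cos (inner ℝ ξ h)) * Real.exp (-(τ * ‖h‖ ^ 2)) =
      (Real.pi / τ) ^ ((n : ℝ) / 2) * (1 - Real.exp (-(‖ξ‖ ^ 2 / 4 / τ))) := by
  obtain ⟨h1, h2⟩ := integral_cos_inner_mul_gaussian hτ ξ
  obtain ⟨h3, h4⟩ := integral_cos_inner_mul_gaussian hτ (0 : Rn n)
  simp only [inner_zero_left, Real.cos_zero, norm_zero] at h3 h4
  simp only [sub_mul]
  rw [integral_sub h3 h1, h2, h4]
  simp
  ring

/-- The substitution τ ↦ 1/τ turns this into the Gamma integral with parameter 1 - s. -/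
theorem integral_rpow_mul_exp_neg_div {s b : ℝ} (h1 : s < 1) (hb : 0 < b) :
    IntegrableOn (fun τ : ℝ => τ ^ (s - 2) * Real.exp (-(b / τ))) (Set.Ioi 0) ∧
    ∫ τ in Set.Ioi (0 : ℝ), τ ^ (s - 2) * Real.exp (-(b / τ)) =
      b ^ (s - 1) * Real.Gamma (1 - s) := by
  have hfun : ∀ x ∈ Set.Ioi (0 : ℝ), (|(-1 : ℝ)| * x ^ ((-1 : ℝ) - 1)) •
      ((fun τ : ℝ => τ ^ (s - 2) * Real.exp (-(b / τ))) (x ^ (-1 : ℝ))) =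
      x ^ ((1 - s) - 1) * Real.exp (-(b * x)) := by
    intro x hx
    have hx0 : (0 : ℝ) < x := hx
    simp only [smul_eq_mul]
    rw [← Real.rpow_mul hx0.le, Real.rpow_neg_one, div_inv_eq_mul, abs_neg, abs_one, one_mul,
      ← mul_assoc, ← Real.rpow_add hx0]
    congr 2
    ring
  have hint : IntegrableOn (fun x : ℝ => x ^ ((1 - s) - 1) * Real.exp (-(b * x))) (Set.Ioi 0) := by
    have := integrableOn_rpow_mul_exp_neg_mul_rpow (p := 1) (s := (1 - s) - 1) (b := b)
      (by linarith) one_pos hb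
    simpa [neg_mul] using this
  constructor
  · rw [← integrableOn_Ioi_comp_rpow_iff _ (by norm_num : (-1 : ℝ) ≠ 0)]
    exact hint.congr_fun (fun x hx => (hfun x hx).symm) measurableSet_Ioi
  · rw [← integral_comp_rpow_Ioi _ (by norm_num : (-1 : ℝ) ≠ 0),
      setIntegral_congr_fun measurableSet_Ioi hfun,
      Real.integral_rpow_mul_exp_neg_mul_Ioi (by linarith) hb, one_div, Real.inv_rpow hb.le,
      ← Real.rpow_neg hb.le]
    congr 2
    ring

theorem one_sub_exp_neg_mem {x : ℝ} (hx : 0 ≤ x) :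
    0 ≤ 1 - Real.exp (-x) ∧ 1 - Real.exp (-x) ≤ 1 ∧ 1 - Real.exp (-x) ≤ x := by
  refine ⟨?_, ?_, ?_⟩
  · linarith [Real.exp_le_one_iff.2 (neg_nonpos.2 hx)]
  · linarith [Real.exp_pos (-x)]
  · linarith [Real.one_sub_le_exp_neg x]

/-- Integration by parts: F(τ) = τ^s (1 - e^{-b/τ}) vanishes at 0 and at infinity, so the two terms
of F' have equal integrals up to sign, and the second is the preceding Gamma integral. -/
theorem integral_rpow_mul_one_sub_exp {s b : ℝ} (h0 : 0 < s) (h1 : s < 1) (hb : 0 < b) :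
    ∫ τ in Set.Ioi (0 : ℝ), τ ^ (s - 1) * (1 - Real.exp (-(b / τ))) =
      b ^ s * Real.Gamma (1 - s) / s := by
  obtain ⟨hi2, he2⟩ := integral_rpow_mul_exp_neg_div h1 hb
  have hmeas : Measurable fun τ : ℝ => τ ^ (s - 1) * (1 - Real.exp (-(b / τ))) := by fun_prop
  have hi1 : IntegrableOn (fun τ : ℝ => τ ^ (s - 1) * (1 - Real.exp (-(b / τ)))) (Set.Ioi 0) := by
    rw [← Set.Ioc_union_Ioi_eq_Ioi (zero_le_one' ℝ)]
    refine IntegrableOn.union ?_ ?_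
    · have : IntegrableOn (fun r : ℝ => r ^ (s - 1)) (Set.Ioc 0 1) :=
        (intervalIntegrable_iff_integrableOn_Ioc_of_le zero_le_one).1
          (intervalIntegral.intervalIntegrable_rpow' (by linarith))
      refine Integrable.mono' this hmeas.aestronglyMeasurable ?_
      filter_upwards [ae_restrict_mem measurableSet_Ioc] with τ hτ
      obtain ⟨e1, e2, -⟩ := one_sub_exp_neg_mem (div_nonneg hb.le hτ.1.le)
      have := Real.rpow_nonneg hτ.1.le (s - 1)
      rw [Real.norm_of_nonneg (by positivity)]
      exact mul_le_of_le_one_right this e2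
    · have : IntegrableOn (fun r : ℝ => b * r ^ (s - 2)) (Set.Ioi 1) :=
        (integrableOn_Ioi_rpow_of_lt (by linarith) zero_lt_one).const_mul b
      refine Integrable.mono' this hmeas.aestronglyMeasurable ?_
      filter_upwards [ae_restrict_mem measurableSet_Ioi] with τ hτ
      have hτ0 : 0 < τ := lt_trans zero_lt_one hτ
      obtain ⟨e1, -, e3⟩ := one_sub_exp_neg_mem (div_nonneg hb.le hτ0.le)
      have := Real.rpow_nonneg hτ0.le (s - 1)
      rw [Real.norm_of_nonneg (by positivity)]
      refine (mul_le_mul_of_nonneg_left e3 this).trans_eq ?_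
      rw [show s - 1 = (s - 2) + 1 by ring, Real.rpow_add hτ0, Real.rpow_one]
      field_simp
  set F : ℝ → ℝ := fun τ => τ ^ s * (1 - Real.exp (-(b / τ))) with hF
  have hFbd : ∀ τ, 0 ≤ τ → |F τ| ≤ τ ^ s := by
    intro τ hτ
    obtain ⟨e1, e2, -⟩ := one_sub_exp_neg_mem (div_nonneg hb.le hτ)
    have := Real.rpow_nonneg hτ s
    rw [hF, abs_of_nonneg (by positivity)]
    exact mul_le_of_le_one_right this e2
  have hF0 : F 0 = 0 := by simp [hF]
  have hcont : ContinuousWithinAt F (Set.Ici 0) 0 := by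
    rw [ContinuousWithinAt, hF0]
    have : Tendsto (fun τ : ℝ => τ ^ s) (𝓝[≥] 0) (𝓝 0) := by
      have := (Real.continuousAt_rpow_const 0 s (Or.inr h0.le)).tendsto
      rw [Real.zero_rpow h0.ne'] at this
      exact this.mono_left nhdsWithin_le_nhds
    refine squeeze_zero_norm' ?_ this
    filter_upwards [self_mem_nhdsWithin] with τ hτ
    exact hFbd τ hτ
  have hderiv : ∀ τ ∈ Set.Ioi (0 : ℝ), HasDerivAt F
      (s * (τ ^ (s - 1) * (1 - Real.exp (-(b / τ)))) -
        b * (τ ^ (s - 2) * Real.exp (-(b / τ)))) τ := by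
    intro τ hτ
    have hτ0 : (0 : ℝ) < τ := hτ
    have d1 := Real.hasDerivAt_rpow_const (x := τ) (p := s) (Or.inl hτ0.ne')
    have d2 : HasDerivAt (fun τ : ℝ => -(b / τ)) (b / τ ^ 2) τ := by
      have := ((hasDerivAt_inv hτ0.ne').const_mul b).neg
      refine (this.congr_of_eventuallyEq (Eventually.of_forall fun x => ?_)).congr_deriv ?_
      · simp [div_eq_mul_inv]
      · field_simp
    have d3 := d1.mul (d2.exp.const_sub 1)
    refine d3.congr_deriv ?_
    rw [show s = (s - 2) + 2 by ring, Real.rpow_add hτ0, show s - 2 + 2 - 2 = s - 2 by ring,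
      Real.rpow_two]
    field_simp
    ring
  have hlim : Tendsto F atTop (𝓝 0) := by
    have : Tendsto (fun τ : ℝ => b * τ ^ (-(1 - s))) atTop (𝓝 0) := by
      simpa using (tendsto_rpow_neg_atTop (by linarith : 0 < 1 - s)).const_mul b
    refine squeeze_zero_norm' ?_ this
    filter_upwards [eventually_gt_atTop 0] with τ hτ
    obtain ⟨e1, -, e3⟩ := one_sub_exp_neg_mem (div_nonneg hb.le hτ.le)
    have := Real.rpow_nonneg hτ.le s
    rw [hF, Real.norm_of_nonneg (by positivity)]
    refine (mul_le_mul_of_nonneg_left e3 this).trans_eq ?_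
    rw [neg_sub, Real.rpow_sub_one hτ.ne']
    ring
  have key := integral_Ioi_of_hasDerivAt_of_tendsto hcont hderiv
    ((hi1.const_mul s).sub (hi2.const_mul b)) hlim
  rw [integral_sub (hi1.const_mul s) (hi2.const_mul b), integral_const_mul, integral_const_mul,
    he2, hF0, sub_zero, sub_eq_zero, Real.rpow_sub_one hb.ne'] at key
  rw [eq_div_iff h0.ne', mul_comm, key]
  field_simp

theorem powKernel_zero_eq_integral {n : ℕ} {s : ℝ} (h0 : 0 < s) {h : Rn n} (hh : h ≠ 0) :
    IntegrableOn (fun τ : ℝ => τ ^ (((n : ℝ) + 2 * s) / 2 - 1) * Real.exp (-(τ * ‖h‖ ^ 2)))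
      (Set.Ioi 0) ∧
    ∫ τ in Set.Ioi (0 : ℝ), τ ^ (((n : ℝ) + 2 * s) / 2 - 1) * Real.exp (-(τ * ‖h‖ ^ 2)) =
      Real.Gamma (((n : ℝ) + 2 * s) / 2) * powKernel n 0 s h := by
  have hr : 0 < ‖h‖ := norm_pos_iff.2 hh
  have hn' : (0 : ℝ) ≤ n := n.cast_nonneg
  have hA : 0 < ((n : ℝ) + 2 * s) / 2 := by positivity
  constructor
  · have := integrableOn_rpow_mul_exp_neg_mul_rpow (p := 1) (s := ((n : ℝ) + 2 * s) / 2 - 1)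
      (b := ‖h‖ ^ 2) (by linarith) one_pos (by positivity)
    refine this.congr_fun (fun τ _ => ?_) measurableSet_Ioi
    simp only [Real.rpow_one, neg_mul, mul_comm τ]
  · have := Real.integral_rpow_mul_exp_neg_mul_Ioi hA (by positivity : 0 < ‖h‖ ^ 2)
    simp only [mul_comm (‖h‖ ^ 2)] at this
    rw [this, powKernel, pow_zero, mul_one, mul_comm, one_div, Real.inv_rpow (by positivity),
      ← Real.rpow_natCast, ← Real.rpow_mul hr.le, ← Real.rpow_neg hr.le]
    congr 2
    push_cast
    ring

/-- Write Γ((n+2s)/2) |h|^{-n-2s} as ∫ τ^{(n+2s)/2-1} e^{-τ|h|²} dτ and exchange the integrals. The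
Gaussian integral in h leaves π^{n/2} ∫ τ^{s-1} (1 - e^{-|ξ|²/(4τ)}) dτ, and the normalization
c_{n,s} cancels every remaining constant. -/
theorem cConst_mul_integral_one_sub_cos {n : ℕ} (hn : 1 ≤ n) {s : ℝ} (h0 : 0 < s) (h1 : s < 1)
    (ξ : Rn n) :
    cConst n s * ∫ h : Rn n, (1 - Real.cos (inner ℝ ξ h)) * powKernel n 0 s h =
      ‖ξ‖ ^ (2 * s) := by
  rcases eq_or_ne ξ 0 with rfl | hξ
  · simp [Real.zero_rpow (by positivity : 2 * s ≠ 0)]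
  have hr : 0 < ‖ξ‖ := norm_pos_iff.2 hξ
  have hA : 0 < ((n : ℝ) + 2 * s) / 2 := by positivity
  have hGA := Real.Gamma_pos_of_pos hA
  have hGB := Real.Gamma_pos_of_pos (by linarith : 0 < 1 - s)
  obtain ⟨C, hC⟩ := abs_one_sub_cos_inner_le ξ
  have hi := integrable_mul_of_le_min (continuous_one_sub_cos_inner ξ).aestronglyMeasurable
    (measurable_powKernel n 0 s).aestronglyMeasurable hC (integrable_min_mul_powKernel hn 0 h0 h1)
  set A := ((n : ℝ) + 2 * s) / 2 with hAdef
  set g : Rn n → ℝ → ℝ := fun h τ =>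
    (1 - Real.cos (inner ℝ ξ h)) * (τ ^ (A - 1) * Real.exp (-(τ * ‖h‖ ^ 2))) with hg
  have hinner : ∀ h : Rn n, h ≠ 0 → ∫ τ in Set.Ioi (0 : ℝ), g h τ =
      Real.Gamma A * ((1 - Real.cos (inner ℝ ξ h)) * powKernel n 0 s h) := by
    intro h hh
    rw [hg, integral_const_mul, (powKernel_zero_eq_integral h0 hh).2]
    ring
  have hmeas : Measurable (Function.uncurry g) := by
    rw [hg]
    unfold Function.uncurry
    fun_prop
  have hprod : Integrable (Function.uncurry g)
      ((volume : Measure (Rn n)).prod (volume.restrict (Set.Ioi (0 : ℝ)))) := by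
    rw [integrable_prod_iff hmeas.aestronglyMeasurable]
    refine ⟨?_, ?_⟩
    · filter_upwards [ae_ne_zero hn] with h hh
      exact (powKernel_zero_eq_integral h0 hh).1.const_mul (1 - Real.cos (inner ℝ ξ h))
    -- The integrand is nonnegative, so its norm integrates in τ to a multiple of (1 - cos ξ·h)
    -- |h|^{-n-2s}, already known to be integrable.
    · refine (hi.const_mul (Real.Gamma A)).congr ?_
      filter_upwards [ae_ne_zero hn] with h hh
      rw [← hinner h hh]
      refine setIntegral_congr_fun measurableSet_Ioi fun τ hτ => ?_
      have hτ0 : (0 : ℝ) < τ := hτ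
      have e1 : 0 ≤ 1 - Real.cos (inner ℝ ξ h) := by linarith [Real.cos_le_one (inner ℝ ξ h)]
      simp only [Function.uncurry, hg]
      rw [Real.norm_of_nonneg (by positivity)]
  have hswap := integral_integral_swap hprod
  have hL : ∫ h, ∫ τ in Set.Ioi (0 : ℝ), g h τ = Real.Gamma A *
      ∫ h : Rn n, (1 - Real.cos (inner ℝ ξ h)) * powKernel n 0 s h := by
    rw [← integral_const_mul]
    refine integral_congr_ae ?_
    filter_upwards [ae_ne_zero hn] with h hh
    exact hinner h hh
  have hR : ∫ τ in Set.Ioi (0 : ℝ), ∫ h, g h τ =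
      Real.pi ^ ((n : ℝ) / 2) * ((‖ξ‖ ^ 2 / 4) ^ s * Real.Gamma (1 - s) / s) := by
    rw [← integral_rpow_mul_one_sub_exp h0 h1 (by positivity), ← integral_const_mul]
    refine setIntegral_congr_fun measurableSet_Ioi fun τ hτ => ?_
    have hτ0 : (0 : ℝ) < τ := hτ
    have e1 : ∀ h, g h τ = τ ^ (A - 1) *
        ((1 - Real.cos (inner ℝ ξ h)) * Real.exp (-(τ * ‖h‖ ^ 2))) := fun h => by
      rw [hg]; ring
    simp only [e1]
    rw [integral_const_mul, integral_one_sub_cos_inner_mul_gaussian hτ0,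
      Real.div_rpow Real.pi_nonneg hτ0.le, div_eq_mul_inv (Real.pi ^ _), ← Real.rpow_neg hτ0.le]
    have e2 : τ ^ (A - 1) * τ ^ (-((n : ℝ) / 2)) = τ ^ (s - 1) := by
      rw [← Real.rpow_add hτ0, hAdef]
      congr 1
      ring
    rw [← e2]
    ring
  rw [hL, hR] at hswap
  have e4 : (‖ξ‖ ^ 2 / 4) ^ s * (2 : ℝ) ^ (2 * s) = ‖ξ‖ ^ (2 * s) := by
    rw [Real.rpow_mul (by norm_num : (0 : ℝ) ≤ 2), ← Real.mul_rpow (by positivity) (by positivity),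
      Real.rpow_mul hr.le, Real.rpow_two, Real.rpow_two]
    congr 1
    ring
  have e5 : Real.pi ^ (-(n : ℝ) / 2) * Real.pi ^ ((n : ℝ) / 2) = 1 := by
    rw [← Real.rpow_add Real.pi_pos, neg_div, neg_add_cancel, Real.rpow_zero]
  have hM : ∫ h : Rn n, (1 - Real.cos (inner ℝ ξ h)) * powKernel n 0 s h =
      Real.pi ^ ((n : ℝ) / 2) * ((‖ξ‖ ^ 2 / 4) ^ s * Real.Gamma (1 - s) / s) / Real.Gamma A := by
    rw [eq_div_iff hGA.ne', mul_comm, hswap]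
  rw [hM, cConst, ← hAdef, ← e4]
  calc _ = (Real.pi ^ (-(n : ℝ) / 2) * Real.pi ^ ((n : ℝ) / 2)) *
        ((‖ξ‖ ^ 2 / 4) ^ s * 2 ^ (2 * s)) := by
        field_simp
    _ = _ := by rw [e5, one_mul]

/-- Both sides are s-derivatives of the two sides of the identity for the pure power kernel, so
uniqueness of derivatives suffices. At ξ = 0 both sides are 0, with `Real.log 0 = 0`. -/
theorem integral_one_sub_cos_mul_kernelSLog {n : ℕ} (hn : 1 ≤ n) {s : ℝ} (h0 : 0 < s) (h1 : s < 1)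
    (ξ : Rn n) :
    ∫ h : Rn n, (1 - Real.cos (inner ℝ ξ h)) * kernelSLog n s ‖h‖ =
      ‖ξ‖ ^ (2 * s) * (2 * Real.log ‖ξ‖) := by
  obtain ⟨C, hC⟩ := abs_one_sub_cos_inner_le ξ
  have hm := (continuous_one_sub_cos_inner ξ).aestronglyMeasurable (μ := volume)
  rcases eq_or_ne ξ 0 with rfl | hξ
  · simp
  have hr : 0 < ‖ξ‖ := norm_pos_iff.2 hξ
  have d1 := (hasDerivAt_cConst hn h0 h1).mul (hasDerivAt_integral_mul_powKernel hn hm hC 0 h0 h1)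
  have e2 : HasDerivAt (fun s : ℝ => 2 * s) 2 s := by
    simpa using (hasDerivAt_id s).const_mul (2 : ℝ)
  have d2 : HasDerivAt (fun t : ℝ => ‖ξ‖ ^ (2 * t)) _ s := e2.const_rpow hr
  have d3 := d1.congr_of_eventuallyEq (f₁ := fun t : ℝ => ‖ξ‖ ^ (2 * t)) (by
    filter_upwards [Ioo_mem_nhds h0 h1] with t ht
    exact (cConst_mul_integral_one_sub_cos hn ht.1 ht.2 ξ).symm)
  rw [integral_mul_kernelSLog hn h0 h1 hm hC]
  have := d2.unique d3
  simp only [zero_add] at this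
  linarith

/-! ### The Fourier transform of integro-differential operators -/

theorem IsCc2.integrable_secondDiff {n : ℕ} {u : Rn n → ℝ} (hu : IsCc2 u) (h : Rn n) :
    Integrable fun x => secondDiff u x h := by
  unfold secondDiff
  exact ((hu.integrable.const_mul 2).sub (hu.integrable.comp_add_right h)).sub
    (hu.integrable.comp_sub_right h)

/-- For |h| ≥ 1, translation invariance bounds the L¹ norm by 4‖u‖₁. For |h| ≤ 1 the support in x
stays in a fixed ball, where the pointwise quadratic bound is integrated. -/
theorem IsCc2.integral_abs_secondDiff_le {n : ℕ} {u : Rn n → ℝ} (hu : IsCc2 u) :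
    ∃ C : ℝ, 0 ≤ C ∧ ∀ h, ∫ x, |secondDiff u x h| ≤ C * min 1 (‖h‖ ^ 2) := by
  obtain ⟨L, hL0, hL⟩ := hu.abs_secondDiff_le_sq
  obtain ⟨R, hR0, hR⟩ := hu.exists_radius
  set V : ℝ := volume.real (Metric.closedBall (0 : Rn n) (R + 1)) with hV
  have hV0 : 0 ≤ V := measureReal_nonneg
  have hN0 : 0 ≤ ∫ x, |u x| := integral_nonneg fun x => abs_nonneg _
  refine ⟨max (4 * ∫ x, |u x|) (L * V), by positivity, fun h => ?_⟩
  rcases le_total 1 ‖h‖ with hh | hh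
  · rw [min_eq_left (one_le_pow₀ hh), mul_one]
    refine le_trans ?_ (le_max_left _ _)
    have i0 := hu.integrable.abs
    have i1 := i0.comp_add_right h
    have i2 := i0.comp_sub_right h
    have i3 : Integrable fun x => 2 * |u x| + |u (x + h)| := (i0.const_mul 2).add i1
    calc ∫ x, |secondDiff u x h| ≤ ∫ x, (2 * |u x| + |u (x + h)| + |u (x - h)|) := by
          refine integral_mono (hu.integrable_secondDiff h).abs
            (i3.add i2) fun x => ?_
          simp only [secondDiff]
          calc |2 * u x - u (x + h) - u (x - h)| ≤ |2 * u x - u (x + h)| + |u (x - h)| := abs_sub _ _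
            _ ≤ |2 * u x| + |u (x + h)| + |u (x - h)| := by gcongr; exact abs_sub _ _
            _ = _ := by rw [abs_mul, abs_two]
      _ = 4 * ∫ x, |u x| := by
          rw [integral_add i3 i2, integral_add (i0.const_mul 2) i1,
            integral_const_mul, integral_add_right_eq_self (μ := volume) (fun x => |u x|) h,
            integral_sub_right_eq_self (μ := volume) (fun x => |u x|) h]
          ring
  · rw [min_eq_right (pow_le_one₀ (norm_nonneg _) hh)]
    have hsupp : ∀ x, x ∉ Metric.closedBall (0 : Rn n) (R + 1) → |secondDiff u x h| = 0 := by
      intro x hx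
      rw [mem_closedBall_zero_iff, not_le] at hx
      have e1 := hR x (by linarith)
      have e2 := hR (x + h) (by have := norm_sub_le (x + h) h; rw [add_sub_cancel_right] at this; linarith)
      have e3 := hR (x - h) (by have := norm_add_le (x - h) h; rw [sub_add_cancel] at this; linarith)
      rw [secondDiff, e1, e2, e3]
      simp
    rw [← setIntegral_eq_integral_of_forall_compl_eq_zero hsupp]
    calc ∫ x in Metric.closedBall (0 : Rn n) (R + 1), |secondDiff u x h|
        ≤ ∫ x in Metric.closedBall (0 : Rn n) (R + 1), L * ‖h‖ ^ 2 := by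
          refine integral_mono (hu.integrable_secondDiff h).abs.integrableOn ?_ fun x => hL x h
          exact integrable_const_iff.2 (Or.inr (isFiniteMeasure_restrict.2
            measure_closedBall_lt_top.ne))
      _ = L * V * ‖h‖ ^ 2 := by
          rw [setIntegral_const, smul_eq_mul]
          ring
      _ ≤ _ := by gcongr; exact le_max_right _ _

theorem fourierT_secondDiff {n : ℕ} {u : Rn n → ℝ} (hu : IsCc2 u) (h ξ : Rn n) :
    fourierT (fun x => (secondDiff u x h : ℂ)) ξ =
      ((2 * (1 - Real.cos (inner ℝ ξ h)) : ℝ) : ℂ) * fourierT (fun x => (u x : ℂ)) ξ := by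
  set e : Rn n → ℂ := fun x => Complex.exp (-Complex.I * (inner ℝ ξ x : ℝ)) with he
  have hec : Continuous e := by fun_prop
  have hen : ∀ x, ‖e x‖ = 1 := fun x => by
    simp only [he]
    rw [neg_mul, ← mul_neg, ← Complex.ofReal_neg, mul_comm, Complex.norm_exp_ofReal_mul_I]
  have hi : ∀ v : Rn n → ℝ, Integrable v → Integrable fun x => e x * (v x : ℂ) := fun v hv =>
    hv.ofReal.bdd_mul (c := 1) hec.aestronglyMeasurable (Eventually.of_forall fun x => (hen x).le)
  have i1 : Integrable fun x => e x * (u (x + h) : ℂ) := hi _ (hu.integrable.comp_add_right h)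
  have i2 : Integrable fun x => e x * (u (x - h) : ℂ) := hi _ (hu.integrable.comp_sub_right h)
  have i0 : Integrable fun x => e x * (u x : ℂ) := hi _ hu.integrable
  have hadd : ∀ x y, e (x + y) = e x * e y := fun x y => by
    simp only [he]
    rw [← Complex.exp_add, inner_add_right]
    congr 1
    push_cast
    ring
  have j1 : ∫ x, e x * (u (x + h) : ℂ) = e (-h) * ∫ x, e x * (u x : ℂ) := by
    rw [← integral_add_right_eq_self (μ := volume) (fun x => e x * (u x : ℂ)) h,
      ← integral_const_mul]
    congr 1
    funext x
    rw [← mul_assoc, ← hadd]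
    congr 2
    abel
  have j2 : ∫ x, e x * (u (x - h) : ℂ) = e h * ∫ x, e x * (u x : ℂ) := by
    rw [← integral_sub_right_eq_self (μ := volume) (fun x => e x * (u x : ℂ)) h,
      ← integral_const_mul]
    congr 1
    funext x
    rw [← mul_assoc, ← hadd]
    congr 2
    abel
  have j : ∫ x, e x * (secondDiff u x h : ℂ) =
      (2 - e (-h) - e h) * ∫ x, e x * (u x : ℂ) := by
    have : ∀ x, e x * (secondDiff u x h : ℂ) =
        2 * (e x * (u x : ℂ)) - e x * (u (x + h) : ℂ) - e x * (u (x - h) : ℂ) := fun x => by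
      rw [secondDiff]
      push_cast
      ring
    simp only [this]
    have i3 : Integrable fun x => 2 * (e x * (u x : ℂ)) - e x * (u (x + h) : ℂ) :=
      (i0.const_mul 2).sub i1
    rw [integral_sub i3 i2, integral_sub (i0.const_mul 2) i1,
      integral_const_mul, j1, j2]
    ring
  have hcos : 2 - e (-h) - e h = ((2 * (1 - Real.cos (inner ℝ ξ h)) : ℝ) : ℂ) := by
    simp only [he, inner_neg_right]
    push_cast
    rw [Complex.cos]
    ring_nf
  rw [fourierT, fourierT, j, hcos]
  ring

/-- Joint integrability is what Fubini needs, both for the result to be in L¹ and for its Fourier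
transform; it follows by integrating in x first. -/
theorem integrable_uncurry_secondDiff_mul {n : ℕ} {u K : Rn n → ℝ} (hu : IsCc2 u)
    (hK : AEStronglyMeasurable K) (hKi : Integrable fun h => min 1 (‖h‖ ^ 2) * K h) :
    Integrable (fun p : Rn n × Rn n => secondDiff u p.1 p.2 * K p.2) (volume.prod volume) := by
  obtain ⟨C, hC0, hC⟩ := hu.integral_abs_secondDiff_le
  have hm : AEStronglyMeasurable (fun p : Rn n × Rn n => secondDiff u p.1 p.2 * K p.2)
      (volume.prod volume) :=
    (continuous_secondDiff hu.continuous).aestronglyMeasurable.mul hK.comp_snd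
  refine (integrable_prod_iff' hm).2 ⟨Eventually.of_forall fun h =>
    (hu.integrable_secondDiff h).mul_const (K h), ?_⟩
  refine (hKi.norm.const_mul C).mono' hm.norm.prod_swap.integral_prod_right' (Eventually.of_forall fun h => ?_)
  have h0 : (0 : ℝ) ≤ min 1 (‖h‖ ^ 2) := by positivity
  simp only [norm_mul]
  rw [integral_mul_const, norm_mul, norm_norm, Real.norm_of_nonneg h0, ← mul_assoc,
    Real.norm_of_nonneg (integral_nonneg fun x => norm_nonneg _)]
  exact mul_le_mul_of_nonneg_right (hC h) (norm_nonneg _)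

theorem integrable_integral_secondDiff_mul {n : ℕ} {u K : Rn n → ℝ} (hu : IsCc2 u)
    (hK : AEStronglyMeasurable K) (hKi : Integrable fun h => min 1 (‖h‖ ^ 2) * K h) :
    Integrable fun x => (∫ h, secondDiff u x h * K h) / 2 :=
  (integrable_uncurry_secondDiff_mul hu hK hKi).integral_prod_left.div_const 2

theorem fourierT_integral_secondDiff_mul {n : ℕ} {u K : Rn n → ℝ} (hu : IsCc2 u)
    (hK : AEStronglyMeasurable K) (hKi : Integrable fun h => min 1 (‖h‖ ^ 2) * K h) (ξ : Rn n) :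
    fourierT (fun x => (((∫ h, secondDiff u x h * K h) / 2 : ℝ) : ℂ)) ξ =
      ((∫ h, (1 - Real.cos (inner ℝ ξ h)) * K h : ℝ) : ℂ) * fourierT (fun x => (u x : ℂ)) ξ := by
  set e : Rn n → ℂ := fun x => Complex.exp (-Complex.I * (inner ℝ ξ x : ℝ)) with he
  have hec : Continuous e := by fun_prop
  have hen : ∀ x, ‖e x‖ = 1 := fun x => by
    simp only [he]
    rw [neg_mul, ← mul_neg, ← Complex.ofReal_neg, mul_comm, Complex.norm_exp_ofReal_mul_I]
  have hp := integrable_uncurry_secondDiff_mul hu hK hKi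
  have hpc : Integrable (Function.uncurry fun x h : Rn n =>
      e x * ((secondDiff u x h * K h : ℝ) : ℂ)) (volume.prod volume) :=
    hp.ofReal.bdd_mul (c := 1) (hec.comp continuous_fst).aestronglyMeasurable
      (Eventually.of_forall fun p => (hen p.1).le)
  have hswap := integral_integral_swap hpc
  have h1 : ∀ x, ∫ h, e x * ((secondDiff u x h * K h : ℝ) : ℂ) =
      2 * (e x * (((∫ h, secondDiff u x h * K h) / 2 : ℝ) : ℂ)) := by
    intro x
    rw [integral_const_mul, integral_complex_ofReal]
    push_cast
    ring
  have h2 : ∀ h, ((((2 * Real.pi) ^ (-(n : ℝ) / 2) : ℝ) : ℂ)) *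
      ∫ x, e x * ((secondDiff u x h * K h : ℝ) : ℂ) =
      2 * (fourierT (fun x => (u x : ℂ)) ξ * (((1 - Real.cos (inner ℝ ξ h)) * K h : ℝ) : ℂ)) := by
    intro h
    have : ∀ x, e x * ((secondDiff u x h * K h : ℝ) : ℂ) =
        e x * (secondDiff u x h : ℂ) * (K h : ℂ) := fun x => by push_cast; ring
    simp only [this]
    rw [integral_mul_const, ← mul_assoc]
    have := fourierT_secondDiff hu h ξ
    rw [fourierT] at this
    rw [this]
    push_cast
    ring
  have h3 : 2 * fourierT (fun x => (((∫ h, secondDiff u x h * K h) / 2 : ℝ) : ℂ)) ξ =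
      2 * (((∫ h, (1 - Real.cos (inner ℝ ξ h)) * K h : ℝ) : ℂ) * fourierT (fun x => (u x : ℂ)) ξ) := by
    calc _ = ((((2 * Real.pi) ^ (-(n : ℝ) / 2) : ℝ) : ℂ)) *
          ∫ x, ∫ h, e x * ((secondDiff u x h * K h : ℝ) : ℂ) := by
          simp only [h1]
          rw [integral_const_mul, fourierT]
          ring
      _ = ∫ h, 2 * (fourierT (fun x => (u x : ℂ)) ξ *
            (((1 - Real.cos (inner ℝ ξ h)) * K h : ℝ) : ℂ)) := by
          rw [hswap, ← integral_const_mul]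
          simp only [h2]
      _ = _ := by
          rw [integral_const_mul, integral_const_mul, integral_complex_ofReal]
          ring
  exact mul_left_cancel₀ two_ne_zero h3

theorem integrable_fracLogLap {n : ℕ} (hn : 1 ≤ n) {s : ℝ} (h0 : 0 < s) (h1 : s < 1)
    {u : Rn n → ℝ} (hu : IsCc2 u) : Integrable (fracLogLap s u) := by
  have := integrable_integral_secondDiff_mul hu (measurable_kernelSLog s).aestronglyMeasurable
    (integrable_min_mul_kernelSLog hn h0 h1)
  exact this.congr (Eventually.of_forall fun x => (fracLogLap_eq_integral hn h0 h1 hu x).symm)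

theorem fourierT_fracLogLap {n : ℕ} (hn : 1 ≤ n) {s : ℝ} (h0 : 0 < s) (h1 : s < 1)
    {u : Rn n → ℝ} (hu : IsCc2 u) (ξ : Rn n) :
    fourierT (fun x => (fracLogLap s u x : ℂ)) ξ =
      ((‖ξ‖ ^ (2 * s) * (2 * Real.log ‖ξ‖) : ℝ) : ℂ) * fourierT (fun x => (u x : ℂ)) ξ := by
  simp only [fracLogLap_eq_integral hn h0 h1 hu]
  rw [fourierT_integral_secondDiff_mul hu (measurable_kernelSLog s).aestronglyMeasurable
    (integrable_min_mul_kernelSLog hn h0 h1), integral_one_sub_cos_mul_kernelSLog hn h0 h1]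

theorem memLp_top_fracLogLap {n : ℕ} (hn : 1 ≤ n) {s : ℝ} (h0 : 0 < s) (h1 : s < 1)
    {u : Rn n → ℝ} (hu : IsCc2 u) : MemLp (fracLogLap s u) ∞ := by
  obtain ⟨C, hC0, hC⟩ := hu.abs_secondDiff_le
  have hKi := integrable_min_mul_kernelSLog hn h0 h1
  refine memLp_top_of_bound (integrable_fracLogLap hn h0 h1 hu).aestronglyMeasurable
    ((∫ h : Rn n, C * ‖min 1 (‖h‖ ^ 2) * kernelSLog n s ‖h‖‖) / 2)
    (Eventually.of_forall fun x => ?_)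
  rw [fracLogLap_eq_integral hn h0 h1 hu, norm_div, Real.norm_two]
  gcongr
  refine norm_integral_le_of_norm_le (hKi.norm.const_mul C) (Eventually.of_forall fun h => ?_)
  have h0 : (0 : ℝ) ≤ min 1 (‖h‖ ^ 2) := by positivity
  rw [norm_mul, norm_mul, Real.norm_of_nonneg h0, ← mul_assoc]
  exact mul_le_mul_of_nonneg_right (hC x h) (norm_nonneg _)

/-! ### Expansion of the fractional Laplacian at order zero -/

/-- The complex Gamma function is holomorphic, hence analytic, on the right half-plane, and its
restriction to the reals inherits the smoothness. -/
theorem contDiffAt_Gamma {x : ℝ} (hx : 0 < x) (k : WithTop ℕ∞) : ContDiffAt ℝ k Real.Gamma x := by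
  have hopen : IsOpen {z : ℂ | 0 < z.re} := isOpen_lt continuous_const Complex.continuous_re
  have hd : DifferentiableOn ℂ Complex.Gamma {z : ℂ | 0 < z.re} := fun z hz => by
    refine (Complex.differentiableAt_Gamma z fun m hm => ?_).differentiableWithinAt
    have hz' : 0 < z.re := hz
    rw [hm, Complex.neg_re, Complex.natCast_re] at hz'
    linarith [(m.cast_nonneg : (0 : ℝ) ≤ m)]
  have ha : AnalyticAt ℂ Complex.Gamma (x : ℂ) :=
    hd.analyticAt (hopen.mem_nhds (by simpa using hx))
  have := (ha.contDiffAt (n := k)).real_of_complex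
  refine this.congr_of_eventuallyEq (Eventually.of_forall fun y => ?_)
  simp [Complex.Gamma_ofReal]

/-- The function `4^t Γ(n/2 + t) / (Γ(1 - t) Γ(n/2))`, which is `c_{n,t} ω_{n-1} / (2t)`. -/
def farConst (n : ℕ) (t : ℝ) : ℝ :=
  2 ^ (2 * t) * (Real.Gamma (((n : ℝ) + 2 * t) / 2) / Real.Gamma (1 - t)) / Real.Gamma ((n : ℝ) / 2)

/-- The constant `π^{-n/2} Γ(n/2)`, twice the inverse of the area of the unit sphere. -/
def invSphere (n : ℕ) : ℝ := Real.pi ^ (-(n : ℝ) / 2) * Real.Gamma ((n : ℝ) / 2)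

theorem Gamma_half_pos {n : ℕ} (hn : 1 ≤ n) : 0 < Real.Gamma ((n : ℝ) / 2) := by
  have : (1 : ℝ) ≤ n := by exact_mod_cast hn
  exact Real.Gamma_pos_of_pos (by positivity)

theorem farConst_zero {n : ℕ} (hn : 1 ≤ n) : farConst n 0 = 1 := by
  have := (Gamma_half_pos hn).ne'
  simp [farConst, this]

theorem cConst_eq {n : ℕ} (hn : 1 ≤ n) (t : ℝ) : cConst n t = invSphere n * t * farConst n t := by
  have := (Gamma_half_pos hn).ne'
  rw [cConst, invSphere, farConst]
  field_simp

theorem contDiffAt_farConst {n : ℕ} (hn : 1 ≤ n) {t : ℝ} (h0 : -(1 / 2) < t) (h1 : t < 1)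
    (k : WithTop ℕ∞) : ContDiffAt ℝ k (farConst n) t := by
  have hn' : (1 : ℝ) ≤ n := by exact_mod_cast hn
  unfold farConst
  have hA : 0 < ((n : ℝ) + 2 * t) / 2 := by linarith
  have hB : 0 < 1 - t := by linarith
  have g1 : ContDiffAt ℝ k (fun t : ℝ => Real.Gamma (((n : ℝ) + 2 * t) / 2)) t :=
    (contDiffAt_Gamma hA k).comp t (f := fun t : ℝ => ((n : ℝ) + 2 * t) / 2) (by fun_prop)
  have g2 : ContDiffAt ℝ k (fun t : ℝ => Real.Gamma (1 - t)) t :=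
    (contDiffAt_Gamma hB k).comp t (f := fun t : ℝ => 1 - t) (by fun_prop)
  have g3 : ContDiffAt ℝ k (fun t : ℝ => (2 : ℝ) ^ (2 * t)) t :=
    contDiffAt_const.rpow (by fun_prop) (by norm_num)
  exact (g3.mul (g1.div g2 (Real.Gamma_pos_of_pos hB).ne')).div_const _

theorem contDiffOn_farConst {n : ℕ} (hn : 1 ≤ n) :
    ContDiffOn ℝ 2 (farConst n) (Set.Ioo (-(1 / 2)) 1) :=
  fun _ ht => (contDiffAt_farConst hn ht.1 ht.2 2).contDiffWithinAt

theorem contDiffOn_deriv_farConst {n : ℕ} (hn : 1 ≤ n) :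
    ContDiffOn ℝ 1 (deriv (farConst n)) (Set.Ioo (-(1 / 2)) 1) :=
  (contDiffOn_farConst hn).deriv_of_isOpen isOpen_Ioo (by norm_num)

theorem continuousOn_deriv_deriv_farConst {n : ℕ} (hn : 1 ≤ n) :
    ContinuousOn (deriv (deriv (farConst n))) (Set.Ioo (-(1 / 2)) 1) :=
  ((contDiffOn_deriv_farConst hn).deriv_of_isOpen (m := 0) isOpen_Ioo (by norm_num)).continuousOn

theorem hasDerivAt_farConst {n : ℕ} (hn : 1 ≤ n) {t : ℝ} (h0 : -(1 / 2) < t) (h1 : t < 1) :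
    HasDerivAt (farConst n) (deriv (farConst n) t) t :=
  (((contDiffOn_farConst hn).differentiableOn (by norm_num)).differentiableAt
    (Ioo_mem_nhds h0 h1)).hasDerivAt

theorem hasDerivAt_deriv_farConst {n : ℕ} (hn : 1 ≤ n) {t : ℝ} (h0 : -(1 / 2) < t) (h1 : t < 1) :
    HasDerivAt (deriv (farConst n)) (deriv (deriv (farConst n)) t) t :=
  (((contDiffOn_deriv_farConst hn).differentiableOn (by norm_num)).differentiableAt
    (Ioo_mem_nhds h0 h1)).hasDerivAt

theorem exists_bound_farConst {n : ℕ} (hn : 1 ≤ n) :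
    ∃ A : ℝ, 0 ≤ A ∧ ∀ t ∈ Set.Icc (0 : ℝ) (1 / 2), |farConst n t| ≤ A ∧
      |deriv (farConst n) t| ≤ A ∧ |deriv (deriv (farConst n)) t| ≤ A := by
  have hsub : Set.Icc (0 : ℝ) (1 / 2) ⊆ Set.Ioo (-(1 / 2)) 1 :=
    Set.Icc_subset_Ioo (by norm_num) (by norm_num)
  obtain ⟨A, hA⟩ := isCompact_Icc.exists_bound_of_continuousOn
    ((contDiffOn_farConst hn).continuousOn.mono hsub)
  obtain ⟨B, hB⟩ := isCompact_Icc.exists_bound_of_continuousOn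
    ((contDiffOn_deriv_farConst hn).continuousOn.mono hsub)
  obtain ⟨C, hC⟩ := isCompact_Icc.exists_bound_of_continuousOn
    ((continuousOn_deriv_deriv_farConst hn).mono hsub)
  refine ⟨max (max A B) (max C 0), by positivity, fun t ht => ⟨(hA t ht).trans ?_,
    (hB t ht).trans ?_, (hC t ht).trans ?_⟩⟩ <;> simp

/-! ### Splitting the integral at |h| = 1. -/

/-- The second difference, cut off to increments of length at most one. -/
def nearDiff {n : ℕ} (u : Rn n → ℝ) (x h : Rn n) : ℝ :=
  ({h : Rn n | ‖h‖ ≤ 1}).indicator (secondDiff u x) h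

/-- The translate `u(x + h)`, cut off to increments of length greater than one. -/
def farShift {n : ℕ} (u : Rn n → ℝ) (x h : Rn n) : ℝ :=
  ({h : Rn n | 1 < ‖h‖}).indicator (fun h => u (x + h)) h

theorem nearDiff_of_norm_le {n : ℕ} (u : Rn n → ℝ) (x : Rn n) {h : Rn n} (hh : ‖h‖ ≤ 1) :
    nearDiff u x h = secondDiff u x h := by
  simp [nearDiff, Set.indicator, hh]

theorem nearDiff_of_lt_norm {n : ℕ} (u : Rn n → ℝ) (x : Rn n) {h : Rn n} (hh : 1 < ‖h‖) :
    nearDiff u x h = 0 := by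
  simp [nearDiff, Set.indicator, not_le.2 hh]

theorem farShift_of_lt_norm {n : ℕ} (u : Rn n → ℝ) (x : Rn n) {h : Rn n} (hh : 1 < ‖h‖) :
    farShift u x h = u (x + h) := by
  simp [farShift, Set.indicator, hh]

theorem farShift_of_norm_le {n : ℕ} (u : Rn n → ℝ) (x : Rn n) {h : Rn n} (hh : ‖h‖ ≤ 1) :
    farShift u x h = 0 := by
  simp [farShift, Set.indicator, not_lt.2 hh]

theorem abs_nearDiff_le {n : ℕ} (u : Rn n → ℝ) (x h : Rn n) :
    |nearDiff u x h| ≤ |secondDiff u x h| := by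
  rcases le_or_gt ‖h‖ 1 with hh | hh
  · rw [nearDiff_of_norm_le u x hh]
  · rw [nearDiff_of_lt_norm u x hh, abs_zero]
    exact abs_nonneg _

theorem abs_farShift_le {n : ℕ} (u : Rn n → ℝ) (x h : Rn n) : |farShift u x h| ≤ |u (x + h)| := by
  rcases le_or_gt ‖h‖ 1 with hh | hh
  · rw [farShift_of_norm_le u x hh, abs_zero]
    exact abs_nonneg _
  · rw [farShift_of_lt_norm u x hh]

theorem measurableSet_norm_le_one {n : ℕ} : MeasurableSet {h : Rn n | ‖h‖ ≤ 1} :=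
  measurableSet_le measurable_norm measurable_const

theorem measurableSet_one_lt_norm {n : ℕ} : MeasurableSet {h : Rn n | 1 < ‖h‖} :=
  measurableSet_lt measurable_const measurable_norm

theorem measurable_uncurry_nearDiff {n : ℕ} {u : Rn n → ℝ} (hu : Continuous u) :
    Measurable (Function.uncurry (nearDiff u)) := by
  have : Function.uncurry (nearDiff u) = (Prod.snd ⁻¹' {h : Rn n | ‖h‖ ≤ 1}).indicator
      (fun p : Rn n × Rn n => secondDiff u p.1 p.2) := by
    funext p
    rfl
  rw [this]
  exact (continuous_secondDiff hu).measurable.indicator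
    (measurable_snd measurableSet_norm_le_one)

theorem measurable_uncurry_farShift {n : ℕ} {u : Rn n → ℝ} (hu : Continuous u) :
    Measurable (Function.uncurry (farShift u)) := by
  have : Function.uncurry (farShift u) = (Prod.snd ⁻¹' {h : Rn n | 1 < ‖h‖}).indicator
      (fun p : Rn n × Rn n => u (p.1 + p.2)) := by
    funext p
    rfl
  rw [this]
  exact (Continuous.measurable (by fun_prop)).indicator
    (measurable_snd measurableSet_one_lt_norm)

theorem measurable_nearDiff {n : ℕ} {u : Rn n → ℝ} (hu : Continuous u) (x : Rn n) :
    Measurable (nearDiff u x) :=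
  (measurable_uncurry_nearDiff hu).of_uncurry_left

theorem measurable_farShift {n : ℕ} {u : Rn n → ℝ} (hu : Continuous u) (x : Rn n) :
    Measurable (farShift u x) :=
  (measurable_uncurry_farShift hu).of_uncurry_left

/-- The function `π^{-n/2} Γ(n/2) (½ ∫_{|h| ≤ 1} D(x,h) k(h) dh - ∫_{|h| > 1} u(x+h) k(h) dh)`, where
`D` is the second difference and `k(h) = |h|^{-n-2t} (-2 ln |h|)^k`. -/
def zeroPart {n : ℕ} (u : Rn n → ℝ) (k : ℕ) (t : ℝ) (x : Rn n) : ℝ :=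
  invSphere n * ((∫ h, nearDiff u x h * powKernel n k t h) / 2 -
    ∫ h, farShift u x h * powKernel n k t h)

theorem measurable_zeroPart {n : ℕ} {u : Rn n → ℝ} (hu : Continuous u) (k : ℕ) (t : ℝ) :
    Measurable (zeroPart u k t) := by
  have h1 : StronglyMeasurable (Function.uncurry fun x h => nearDiff u x h * powKernel n k t h) :=
    ((measurable_uncurry_nearDiff hu).mul
      ((measurable_powKernel n k t).comp measurable_snd)).stronglyMeasurable
  have h2 : StronglyMeasurable (Function.uncurry fun x h => farShift u x h * powKernel n k t h) :=
    ((measurable_uncurry_farShift hu).mul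
      ((measurable_powKernel n k t).comp measurable_snd)).stronglyMeasurable
  exact ((h1.integral_prod_right.measurable.div_const 2).sub
    h2.integral_prod_right.measurable).const_mul _

theorem IsCc2.exists_nearDiff_bound {n : ℕ} {u : Rn n → ℝ} (hu : IsCc2 u) :
    ∃ C R : ℝ, 0 ≤ C ∧ 0 < R ∧ (∀ x h, |nearDiff u x h| ≤ C * min 1 (‖h‖ ^ 2)) ∧
      ∀ x h, R < ‖x‖ → nearDiff u x h = 0 := by
  obtain ⟨C, hC0, hC⟩ := hu.abs_secondDiff_le
  obtain ⟨R, hR0, hR⟩ := hu.exists_radius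
  refine ⟨C, R + 1, hC0, by positivity, fun x h => ?_, fun x h hx => ?_⟩
  · exact (abs_nearDiff_le u x h).trans (hC x h)
  · rcases lt_or_ge 1 ‖h‖ with hh' | hh'
    · exact nearDiff_of_lt_norm u x hh'
    rw [nearDiff_of_norm_le u x hh']
    have e1 := hR x (by linarith)
    have e2 := hR (x + h) (by have := norm_sub_le (x + h) h; rw [add_sub_cancel_right] at this; linarith)
    have e3 := hR (x - h) (by have := norm_add_le (x - h) h; rw [sub_add_cancel] at this; linarith)
    rw [secondDiff, e1, e2, e3]
    simp

theorem powKernel_zero_le_of_norm_le_one {n : ℕ} {a b : ℝ} (hab : a ≤ b) {h : Rn n} (hh : h ≠ 0)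
    (h1 : ‖h‖ ≤ 1) : powKernel n 0 a h ≤ powKernel n 0 b h := by
  simp only [powKernel, pow_zero, mul_one]
  exact Real.rpow_le_rpow_of_exponent_ge (norm_pos_iff.2 hh) h1 (by linarith)

/-- For 0 < |h| ≤ 1 the kernel increases with t, so any t < 1, also t ≤ 0, is compared with a
parameter in (0,1). -/
theorem integrable_nearDiff_mul_powKernel_zero {n : ℕ} (hn : 1 ≤ n) {u : Rn n → ℝ} (hu : IsCc2 u)
    (x : Rn n) {t : ℝ} (h1 : t < 1) : Integrable fun h => nearDiff u x h * powKernel n 0 t h := by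
  obtain ⟨C, R, hC0, -, hC, -⟩ := hu.exists_nearDiff_bound
  have hmax : t ≤ max t (1 / 2) := le_max_left _ _
  have hi := integrable_mul_of_le_min (measurable_nearDiff hu.continuous x).aestronglyMeasurable
    (measurable_powKernel n 0 (max t (1 / 2))).aestronglyMeasurable (hC x)
    (integrable_min_mul_powKernel hn 0 (lt_max_of_lt_right (by norm_num))
      (max_lt h1 (by norm_num)))
  refine hi.mono ((measurable_nearDiff hu.continuous x).mul
    (measurable_powKernel n 0 t)).aestronglyMeasurable ?_
  filter_upwards [ae_ne_zero hn] with h hh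
  by_cases hh1 : ‖h‖ ≤ 1
  · rw [norm_mul, norm_mul, Real.norm_of_nonneg (powKernel_zero_nonneg t h),
      Real.norm_of_nonneg (powKernel_zero_nonneg _ h)]
    gcongr
    exact powKernel_zero_le_of_norm_le_one hmax hh hh1
  · have : nearDiff u x h = 0 := nearDiff_of_lt_norm u x (not_le.1 hh1)
    rw [this, zero_mul, zero_mul]

/-- For |h| > 1 the kernel is at most 1 once -n-2t ≤ 0, which t ≥ -1/2 and n ≥ 1 ensure;
integrability then comes from u alone. -/
theorem integrable_farShift_mul_powKernel_zero {n : ℕ} (hn : 1 ≤ n) {u : Rn n → ℝ} (hu : IsCc2 u)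
    (x : Rn n) {t : ℝ} (h1 : -(1 / 2) ≤ t) :
    Integrable fun h => farShift u x h * powKernel n 0 t h := by
  have hn' : (1 : ℝ) ≤ n := by exact_mod_cast hn
  refine (hu.integrable.comp_add_left x).mono ((measurable_farShift hu.continuous x).mul
    (measurable_powKernel n 0 t)).aestronglyMeasurable (Eventually.of_forall fun h => ?_)
  by_cases hh : 1 < ‖h‖
  · rw [norm_mul, Real.norm_of_nonneg (powKernel_zero_nonneg t h)]
    refine (mul_le_of_le_one_right (norm_nonneg _) ?_).trans (abs_farShift_le u x h)
    simp only [powKernel, pow_zero, mul_one]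
    exact Real.rpow_le_one_of_one_le_of_nonpos hh.le (by linarith)
  · have : farShift u x h = 0 := farShift_of_norm_le u x (not_lt.1 hh)
    rw [this, zero_mul, norm_zero]
    exact norm_nonneg _

/-- With the divergent term u(x) ∫_{|h|>1} removed, both pieces converge on an interval around t =
0, so 0 is an interior point and ordinary two-sided derivatives are available there. -/
theorem hasDerivAt_zeroPart {n : ℕ} (hn : 1 ≤ n) {u : Rn n → ℝ} (hu : IsCc2 u) (k : ℕ) {t : ℝ}
    (h0 : -(1 / 2) < t) (h1 : t < 1) (x : Rn n) :
    HasDerivAt (fun τ => zeroPart u k τ x) (zeroPart u (k + 1) t x) t := by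
  have d1 := (integrable_and_hasDerivAt_integral_powKernel hn
    (measurable_nearDiff hu.continuous x).aestronglyMeasurable (a := t - 1) (b := (t + 1) / 2)
    (by linarith) (by linarith) (integrable_nearDiff_mul_powKernel_zero hn hu x (by linarith))
    (integrable_nearDiff_mul_powKernel_zero hn hu x (by linarith)) k).2
  have d2 := (integrable_and_hasDerivAt_integral_powKernel hn
    (measurable_farShift hu.continuous x).aestronglyMeasurable (a := -(1 / 2)) (b := t + 1)
    h0 (by linarith) (integrable_farShift_mul_powKernel_zero hn hu x le_rfl)
    (integrable_farShift_mul_powKernel_zero hn hu x (t := t + 1) (by linarith)) k).2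
  exact ((d1.div_const 2).sub d2).const_mul (invSphere n)

/-! ### Decay -/

/-- The weight `(1 + |x|)^{-(n - δ)}`. -/
def decay (n : ℕ) (δ : ℝ) (x : Rn n) : ℝ := (1 + ‖x‖) ^ (-((n : ℝ) - δ))

theorem decay_pos {n : ℕ} (δ : ℝ) (x : Rn n) : 0 < decay n δ x := by
  unfold decay
  positivity

theorem exists_le_decay {n : ℕ} (hn : 1 ≤ n) {δ : ℝ} (hδ : δ ≤ 1) {M R : ℝ} (hM : 0 ≤ M)
    (hR : 0 < R) : ∃ C : ℝ, 0 ≤ C ∧ ∀ x : Rn n, ‖x‖ ≤ R → M ≤ C * decay n δ x := by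
  have hn' : (1 : ℝ) ≤ n := by exact_mod_cast hn
  refine ⟨M * (1 + R) ^ ((n : ℝ) - δ), by positivity, fun x hx => ?_⟩
  have h1 : (1 + ‖x‖) ^ ((n : ℝ) - δ) ≤ (1 + R) ^ ((n : ℝ) - δ) :=
    Real.rpow_le_rpow (by positivity) (by linarith) (by linarith)
  have h2 : (1 + ‖x‖) ^ ((n : ℝ) - δ) * decay n δ x = 1 := by
    rw [decay, ← Real.rpow_add (by positivity), add_neg_cancel, Real.rpow_zero]
  calc M = M * ((1 + ‖x‖) ^ ((n : ℝ) - δ) * decay n δ x) := by rw [h2, mul_one]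
    _ ≤ M * ((1 + R) ^ ((n : ℝ) - δ) * decay n δ x) := by
      have := (decay_pos δ x).le
      gcongr
    _ = _ := by ring

theorem exists_bound_integral_nearDiff {n : ℕ} (hn : 1 ≤ n) {u : Rn n → ℝ} (hu : IsCc2 u) (k : ℕ)
    {δ : ℝ} (hδ : δ ≤ 1) :
    ∃ C : ℝ, 0 ≤ C ∧ ∀ t ∈ Set.Icc (0 : ℝ) (1 / 2), ∀ x,
      |∫ h, nearDiff u x h * powKernel n k t h| ≤ C * decay n δ x := by
  obtain ⟨C, R, hC0, hR0, hC, hR⟩ := hu.exists_nearDiff_bound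
  set B : ℝ := 2 * (2 * ((k : ℝ) + 1) / (1 / 4)) ^ k with hB
  have hB0 : 0 ≤ B := by positivity
  have hi := integrable_min_mul_powKernel_zero hn (t := 3 / 4) (by norm_num) (by norm_num)
  set g : Rn n → ℝ := fun h => C * (B * (2 * (min 1 (‖h‖ ^ 2) * powKernel n 0 (3 / 4) h))) with hg
  have hgi : Integrable g := ((hi.const_mul 2).const_mul B).const_mul C
  have hg0 : ∀ h, 0 ≤ g h := fun h => by
    have := powKernel_zero_nonneg (3 / 4) h
    rw [hg]
    positivity
  obtain ⟨A, hA0, hA⟩ := exists_le_decay hn hδ (M := ∫ h, g h) (integral_nonneg hg0) hR0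
  refine ⟨A, hA0, fun t ht x => ?_⟩
  rcases le_or_gt ‖x‖ R with hx | hx
  · refine le_trans ?_ (hA x hx)
    rw [← Real.norm_eq_abs]
    refine norm_integral_le_of_norm_le hgi ?_
    filter_upwards [ae_ne_zero hn] with h hh
    by_cases hh1 : ‖h‖ ≤ 1
    -- Enlarging [0, 1/2] by 1/4 on each side leaves room for the logarithms while the upper
    -- parameter 3/4 stays below 1.
    · have e1 := abs_powKernel_le (n := n) (k := k) (a := -(1 / 4)) (b := 3 / 4) (ε := 1 / 4) (t := t)
        (by norm_num) (by linarith [ht.1]) (by linarith [ht.2]) hh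
      have e2 := powKernel_zero_le_of_norm_le_one (n := n) (a := -(1 / 4)) (b := 3 / 4)
        (by norm_num) hh hh1
      rw [norm_mul, hg]
      calc ‖nearDiff u x h‖ * ‖powKernel n k t h‖
          ≤ (C * min 1 (‖h‖ ^ 2)) * (B * (powKernel n 0 (-(1 / 4)) h + powKernel n 0 (3 / 4) h)) :=
            mul_le_mul (hC x h) e1 (norm_nonneg _) (by positivity)
        _ ≤ (C * min 1 (‖h‖ ^ 2)) * (B * (powKernel n 0 (3 / 4) h + powKernel n 0 (3 / 4) h)) := by
            gcongr
        _ = _ := by ring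
    · have : nearDiff u x h = 0 := nearDiff_of_lt_norm u x (not_le.1 hh1)
      rw [this, zero_mul, norm_zero]
      exact hg0 h
  · simp only [hR x _ hx, zero_mul, integral_zero, abs_zero]
    have := (decay_pos δ x).le
    positivity

/-- Where u(x+h) ≠ 0 one has |x+h| ≤ R, and with |h| > 1 this gives 1 + |x| ≤ (2+R)|h|. The kernel
thus decays in x like |x|^{-n}, up to logarithms that are paid for with the power δ. -/
theorem exists_bound_integral_farShift {n : ℕ} (hn : 1 ≤ n) {u : Rn n → ℝ} (hu : IsCc2 u) (k : ℕ)
    {δ : ℝ} (hδ0 : 0 < δ) (hδ : δ ≤ 1) :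
    ∃ C : ℝ, 0 ≤ C ∧ ∀ t ∈ Set.Icc (0 : ℝ) (1 / 2), ∀ x,
      |∫ h, farShift u x h * powKernel n k t h| ≤ C * decay n δ x := by
  have hn' : (1 : ℝ) ≤ n := by exact_mod_cast hn
  obtain ⟨R, hR0, hR⟩ := hu.exists_radius
  set B : ℝ := (2 * ((k : ℝ) + 1) / δ) ^ k * (2 + R) ^ ((n : ℝ) - δ) with hB
  have hB0 : 0 ≤ B := by positivity
  have hN0 : 0 ≤ ∫ y, |u y| := integral_nonneg fun x => abs_nonneg _
  refine ⟨B * ∫ y, |u y|, by positivity, fun t ht x => ?_⟩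
  have hi : Integrable fun h => B * decay n δ x * |u (x + h)| :=
    ((hu.integrable.comp_add_left x).abs).const_mul _
  have hval : ∫ h, B * decay n δ x * |u (x + h)| = B * (∫ y, |u y|) * decay n δ x := by
    rw [integral_const_mul, integral_add_left_eq_self (μ := volume) (fun y => |u y|) x]
    ring
  rw [← hval, ← Real.norm_eq_abs]
  refine norm_integral_le_of_norm_le hi (Eventually.of_forall fun h => ?_)
  have hd := (decay_pos δ x).le
  by_cases hh : 1 < ‖h‖
  · rcases le_or_gt ‖x + h‖ R with hxh | hxh
    · have hr0 : 0 < ‖h‖ := by linarith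
      have e1 : |powKernel n k t h| ≤ B * decay n δ x := by
        have f1 : |(-2 * Real.log ‖h‖) ^ k| ≤ (2 * ((k : ℝ) + 1) / δ) ^ k * ‖h‖ ^ δ := by
          rw [abs_pow, neg_mul, abs_neg, abs_of_nonneg (by have := Real.log_nonneg hh.le; positivity)]
          exact two_mul_log_pow_le hδ0 hh.le
        have f2 : ‖h‖ ^ (-(n : ℝ) - 2 * t) ≤ ‖h‖ ^ (-(n : ℝ)) :=
          Real.rpow_le_rpow_of_exponent_le hh.le (by linarith [ht.1])
        have f3 : ‖h‖ ^ (-((n : ℝ) - δ)) ≤ ((1 + ‖x‖) / (2 + R)) ^ (-((n : ℝ) - δ)) := by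
          refine Real.rpow_le_rpow_of_nonpos (by positivity) ?_ (by linarith)
          rw [div_le_iff₀ (by positivity)]
          have := norm_sub_le (x + h) h
          rw [add_sub_cancel_right] at this
          nlinarith
        rw [powKernel, abs_mul, abs_of_nonneg (by positivity)]
        calc ‖h‖ ^ (-(n : ℝ) - 2 * t) * |(-2 * Real.log ‖h‖) ^ k|
            ≤ ‖h‖ ^ (-(n : ℝ)) * ((2 * ((k : ℝ) + 1) / δ) ^ k * ‖h‖ ^ δ) := by gcongr
          _ = (2 * ((k : ℝ) + 1) / δ) ^ k * ‖h‖ ^ (-((n : ℝ) - δ)) := by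
              rw [neg_sub, sub_eq_neg_add, Real.rpow_add hr0]
              ring
          _ ≤ (2 * ((k : ℝ) + 1) / δ) ^ k * ((1 + ‖x‖) / (2 + R)) ^ (-((n : ℝ) - δ)) := by gcongr
          _ = _ := by
              rw [Real.div_rpow (by positivity) (by positivity), hB, decay,
                Real.rpow_neg (by positivity : 0 ≤ 2 + R), div_inv_eq_mul]
              ring
      rw [norm_mul, mul_comm]
      exact mul_le_mul e1 (abs_farShift_le u x h) (norm_nonneg _) (by positivity)
    · have : farShift u x h = 0 := by rw [farShift_of_lt_norm u x hh, hR _ hxh]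
      rw [this, zero_mul, norm_zero]
      positivity
  · have : farShift u x h = 0 := farShift_of_norm_le u x (not_lt.1 hh)
    rw [this, zero_mul, norm_zero]
    positivity

theorem exists_bound_zeroPart {n : ℕ} (hn : 1 ≤ n) {u : Rn n → ℝ} (hu : IsCc2 u) (k : ℕ)
    {δ : ℝ} (hδ0 : 0 < δ) (hδ : δ ≤ 1) :
    ∃ C : ℝ, 0 ≤ C ∧ ∀ t ∈ Set.Icc (0 : ℝ) (1 / 2), ∀ x, |zeroPart u k t x| ≤ C * decay n δ x := by
  obtain ⟨A, hA0, hA⟩ := exists_bound_integral_nearDiff hn hu k hδ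
  obtain ⟨B, hB0, hB⟩ := exists_bound_integral_farShift hn hu k hδ0 hδ
  refine ⟨|invSphere n| * (A / 2 + B), by positivity, fun t ht x => ?_⟩
  rw [zeroPart, abs_mul, mul_assoc]
  gcongr
  refine (abs_sub _ _).trans ?_
  rw [abs_div, abs_two, add_mul, div_mul_eq_mul_div]
  gcongr
  · exact hA t ht x
  · exact hB t ht x

theorem exists_bound_decay {n : ℕ} (hn : 1 ≤ n) {u : Rn n → ℝ} (hu : IsCc2 u) {δ : ℝ}
    (hδ : δ ≤ 1) : ∃ C : ℝ, 0 ≤ C ∧ ∀ x, |u x| ≤ C * decay n δ x := by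
  obtain ⟨M, hM0, hM⟩ := hu.exists_bound
  obtain ⟨R, hR0, hR⟩ := hu.exists_radius
  obtain ⟨C, hC0, hC⟩ := exists_le_decay hn hδ hM0.le hR0
  refine ⟨C, hC0, fun x => ?_⟩
  rcases le_or_gt ‖x‖ R with hx | hx
  · exact (hM x).trans (hC x hx)
  · rw [hR x hx, abs_zero]
    have := (decay_pos δ x).le
    positivity

/-- For finite p one needs (n - δ)p > n. The choice δ = (p-1)/(2p) makes δp = (p-1)/2, less than
n(p-1) because n ≥ 1 and p > 1. -/
theorem memLp_decay {n : ℕ} (hn : 1 ≤ n) {p : ℝ≥0∞} (hp : 1 < p) :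
    ∃ δ : ℝ, 0 < δ ∧ δ ≤ 1 ∧ MemLp (decay n δ) p := by
  have hn' : (1 : ℝ) ≤ n := by exact_mod_cast hn
  have hcont : ∀ δ, Continuous (decay n δ) := fun δ => by
    unfold decay
    exact Continuous.rpow_const (by fun_prop) fun x => Or.inl (by positivity)
  rcases eq_or_ne p ∞ with rfl | hpt
  · refine ⟨1, one_pos, le_rfl, memLp_top_of_bound (hcont 1).aestronglyMeasurable 1
      (Eventually.of_forall fun x => ?_)⟩
    rw [Real.norm_of_nonneg (decay_pos 1 x).le, decay]
    exact Real.rpow_le_one_of_one_le_of_nonpos (by linarith [norm_nonneg x]) (by linarith)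
  · have hq : 1 < p.toReal := by
      rw [← ENNReal.toReal_one]
      exact (ENNReal.toReal_lt_toReal ENNReal.one_ne_top hpt).2 hp
    have hq0 : 0 < p.toReal := by linarith
    set q := p.toReal with hqdef
    have hδ0 : 0 < (q - 1) / (2 * q) := div_pos (by linarith) (by linarith)
    have hδ1 : (q - 1) / (2 * q) ≤ 1 := by
      rw [div_le_one (by linarith)]
      linarith
    refine ⟨(q - 1) / (2 * q), hδ0, hδ1, ?_⟩
    rw [← integrable_norm_rpow_iff (hcont _).aestronglyMeasurable (by positivity) hpt]
    have hfin : ((Module.finrank ℝ (Rn n) : ℕ) : ℝ) < ((n : ℝ) - (q - 1) / (2 * q)) * q := by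
      rw [finrank_euclideanSpace, Fintype.card_fin]
      have : (q - 1) / (2 * q) * q = (q - 1) / 2 := by field_simp
      rw [sub_mul, this]
      nlinarith
    refine (integrable_one_add_norm (E := Rn n) (μ := volume) hfin).congr
      (Eventually.of_forall fun x => ?_)
    simp only []
    rw [Real.norm_of_nonneg (decay_pos _ x).le, decay, ← Real.rpow_mul (by positivity), neg_mul]

/-! ### The expansion in t around order zero. -/

theorem invSphere_mul_volume_ball {n : ℕ} (hn : 1 ≤ n) :
    invSphere n * (n * volume.real (Metric.ball (0 : Rn n) 1) / 2) = 1 := by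
  have hn' : (1 : ℝ) ≤ n := by exact_mod_cast hn
  have : Nonempty (Fin n) := ⟨⟨0, hn⟩⟩
  have hΓ := (Gamma_half_pos hn).ne'
  have hG : Real.Gamma ((n : ℝ) / 2 + 1) = (n : ℝ) / 2 * Real.Gamma ((n : ℝ) / 2) :=
    Real.Gamma_add_one (by positivity)
  have hpow : √Real.pi ^ n = Real.pi ^ ((n : ℝ) / 2) := by
    rw [Real.sqrt_eq_rpow, ← Real.rpow_natCast, ← Real.rpow_mul Real.pi_nonneg]
    congr 1
    ring
  have hπ : Real.pi ^ (-(n : ℝ) / 2) * Real.pi ^ ((n : ℝ) / 2) = 1 := by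
    rw [← Real.rpow_add Real.pi_pos, neg_div, neg_add_cancel, Real.rpow_zero]
  rw [Measure.real, EuclideanSpace.volume_ball, ENNReal.ofReal_one, one_pow, one_mul,
    Fintype.card_fin, ENNReal.toReal_ofReal (by rw [hG]; positivity), hG, hpow, invSphere]
  calc _ = Real.pi ^ (-(n : ℝ) / 2) * Real.pi ^ ((n : ℝ) / 2) := by field_simp
    _ = 1 := hπ

theorem integral_one_lt_powKernel {n : ℕ} (hn : 1 ≤ n) {t : ℝ} (h0 : 0 < t) :
    (Integrable fun h : Rn n => ({h : Rn n | 1 < ‖h‖}).indicator 1 h * powKernel n 0 t h) ∧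
    ∫ h : Rn n, ({h : Rn n | 1 < ‖h‖}).indicator 1 h * powKernel n 0 t h =
      n * volume.real (Metric.ball (0 : Rn n) 1) / (2 * t) := by
  have : Nonempty (Fin n) := ⟨⟨0, hn⟩⟩
  have : Nontrivial (Rn n) := inferInstance
  set f : ℝ → ℝ := (Set.Ioi (1 : ℝ)).indicator fun r => r ^ (-(n : ℝ) - 2 * t) with hf
  have hfun : ∀ h : Rn n, ({h : Rn n | 1 < ‖h‖}).indicator 1 h * powKernel n 0 t h = f ‖h‖ := by
    intro h
    by_cases hh : 1 < ‖h‖ <;> simp [hf, Set.indicator, hh, powKernel]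
  have hpow : ∀ r ∈ Set.Ioi (0 : ℝ), r ^ (n - 1) • f r =
      (Set.Ioi (1 : ℝ)).indicator (fun r => r ^ (-1 - 2 * t)) r := by
    intro r hr
    by_cases hr1 : r ∈ Set.Ioi (1 : ℝ)
    · rw [hf, Set.indicator_of_mem hr1, Set.indicator_of_mem hr1, smul_eq_mul,
        ← Real.rpow_natCast, ← Real.rpow_add hr, Nat.cast_sub hn]
      congr 1
      push_cast
      ring
    · rw [hf, Set.indicator_of_notMem hr1, Set.indicator_of_notMem hr1, smul_zero]
  have hi : IntegrableOn (fun r : ℝ => r ^ (-1 - 2 * t)) (Set.Ioi 1) :=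
    integrableOn_Ioi_rpow_of_lt (by linarith) zero_lt_one
  constructor
  · simp only [hfun]
    rw [integrable_fun_norm_addHaar, finrank_euclideanSpace, Fintype.card_fin]
    exact ((integrable_indicator_iff measurableSet_Ioi).2 hi).integrableOn.congr_fun
      (fun r hr => (hpow r hr).symm) measurableSet_Ioi
  · simp only [hfun]
    rw [integral_fun_norm_addHaar, finrank_euclideanSpace, Fintype.card_fin,
      setIntegral_congr_fun measurableSet_Ioi hpow, setIntegral_indicator measurableSet_Ioi,
      Set.inter_eq_self_of_subset_right (Set.Ioi_subset_Ioi zero_le_one),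
      integral_Ioi_rpow_of_lt (by linarith) zero_lt_one, Real.one_rpow, nsmul_eq_mul, smul_eq_mul]
    have : -1 - 2 * t + 1 = -(2 * t) := by ring
    rw [this]
    field_simp

theorem secondDiff_eq_near_add_far {n : ℕ} (u : Rn n → ℝ) (x h : Rn n) :
    secondDiff u x h = nearDiff u x h + 2 * u x * ({h : Rn n | 1 < ‖h‖}).indicator 1 h -
      farShift u x h - farShift u x (-h) := by
  rcases le_or_gt ‖h‖ 1 with hh | hh
  · rw [nearDiff_of_norm_le u x hh, farShift_of_norm_le u x hh,
      farShift_of_norm_le u x (by rwa [norm_neg])]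
    simp [Set.indicator, not_lt.2 hh]
  · rw [nearDiff_of_lt_norm u x hh, farShift_of_lt_norm u x hh,
      farShift_of_lt_norm u x (by rwa [norm_neg])]
    simp [Set.indicator, hh, secondDiff, sub_eq_add_neg]

/-- Integrating 2u(x) |h|^{-n-2t} over |h| > 1 gives a multiple of u(x)/t. The factor t in c_{n,t}
cancels it, and the sphere constant normalizes the coefficient of u(x) to 1; the two far translates
contribute equally by reflection. -/
theorem fracLap_eq_expansion {n : ℕ} (hn : 1 ≤ n) {t : ℝ} (h0 : 0 < t) (h1 : t < 1)
    {u : Rn n → ℝ} (hu : IsCc2 u) (x : Rn n) :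
    fracLap t u x = farConst n t * (u x + t * zeroPart u 0 t x) := by
  have i1 := integrable_nearDiff_mul_powKernel_zero hn hu x h1
  obtain ⟨i2, e2⟩ := integral_one_lt_powKernel hn h0
  have i3 := integrable_farShift_mul_powKernel_zero hn hu x (t := t) (by linarith)
  have i4 : Integrable fun h => farShift u x (-h) * powKernel n 0 t h := by
    simpa only [powKernel_neg] using i3.comp_neg
  have e4 : ∫ h, farShift u x (-h) * powKernel n 0 t h = ∫ h, farShift u x h * powKernel n 0 t h := by
    rw [← integral_neg_eq_self (fun h => farShift u x h * powKernel n 0 t h)]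
    simp only [powKernel_neg]
  have key : ∫ h, secondDiff u x h * powKernel n 0 t h =
      (∫ h, nearDiff u x h * powKernel n 0 t h) +
      2 * u x * (n * volume.real (Metric.ball (0 : Rn n) 1) / (2 * t)) -
      2 * ∫ h, farShift u x h * powKernel n 0 t h := by
    have hfun : ∀ h, secondDiff u x h * powKernel n 0 t h =
        nearDiff u x h * powKernel n 0 t h +
        2 * u x * (({h : Rn n | 1 < ‖h‖}).indicator 1 h * powKernel n 0 t h) -
        farShift u x h * powKernel n 0 t h - farShift u x (-h) * powKernel n 0 t h := fun h => by
      rw [secondDiff_eq_near_add_far]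
      ring
    simp only [hfun]
    have j1 : Integrable fun h => nearDiff u x h * powKernel n 0 t h +
        2 * u x * (({h : Rn n | 1 < ‖h‖}).indicator 1 h * powKernel n 0 t h) :=
      i1.add (i2.const_mul _)
    have j2 : Integrable fun h => nearDiff u x h * powKernel n 0 t h +
        2 * u x * (({h : Rn n | 1 < ‖h‖}).indicator 1 h * powKernel n 0 t h) -
        farShift u x h * powKernel n 0 t h := j1.sub i3
    rw [integral_sub j2 i4, integral_sub j1 i3, integral_add i1 (i2.const_mul _),
      integral_const_mul, e2, e4]
    ring
  have hball := invSphere_mul_volume_ball hn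
  rw [fracLap_eq hn h0 h1 hu, key, cConst_eq hn, zeroPart]
  calc _ = farConst n t * ((invSphere n * (n * volume.real (Metric.ball (0 : Rn n) 1) / 2)) * u x +
        t * (invSphere n * ((∫ h, nearDiff u x h * powKernel n 0 t h) / 2 -
          ∫ h, farShift u x h * powKernel n 0 t h))) := by
        field_simp
        ring
    _ = _ := by rw [hball, one_mul]

/-- The first derivative in `t` of `farConst n t * (u x + t * zeroPart u 0 t x)`. -/
def expansionDeriv {n : ℕ} (u : Rn n → ℝ) (t : ℝ) (x : Rn n) : ℝ :=
  deriv (farConst n) t * (u x + t * zeroPart u 0 t x) +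
    farConst n t * (zeroPart u 0 t x + t * zeroPart u 1 t x)

theorem hasDerivAt_expansion {n : ℕ} (hn : 1 ≤ n) {t : ℝ} (h0 : -(1 / 2) < t) (h1 : t < 1)
    {u : Rn n → ℝ} (hu : IsCc2 u) (x : Rn n) :
    HasDerivAt (fun τ => farConst n τ * (u x + τ * zeroPart u 0 τ x)) (expansionDeriv u t x) t := by
  have d := (hasDerivAt_farConst hn h0 h1).mul
    (((hasDerivAt_id t).mul (hasDerivAt_zeroPart hn hu 0 h0 h1 x)).const_add (u x))
  refine d.congr_deriv ?_
  simp [expansionDeriv]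

theorem hasDerivAt_expansionDeriv {n : ℕ} (hn : 1 ≤ n) {t : ℝ} (h0 : -(1 / 2) < t) (h1 : t < 1)
    {u : Rn n → ℝ} (hu : IsCc2 u) (x : Rn n) :
    HasDerivAt (fun τ => expansionDeriv u τ x)
      (deriv (deriv (farConst n)) t * (u x + t * zeroPart u 0 t x) +
        2 * (deriv (farConst n) t * (zeroPart u 0 t x + t * zeroPart u 1 t x)) +
        farConst n t * (2 * zeroPart u 1 t x + t * zeroPart u 2 t x)) t := by
  have z0 := hasDerivAt_zeroPart hn hu 0 h0 h1 x
  have z1 := hasDerivAt_zeroPart hn hu 1 h0 h1 x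
  have d := ((hasDerivAt_deriv_farConst hn h0 h1).mul
    (((hasDerivAt_id t).mul z0).const_add (u x))).add
    ((hasDerivAt_farConst hn h0 h1).mul (z0.add ((hasDerivAt_id t).mul z1)))
  refine d.congr_deriv ?_
  simp
  ring

theorem fracLogLap_eq_expansionDeriv {n : ℕ} (hn : 1 ≤ n) {t : ℝ} (h0 : 0 < t) (h1 : t < 1)
    {u : Rn n → ℝ} (hu : IsCc2 u) (x : Rn n) : fracLogLap t u x = expansionDeriv u t x := by
  refine ((hasDerivAt_expansion hn (by linarith) h1 hu x).congr_of_eventuallyEq ?_).deriv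
  filter_upwards [Ioo_mem_nhds h0 h1] with τ hτ
  exact fracLap_eq_expansion hn hτ.1 hτ.2 hu x

/-- Mean value inequality in t: every term of the second t-derivative of the expansion is a bounded
coefficient times a function bounded by the weight, uniformly for t in [0, 1/2]. -/
theorem exists_bound_expansionDeriv_sub {n : ℕ} (hn : 1 ≤ n) {u : Rn n → ℝ} (hu : IsCc2 u)
    {δ : ℝ} (hδ0 : 0 < δ) (hδ : δ ≤ 1) :
    ∃ C : ℝ, 0 ≤ C ∧ ∀ t ∈ Set.Icc (0 : ℝ) (1 / 2), ∀ x,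
      |expansionDeriv u t x - expansionDeriv u 0 x| ≤ C * decay n δ x * t := by
  obtain ⟨A, hA0, hA⟩ := exists_bound_farConst hn
  obtain ⟨U, hU0, hU⟩ := exists_bound_decay hn hu hδ
  obtain ⟨B0, hB0, hB0'⟩ := exists_bound_zeroPart hn hu 0 hδ0 hδ
  obtain ⟨B1, hB1, hB1'⟩ := exists_bound_zeroPart hn hu 1 hδ0 hδ
  obtain ⟨B2, hB2, hB2'⟩ := exists_bound_zeroPart hn hu 2 hδ0 hδ
  refine ⟨A * (U + B0) + 2 * (A * (B0 + B1)) + A * (2 * B1 + B2), by positivity, fun t ht x => ?_⟩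
  have hw := (decay_pos δ x).le
  have hsub : ∀ τ ∈ Set.Icc (0 : ℝ) t, τ ∈ Set.Icc (0 : ℝ) (1 / 2) :=
    fun τ hτ => ⟨hτ.1, hτ.2.trans ht.2⟩
  have key := norm_image_sub_le_of_norm_deriv_le_segment'
    (f := fun τ => expansionDeriv u τ x) (a := 0) (b := t)
    (C := (A * (U + B0) + 2 * (A * (B0 + B1)) + A * (2 * B1 + B2)) * decay n δ x)
    (fun τ hτ => (hasDerivAt_expansionDeriv hn (by linarith [hτ.1])
      (by linarith [(hsub τ hτ).2]) hu x).hasDerivWithinAt) ?_ t ⟨ht.1, le_rfl⟩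
  · rwa [sub_zero] at key
  · intro τ hτ
    have hτ' := hsub τ ⟨hτ.1, hτ.2.le⟩
    obtain ⟨a0, a1, a2⟩ := hA τ hτ'
    have b0 := hB0' τ hτ' x
    have b1 := hB1' τ hτ' x
    have b2 := hB2' τ hτ' x
    have hτ1 : |τ| ≤ 1 := by rw [abs_of_nonneg hτ'.1]; linarith [hτ'.2]
    have hmul : ∀ z c : ℝ, |z| ≤ c * decay n δ x → |τ * z| ≤ c * decay n δ x := fun z c hz => by
      rw [abs_mul]
      exact (mul_le_of_le_one_left (abs_nonneg z) hτ1).trans hz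
    have hadd : ∀ y z c d : ℝ, |y| ≤ c * decay n δ x → |z| ≤ d * decay n δ x →
        |y + z| ≤ (c + d) * decay n δ x := fun y z c d hy hz => by
      rw [add_mul]
      exact (abs_add_le y z).trans (add_le_add hy hz)
    have hA' : ∀ y z c : ℝ, |y| ≤ A → |z| ≤ c * decay n δ x → |y * z| ≤ A * c * decay n δ x :=
      fun y z c hy hz => by
        rw [abs_mul, mul_assoc]
        exact mul_le_mul hy hz (abs_nonneg _) hA0
    have h2 : ∀ z c : ℝ, |z| ≤ c * decay n δ x → |2 * z| ≤ 2 * c * decay n δ x := fun z c hz => by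
      rw [abs_mul, abs_two, mul_assoc]
      gcongr
    rw [Real.norm_eq_abs]
    exact hadd _ _ _ _ (hadd _ _ _ _ (hA' _ _ _ a2 (hadd _ _ _ _ (hU x) (hmul _ _ b0)))
      (h2 _ _ (hA' _ _ _ a1 (hadd _ _ _ _ b0 (hmul _ _ b1)))))
      (hA' _ _ _ a0 (hadd _ _ _ _ (h2 _ _ b1) (hmul _ _ b2)))

/-- The logarithmic Laplacian: the derivative of `(-Δ)^t u` at `t = 0⁺`. -/
def logLap {n : ℕ} (u : Rn n → ℝ) (x : Rn n) : ℝ := expansionDeriv u 0 x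

theorem exists_rate_fracLogLap {n : ℕ} (hn : 1 ≤ n) {u : Rn n → ℝ} (hu : IsCc2 u)
    {δ : ℝ} (hδ0 : 0 < δ) (hδ : δ ≤ 1) :
    ∃ C : ℝ, 0 ≤ C ∧ ∀ t ∈ Set.Ioc (0 : ℝ) (1 / 2), ∀ x,
      |fracLogLap t u x - logLap u x| ≤ t * (C * decay n δ x) ∧
      |(fracLap t u x - u x) / t - logLap u x| ≤ t * (C * decay n δ x) := by
  obtain ⟨C, hC0, hC⟩ := exists_bound_expansionDeriv_sub hn hu hδ0 hδ
  refine ⟨C, hC0, fun t ht x => ⟨?_, ?_⟩⟩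
  · rw [fracLogLap_eq_expansionDeriv hn ht.1 (by linarith [ht.2]) hu, mul_comm]
    exact hC t ⟨ht.1.le, ht.2⟩ x
  · have hw := (decay_pos δ x).le
    -- The expansion replaces `fracLap` on [0,t] because it equals u at τ = 0, while `fracLap 0 u`
    -- is 0, its constant having the factor s. Subtracting τ Log(-Δ)u leaves a derivative of size t,
    -- hence an increment of size t².
    have key := norm_image_sub_le_of_norm_deriv_le_segment'
      (f := fun τ => farConst n τ * (u x + τ * zeroPart u 0 τ x) - τ * logLap u x) (a := 0) (b := t)
      (f' := fun τ => expansionDeriv u τ x - logLap u x)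
      (C := C * decay n δ x * t) ?_ ?_ t ⟨ht.1.le, le_rfl⟩
    · rw [← fracLap_eq_expansion hn ht.1 (by linarith [ht.2]) hu, farConst_zero hn] at key
      simp only [zero_mul, add_zero, one_mul, sub_zero] at key
      have e : (fracLap t u x - u x) / t - logLap u x =
          (fracLap t u x - t * logLap u x - u x) / t := by
        have := ht.1.ne'
        field_simp
        ring
      rw [e, abs_div, abs_of_pos ht.1, div_le_iff₀ ht.1]
      refine key.trans_eq ?_
      ring
    · intro τ hτ
      have d := (hasDerivAt_expansion hn (t := τ) (by linarith [hτ.1])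
        (by linarith [hτ.2, ht.2]) hu x).sub ((hasDerivAt_id τ).mul_const (logLap u x))
      refine (d.congr_deriv ?_).hasDerivWithinAt
      simp
    · intro τ hτ
      refine (hC τ ⟨hτ.1, hτ.2.le.trans ht.2⟩ x).trans ?_
      have := hτ.2.le
      gcongr

theorem measurable_logLap {n : ℕ} {u : Rn n → ℝ} (hu : Continuous u) : Measurable (logLap u) := by
  have h0 := measurable_zeroPart hu 0 0
  have h1 := measurable_zeroPart hu 1 0
  have hu' := hu.measurable
  unfold logLap expansionDeriv
  fun_prop

theorem memLp_logLap {n : ℕ} (hn : 1 ≤ n) {u : Rn n → ℝ} (hu : IsCc2 u) {p : ℝ≥0∞} (hp : 1 < p) :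
    MemLp (logLap u) p := by
  obtain ⟨δ, hδ0, hδ, hW⟩ := memLp_decay hn hp
  obtain ⟨U, hU0, hU⟩ := exists_bound_decay hn hu hδ
  obtain ⟨B, hB0, hB⟩ := exists_bound_zeroPart hn hu 0 hδ0 hδ
  refine (hW.const_mul (|deriv (farConst n) 0| * U + B)).of_le
    (measurable_logLap hu.continuous).aestronglyMeasurable (Eventually.of_forall fun x => ?_)
  have hw := (decay_pos δ x).le
  have e : logLap u x = deriv (farConst n) 0 * u x + zeroPart u 0 0 x := by
    simp [logLap, expansionDeriv, farConst_zero hn]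
  have hnn : 0 ≤ (|deriv (farConst n) 0| * U + B) * decay n δ x :=
    mul_nonneg (by positivity) hw
  rw [e, Real.norm_of_nonneg hnn, add_mul, mul_assoc, Real.norm_eq_abs]
  have hz := hB 0 ⟨le_rfl, by norm_num⟩ x
  refine (abs_add_le _ _).trans (add_le_add ?_ hz)
  rw [abs_mul]
  exact mul_le_mul_of_nonneg_left (hU x) (abs_nonneg _)

theorem tendsto_eLpNorm_of_le_mul {n : ℕ} {p : ℝ≥0∞} {W : Rn n → ℝ} (hW : MemLp W p)
    {f : ℝ → Rn n → ℝ} (hf : ∀ t ∈ Set.Ioc (0 : ℝ) (1 / 2), ∀ x, |f t x| ≤ t * W x) :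
    Tendsto (fun t => eLpNorm (f t) p volume) (𝓝[>] (0 : ℝ)) (𝓝 0) := by
  have hlim : Tendsto (fun t : ℝ => ‖t‖ₑ * eLpNorm W p volume) (𝓝[>] (0 : ℝ)) (𝓝 0) := by
    have h1 : Tendsto (fun t : ℝ => ‖t‖ₑ) (𝓝[>] (0 : ℝ)) (𝓝 0) := by
      have : Tendsto (fun t : ℝ => ‖t‖ₑ) (𝓝 (0 : ℝ)) (𝓝 ‖(0 : ℝ)‖ₑ) :=
        continuous_enorm.tendsto 0
      rw [enorm_zero] at this
      exact this.mono_left nhdsWithin_le_nhds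
    simpa using ENNReal.Tendsto.mul_const h1 (Or.inr hW.eLpNorm_ne_top)
  refine tendsto_of_tendsto_of_tendsto_of_le_of_le' tendsto_const_nhds hlim
    (Eventually.of_forall fun _ => zero_le) ?_
  filter_upwards [Ioc_mem_nhdsGT (by norm_num : (0 : ℝ) < 1 / 2)] with t ht
  rw [← eLpNorm_const_smul]
  exact eLpNorm_mono_real fun x => hf t ht x

theorem isLogLap_logLap {n : ℕ} (hn : 1 ≤ n) {u : Rn n → ℝ} (hu : IsCc2 u) :
    IsLogLap u (logLap u) := by
  intro p hp
  refine ⟨memLp_logLap hn hu hp, ?_⟩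
  obtain ⟨δ, hδ0, hδ, hW⟩ := memLp_decay hn hp
  obtain ⟨C, hC0, hC⟩ := exists_rate_fracLogLap hn hu hδ0 hδ
  exact tendsto_eLpNorm_of_le_mul (hW.const_mul C) fun t ht x => (hC t ht x).2

theorem tendsto_fracLogLap_logLap {n : ℕ} (hn : 1 ≤ n) {u : Rn n → ℝ} (hu : IsCc2 u) :
    Tendsto (fun s : ℝ => eLpNorm (fun x => fracLogLap s u x - logLap u x) ∞ volume)
      (𝓝[>] (0 : ℝ)) (𝓝 0) := by
  obtain ⟨δ, hδ0, hδ, hW⟩ := memLp_decay hn (p := ∞) ENNReal.one_lt_top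
  obtain ⟨C, hC0, hC⟩ := exists_rate_fracLogLap hn hu hδ0 hδ
  exact tendsto_eLpNorm_of_le_mul (hW.const_mul C) fun t ht x => (hC t ht x).1

theorem aestronglyMeasurable_fracLap {n : ℕ} (hn : 1 ≤ n) {t : ℝ} (h0 : 0 < t) (h1 : t < 1)
    {u : Rn n → ℝ} (hu : IsCc2 u) : AEStronglyMeasurable (fracLap t u) := by
  have := ((integrable_integral_secondDiff_mul hu
    (measurable_powKernel n 0 t).aestronglyMeasurable
    (integrable_min_mul_powKernel hn 0 h0 h1)).const_mul (cConst n t)).aestronglyMeasurable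
  exact this.congr (Eventually.of_forall fun x => (fracLap_eq hn h0 h1 hu x).symm)

/-- The logarithmic Laplacian is determined almost everywhere. -/
theorem IsLogLap.ae_eq {n : ℕ} (hn : 1 ≤ n) {u v w : Rn n → ℝ} (hu : IsCc2 u)
    (hv : IsLogLap u v) (hw : IsLogLap u w) : v =ᵐ[volume] w := by
  obtain ⟨mv, tv⟩ := hv ∞ ENNReal.one_lt_top
  obtain ⟨mw, tw⟩ := hw ∞ ENNReal.one_lt_top
  -- At each t the difference v - w is a difference of two remainders of the same quotient, both
  -- tending to 0 in norm.
  have h0 : eLpNorm (v - w) ∞ volume ≤ 0 := by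
    have hlim := tw.add tv
    rw [add_zero] at hlim
    refine ge_of_tendsto hlim ?_
    filter_upwards [Ioo_mem_nhdsGT (zero_lt_one' ℝ)] with t ht
    have hm := (((aestronglyMeasurable_fracLap hn ht.1 ht.2 hu).sub
      hu.continuous.aestronglyMeasurable).mul_const t⁻¹)
    have hsub : v - w = (fun x => (fracLap t u x - u x) / t - w x) -
        fun x => (fracLap t u x - u x) / t - v x := by
      funext x
      simp
    rw [hsub]
    exact eLpNorm_sub_le (hm.sub mw.1) (hm.sub mv.1) le_top
  have := (eLpNorm_eq_zero_iff (mv.1.sub mw.1) ENNReal.top_ne_zero).1 (le_antisymm h0 (zero_le))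
  filter_upwards [this] with x hx
  simpa [sub_eq_zero] using hx

theorem tendsto_fracLogLap_of_isLogLap {n : ℕ} (hn : 1 ≤ n) {u v : Rn n → ℝ} (hu : IsCc2 u)
    (hv : IsLogLap u v) :
    Tendsto (fun s : ℝ => eLpNorm (fun x => fracLogLap s u x - v x) ∞ volume)
      (𝓝[>] (0 : ℝ)) (𝓝 0) := by
  refine (tendsto_fracLogLap_logLap hn hu).congr fun s => eLpNorm_congr_ae ?_
  filter_upwards [(isLogLap_logLap hn hu).ae_eq hn hu hv] with x hx
  rw [hx]

/-! ### Symbols with moderate singularity at the origin -/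

section Symbols

variable {E : Type*} [NormedAddCommGroup E]

/-- The weight `(1 + |x|)(1 + 1/|x|)`, large both at infinity and at the origin. -/
def singWeight (x : E) : ℝ := (1 + ‖x‖) * (1 + ‖x‖⁻¹)

theorem one_le_singWeight (x : E) : 1 ≤ singWeight x := by
  unfold singWeight
  have h1 : 0 ≤ ‖x‖ := norm_nonneg x
  have h2 : 0 ≤ ‖x‖⁻¹ := by positivity
  nlinarith [mul_nonneg h1 h2]

theorem singWeight_pos (x : E) : 0 < singWeight x := one_pos.trans_le (one_le_singWeight x)

theorem one_add_norm_le_singWeight (x : E) : 1 + ‖x‖ ≤ singWeight x := by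
  unfold singWeight
  exact le_mul_of_one_le_right (by positivity) (by have : 0 ≤ ‖x‖⁻¹ := by positivity
                                                   linarith)

theorem norm_inv_le_singWeight (x : E) : ‖x‖⁻¹ ≤ singWeight x := by
  unfold singWeight
  have h1 : 0 ≤ ‖x‖ := norm_nonneg x
  have h2 : 0 ≤ ‖x‖⁻¹ := by positivity
  nlinarith [mul_nonneg h1 h2]

theorem singWeight_norm_sq_le (x : E) : singWeight (‖x‖ ^ 2) ≤ singWeight x ^ 2 := by
  unfold singWeight
  have h1 : 0 ≤ ‖x‖ := norm_nonneg x
  have h2 : 0 ≤ ‖x‖⁻¹ := by positivity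
  rw [Real.norm_of_nonneg (by positivity), mul_pow, ← inv_pow]
  gcongr <;> nlinarith

variable [NormedSpace ℝ E] {F : Type*} [NormedAddCommGroup F] [NormedSpace ℝ F]

/-- Smooth off the origin, with all derivatives bounded by powers of `(1 + |x|)(1 + 1/|x|)` on
the set `S`. -/
def IsModerateOn (S : Set E) (a : E → F) : Prop :=
  ContDiffOn ℝ (⊤ : ℕ∞) a S ∧ ∀ k : ℕ, ∃ (C : ℝ) (M : ℕ), 0 ≤ C ∧
    ∀ x ∈ S, ‖iteratedFDerivWithin ℝ k a S x‖ ≤ C * singWeight x ^ M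

theorem IsModerateOn.uniform {S : Set E} {a : E → F} (ha : IsModerateOn S a) (k : ℕ) :
    ∃ (C : ℝ) (M : ℕ), 0 ≤ C ∧ ∀ i ≤ k, ∀ x ∈ S,
      ‖iteratedFDerivWithin ℝ i a S x‖ ≤ C * singWeight x ^ M := by
  choose C M hC h using ha.2
  refine ⟨∑ i ∈ Finset.range (k + 1), C i, ∑ i ∈ Finset.range (k + 1), M i,
    Finset.sum_nonneg fun i _ => hC i, fun i hi x hx => (h i x hx).trans ?_⟩
  have hi' : i ∈ Finset.range (k + 1) := Finset.mem_range.2 (by omega)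
  have hw := one_le_singWeight x
  gcongr
  · exact Finset.sum_nonneg fun i _ => hC i
  · exact Finset.single_le_sum (fun i _ => hC i) hi'
  · exact Finset.single_le_sum (fun i _ => (M i).zero_le) hi'

theorem uniqueDiffOn_compl_zero : UniqueDiffOn ℝ ({0}ᶜ : Set E) :=
  isOpen_compl_singleton.uniqueDiffOn

end Symbols

/-- Reduces radial symbols to one variable. Using |x|² instead of |x| makes the inner function
smooth with temperate derivatives, and the general bound for derivatives of a composition does the
rest. -/
theorem IsModerateOn.comp_norm_sq {E : Type*} [NormedAddCommGroup E] [InnerProductSpace ℝ E]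
    {γ : ℝ → ℝ} (hγ : IsModerateOn (Set.Ioi 0) γ) :
    IsModerateOn ({0}ᶜ : Set E) fun x => γ (‖x‖ ^ 2) := by
  have hmaps : Set.MapsTo (fun x : E => ‖x‖ ^ 2) ({0}ᶜ : Set E) (Set.Ioi 0) := fun x hx => by
    have : 0 < ‖x‖ := norm_pos_iff.2 hx
    exact (by positivity : 0 < ‖x‖ ^ 2)
  have hsq : ContDiffOn ℝ (⊤ : ℕ∞) (fun x : E => ‖x‖ ^ 2) ({0}ᶜ : Set E) :=
    (contDiff_norm_sq ℝ).contDiffOn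
  refine ⟨hγ.1.comp hsq hmaps, fun k => ?_⟩
  obtain ⟨C, M, hC, h⟩ := hγ.uniform k
  obtain ⟨N, D, hD, hq⟩ :=
    (Function.hasTemperateGrowth_norm_sq (H := E)).norm_iteratedFDeriv_le_uniform k
  refine ⟨k.factorial * C * (D + 1) ^ k, 2 * M + N * k, by positivity, fun x hx => ?_⟩
  have hw := one_le_singWeight x
  have key := norm_iteratedFDerivWithin_comp_le (n := k) (x := x)
    (C := C * (singWeight x ^ 2) ^ M) (D := (D + 1) * singWeight x ^ N) hγ.1 hsq
    (by exact_mod_cast le_top) (uniqueDiffOn_Ioi 0)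
    uniqueDiffOn_compl_zero hmaps hx ?_ ?_
  · refine key.trans_eq ?_
    rw [mul_pow, ← pow_mul, ← pow_mul, pow_add]
    ring
  · intro i hi
    refine (h i hi _ (hmaps hx)).trans ?_
    have := (singWeight_pos (‖x‖ ^ 2)).le
    gcongr
    exact singWeight_norm_sq_le x
  · intro i hi1 hi
    rw [iteratedFDerivWithin_of_isOpen i isOpen_compl_singleton hx]
    -- The base must be at least 1 so that it is below its i-th power, the form required of the
    -- inner derivatives; hence D + 1.
    have h1 : 1 ≤ (D + 1) * singWeight x ^ N :=
      one_le_mul_of_one_le_of_one_le (by linarith) (one_le_pow₀ hw)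
    calc ‖iteratedFDeriv ℝ i (fun x : E => ‖x‖ ^ 2) x‖ ≤ D * (1 + ‖x‖) ^ N := hq i hi x
      _ ≤ (D + 1) * singWeight x ^ N := by
        gcongr
        · linarith
        · exact one_add_norm_le_singWeight x
      _ ≤ ((D + 1) * singWeight x ^ N) ^ i := le_self_pow₀ h1 (by omega)

theorem isModerateOn_rpow {s : ℝ} (h0 : 0 < s) (h1 : s < 1) :
    IsModerateOn (Set.Ioi 0) fun r : ℝ => r ^ s := by
  have hcd : ∀ r ∈ Set.Ioi (0 : ℝ), ∀ n : ℕ∞, ContDiffAt ℝ n (fun r : ℝ => r ^ s) r := fun r hr n =>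
    Real.contDiffAt_rpow_const_of_ne (ne_of_gt hr)
  refine ⟨fun r hr => (hcd r hr _).contDiffWithinAt, fun k => ?_⟩
  refine ⟨|(descPochhammer ℝ k).eval s|, 1 + k, by positivity, fun r hr => ?_⟩
  have hr0 : (0 : ℝ) < r := hr
  rw [iteratedFDerivWithin_of_isOpen k isOpen_Ioi hr, norm_iteratedFDeriv_eq_norm_iteratedDeriv,
    iteratedDeriv_eq_iterate, Real.iter_deriv_rpow_const, norm_mul, Real.rpow_sub_natCast hr0.ne',
    pow_add, pow_one]
  rw [Real.norm_eq_abs, Real.norm_of_nonneg (by positivity), div_eq_mul_inv, ← inv_pow]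
  have hn : ‖r‖ = r := Real.norm_of_nonneg hr0.le
  have e1 : r ^ s ≤ singWeight r := by
    refine le_trans ?_ (one_add_norm_le_singWeight r)
    rw [hn]
    have := rpow_le_rpow_add_rpow hr0 h0.le h1.le
    rwa [Real.rpow_zero, Real.rpow_one] at this
  have e2 : r⁻¹ ≤ singWeight r := by
    have := norm_inv_le_singWeight r
    rwa [hn] at this
  have := (singWeight_pos r).le
  gcongr

theorem isModerateOn_log : IsModerateOn (Set.Ioi 0) Real.log := by
  refine ⟨fun r hr => (Real.contDiffAt_log.2 (ne_of_gt hr)).contDiffWithinAt, fun k => ?_⟩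
  rcases k with _ | k
  · refine ⟨1, 1, zero_le_one, fun r hr => ?_⟩
    have hr0 : (0 : ℝ) < r := hr
    have hn : ‖r‖ = r := Real.norm_of_nonneg hr0.le
    rw [norm_iteratedFDerivWithin_zero, Real.norm_eq_abs, one_mul, pow_one, abs_le]
    have e1 := Real.log_le_sub_one_of_pos hr0
    have e2 := Real.one_sub_inv_le_log_of_pos hr0
    have e3 := one_add_norm_le_singWeight r
    have e4 := norm_inv_le_singWeight r
    rw [hn] at e3 e4
    constructor <;> linarith
  · refine ⟨k.factorial, 1 + k, by positivity, fun r hr => ?_⟩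
    have hr0 : (0 : ℝ) < r := hr
    have hn : ‖r‖ = r := Real.norm_of_nonneg hr0.le
    have e4 := norm_inv_le_singWeight r
    rw [hn] at e4
    rw [iteratedFDerivWithin_of_isOpen _ isOpen_Ioi hr, norm_iteratedFDeriv_eq_norm_iteratedDeriv,
      iteratedDeriv_succ', Real.deriv_log', iteratedDeriv_eq_iterate]
    have := iter_deriv_inv k r
    rw [show (Inv.inv : ℝ → ℝ) = fun x => x⁻¹ from rfl, this, norm_mul, norm_mul, norm_pow, norm_neg,
      norm_one, one_pow, one_mul, show ((-1 : ℤ) - k) = -((1 + k : ℕ) : ℤ) by push_cast; ring,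
      zpow_neg, zpow_natCast, ← inv_pow, norm_pow, norm_inv, hn, Real.norm_natCast]
    gcongr

theorem isModerateOn_symFrac {n : ℕ} {s : ℝ} (h0 : 0 < s) (h1 : s < 1) :
    IsModerateOn ({0}ᶜ : Set (Rn n)) (symFrac s) := by
  have : (symFrac s : Rn n → ℝ) = fun x => (‖x‖ ^ 2) ^ s := by
    funext x
    rw [symFrac, Real.rpow_mul (norm_nonneg x), Real.rpow_two]
  rw [this]
  exact (isModerateOn_rpow h0 h1).comp_norm_sq

theorem isModerateOn_symLog {n : ℕ} : IsModerateOn ({0}ᶜ : Set (Rn n)) symLog := by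
  have : (symLog : Rn n → ℝ) = fun x => Real.log (‖x‖ ^ 2) := by
    funext x
    rw [symLog, Real.log_pow, Nat.cast_ofNat]
  rw [this]
  exact isModerateOn_log.comp_norm_sq

/-! ### Flat Schwartz functions -/

section Flat

variable {E : Type*} [NormedAddCommGroup E] [NormedSpace ℝ E]
  {F : Type*} [NormedAddCommGroup F] [NormedSpace ℝ F]

/-- A function smooth off the origin whose derivatives are of second order at the origin is smooth,
and all its derivatives vanish at the origin. -/
theorem contDiff_of_flat {f : E → F} (hf0 : f 0 = 0)
    (hf : ∀ x, x ≠ 0 → ContDiffAt ℝ (⊤ : ℕ∞) f x)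
    (hb : ∀ k : ℕ, ∃ C : ℝ, ∀ x, x ≠ 0 → ‖iteratedFDeriv ℝ k f x‖ ≤ C * ‖x‖ ^ 2) :
    ContDiff ℝ (⊤ : ℕ∞) f ∧ ∀ k : ℕ, iteratedFDeriv ℝ k f 0 = 0 := by
  -- A quadratic bound is o(|x|), so a derivative vanishing at 0 is differentiable there with
  -- derivative 0; this is exactly the vanishing of the next one.
  have hd : ∀ k : ℕ, iteratedFDeriv ℝ k f 0 = 0 →
      HasFDerivAt (iteratedFDeriv ℝ k f) (0 : E →L[ℝ] E [×k]→L[ℝ] F) 0 := by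
    intro k hk
    obtain ⟨C, hC⟩ := hb k
    rw [hasFDerivAt_iff_isLittleO_nhds_zero]
    simp only [zero_add, hk, sub_zero, zero_apply]
    have h1 : (fun h : E => iteratedFDeriv ℝ k f h) =O[𝓝 0] fun h => ‖h‖ ^ 2 := by
      refine Asymptotics.IsBigO.of_bound C (Eventually.of_forall fun x => ?_)
      rw [norm_pow, norm_norm]
      rcases eq_or_ne x 0 with rfl | hx
      · simp [hk]
      · exact hC x hx
    refine h1.trans_isLittleO ?_
    exact Asymptotics.isLittleO_norm_pow_id one_lt_two
  have h0 : ∀ k : ℕ, iteratedFDeriv ℝ k f 0 = 0 := by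
    intro k
    induction k with
    | zero => rw [← norm_eq_zero, norm_iteratedFDeriv_zero, hf0, norm_zero]
    | succ k ih =>
      ext v
      rw [iteratedFDeriv_succ_apply_left, (hd k ih).fderiv]
      rfl
  refine ⟨contDiff_of_differentiable_iteratedFDeriv fun k _ x => ?_, h0⟩
  rcases eq_or_ne x 0 with rfl | hx
  · exact (hd k (h0 k)).differentiableAt
  · exact (hf x hx).differentiableAt_iteratedFDeriv (by exact_mod_cast WithTop.coe_lt_top k)

/-- The Schwartz functions all of whose derivatives vanish at the origin. -/
def flatSchwartz (E : Type*) [NormedAddCommGroup E] [NormedSpace ℝ E] : Submodule ℂ 𝓢(E, ℂ) where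
  carrier := {g | ∀ k : ℕ, iteratedFDeriv ℝ k g 0 = 0}
  zero_mem' := by
    intro k
    have h : (⇑(0 : 𝓢(E, ℂ))) = fun _ => 0 := rfl
    rw [h]
    simp
  add_mem' := by
    intro f g hf hg k
    have h : (⇑(f + g)) = ⇑f + ⇑g := rfl
    rw [h, iteratedFDeriv_add_apply (f.smooth k).contDiffAt (g.smooth k).contDiffAt, hf k, hg k,
      add_zero]
  smul_mem' := by
    intro c f hf k
    have h : (⇑(c • f)) = c • ⇑f := rfl
    rw [h, iteratedFDeriv_const_smul_apply (f.smooth k).contDiffAt, hf k, smul_zero]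

/-- The seminorms of the Schwartz space, increasing in `m`. -/
def supSeminorm (E : Type*) [NormedAddCommGroup E] [NormedSpace ℝ E] (m : ℕ × ℕ) :
    Seminorm ℂ 𝓢(E, ℂ) :=
  (Finset.Iic m).sup fun m => SchwartzMap.seminorm ℂ m.1 m.2

theorem supSeminorm_mono {m m' : ℕ × ℕ} (h : m ≤ m') : supSeminorm E m ≤ supSeminorm E m' :=
  Finset.sup_mono (Finset.Iic_subset_Iic.2 h)

/-- Each application of the mean value inequality from the origin trades one more derivative for one
power of |x|. -/
theorem norm_iteratedFDeriv_le_of_flat {g : 𝓢(E, ℂ)} (hg : g ∈ flatSchwartz E) (m : ℕ) :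
    ∀ (k : ℕ) (x : E), ‖iteratedFDeriv ℝ k g x‖ ≤ ‖x‖ ^ m * supSeminorm E (0, k + m) g := by
  induction m with
  | zero =>
    intro k x
    have := SchwartzMap.one_add_le_sup_seminorm_apply (𝕜 := ℂ) (m := (0, k)) le_rfl le_rfl g x
    simpa [supSeminorm] using this
  | succ m ih =>
    intro k x
    have hdiff : Differentiable ℝ (iteratedFDeriv ℝ k g) :=
      (g.smooth (k + 1 : ℕ)).differentiable_iteratedFDeriv (by exact_mod_cast Nat.lt_succ_self k)
    have hs := apply_nonneg (supSeminorm E (0, k + (m + 1))) g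
    have key := (convex_closedBall (0 : E) ‖x‖).norm_image_sub_le_of_norm_fderiv_le (𝕜 := ℝ)
      (f := iteratedFDeriv ℝ k g) (C := ‖x‖ ^ m * supSeminorm E (0, k + (m + 1)) g)
      (x := 0) (y := x) (fun y _ => hdiff y) ?_ (by simp) (by simp)
    · rw [hg k, sub_zero, sub_zero] at key
      refine key.trans_eq ?_
      ring
    · intro y hy
      rw [mem_closedBall_zero_iff] at hy
      rw [norm_fderiv_iteratedFDeriv]
      refine (ih (k + 1) y).trans ?_
      rw [show k + 1 + m = k + (m + 1) by ring]
      gcongr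

/-- Flatness pays for the powers of 1/|x| when |x| ≤ 1, Schwartz decay for the powers of |x| when
|x| ≥ 1. -/
theorem singWeight_pow_mul_norm_iteratedFDeriv_le {g : 𝓢(E, ℂ)} (hg : g ∈ flatSchwartz E)
    (k J : ℕ) (x : E) (hx : x ≠ 0) :
    singWeight x ^ J * ‖iteratedFDeriv ℝ k g x‖ ≤ 4 ^ J * supSeminorm E (J, k + J) g := by
  have hx0 : 0 < ‖x‖ := norm_pos_iff.2 hx
  have hw := (singWeight_pos x).le
  rcases le_total ‖x‖ 1 with h | h
  · have e1 : singWeight x ≤ 4 * ‖x‖⁻¹ := by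
      have : 1 ≤ ‖x‖⁻¹ := (one_le_inv₀ hx0).2 h
      unfold singWeight
      nlinarith
    calc singWeight x ^ J * ‖iteratedFDeriv ℝ k g x‖
        ≤ (4 * ‖x‖⁻¹) ^ J * (‖x‖ ^ J * supSeminorm E (0, k + J) g) := by
          gcongr
          exact norm_iteratedFDeriv_le_of_flat hg J k x
      _ = 4 ^ J * supSeminorm E (0, k + J) g := by
          rw [mul_pow, inv_pow]
          field_simp
      _ ≤ _ := by
          have h' : ((0, k + J) : ℕ × ℕ) ≤ (J, k + J) := Prod.mk_le_mk.2 ⟨J.zero_le, le_rfl⟩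
          exact mul_le_mul_of_nonneg_left (supSeminorm_mono h' g) (by positivity)
  · have e1 : singWeight x ≤ 2 * (1 + ‖x‖) := by
      have : ‖x‖⁻¹ ≤ 1 := inv_le_one_of_one_le₀ h
      unfold singWeight
      nlinarith
    calc singWeight x ^ J * ‖iteratedFDeriv ℝ k g x‖
        ≤ (2 * (1 + ‖x‖)) ^ J * ‖iteratedFDeriv ℝ k g x‖ := by gcongr
      _ = 2 ^ J * ((1 + ‖x‖) ^ J * ‖iteratedFDeriv ℝ k g x‖) := by rw [mul_pow]; ring
      _ ≤ 2 ^ J * (2 ^ J * supSeminorm E (J, k + J) g) := by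
          refine mul_le_mul_of_nonneg_left ?_ (by positivity)
          exact SchwartzMap.one_add_le_sup_seminorm_apply (𝕜 := ℂ) (m := (J, k + J)) le_rfl
            (Nat.le_add_right k J) g x
      _ = _ := by
          rw [← mul_assoc, ← mul_pow]
          norm_num

theorem contDiffOn_smul_flat {a : E → ℝ} (ha : IsModerateOn ({0}ᶜ : Set E) a) (g : 𝓢(E, ℂ)) :
    ContDiffOn ℝ (⊤ : ℕ∞) (fun x => a x • g x) ({0}ᶜ : Set E) :=
  ha.1.smul (g.smooth ⊤).contDiffOn

/-- Leibniz: derivatives of the symbol cost M powers of the weight, and the flat factor absorbs J +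
M of them. The constants do not depend on g, which later gives continuity of the multiplication. -/
theorem exists_bound_smul_flat {a : E → ℝ} (ha : IsModerateOn ({0}ᶜ : Set E) a) (k J : ℕ) :
    ∃ (C : ℝ) (m : ℕ × ℕ), 0 ≤ C ∧ ∀ g ∈ flatSchwartz E, ∀ x, x ≠ 0 →
      singWeight x ^ J * ‖iteratedFDeriv ℝ k (fun x => a x • g x) x‖ ≤ C * supSeminorm E m g := by
  obtain ⟨C, M, hC, h⟩ := ha.uniform k
  refine ⟨∑ i ∈ Finset.range (k + 1), (k.choose i : ℝ) * C * 4 ^ (J + M),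
    (J + M, k + (J + M)), Finset.sum_nonneg fun i _ => by positivity, fun g hg x hx => ?_⟩
  have hw := (singWeight_pos x).le
  have hx' : x ∈ ({0}ᶜ : Set E) := hx
  have key := norm_iteratedFDerivWithin_smul_le ha.1 ((g.smooth ⊤).contDiffOn (s := {0}ᶜ))
    uniqueDiffOn_compl_zero hx' (n := k) (by exact_mod_cast le_top)
  rw [iteratedFDerivWithin_of_isOpen k isOpen_compl_singleton hx'] at key
  refine (mul_le_mul_of_nonneg_left key (by positivity)).trans ?_
  rw [Finset.mul_sum, Finset.sum_mul]
  refine Finset.sum_le_sum fun i hi => ?_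
  have hi' : i ≤ k := Nat.lt_succ_iff.1 (Finset.mem_range.1 hi)
  rw [iteratedFDerivWithin_of_isOpen (k - i) isOpen_compl_singleton hx']
  have e1 := h i hi' x hx'
  have e2 := singWeight_pow_mul_norm_iteratedFDeriv_le hg (k - i) (J + M) x hx
  have e3 : supSeminorm E (J + M, k - i + (J + M)) g ≤ supSeminorm E (J + M, k + (J + M)) g :=
    supSeminorm_mono (Prod.mk_le_mk.2 ⟨le_rfl, by omega⟩) g
  calc singWeight x ^ J * ((k.choose i : ℝ) * ‖iteratedFDerivWithin ℝ i a {0}ᶜ x‖ *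
        ‖iteratedFDeriv ℝ (k - i) g x‖)
      ≤ singWeight x ^ J * ((k.choose i : ℝ) * (C * singWeight x ^ M) *
        ‖iteratedFDeriv ℝ (k - i) g x‖) := by gcongr
    _ = (k.choose i : ℝ) * C * (singWeight x ^ (J + M) * ‖iteratedFDeriv ℝ (k - i) g x‖) := by
        rw [pow_add]
        ring
    _ ≤ (k.choose i : ℝ) * C * (4 ^ (J + M) * supSeminorm E (J + M, k + (J + M)) g) := by
        refine mul_le_mul_of_nonneg_left (e2.trans ?_) (by positivity)
        exact mul_le_mul_of_nonneg_left e3 (by positivity)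
    _ = _ := by ring

theorem smul_flat_smooth {a : E → ℝ} (ha : IsModerateOn ({0}ᶜ : Set E) a) {g : 𝓢(E, ℂ)}
    (hg : g ∈ flatSchwartz E) :
    ContDiff ℝ (⊤ : ℕ∞) (fun x => a x • g x) ∧
      ∀ k : ℕ, iteratedFDeriv ℝ k (fun x => a x • g x) 0 = 0 := by
  have hg0 : g 0 = 0 := by
    have := hg 0
    rw [← norm_eq_zero, norm_iteratedFDeriv_zero, norm_eq_zero] at this
    exact this
  refine contDiff_of_flat (by simp [hg0]) (fun x hx => (contDiffOn_smul_flat ha g).contDiffAt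
    (isOpen_compl_singleton.mem_nhds hx)) fun k => ?_
  -- Two powers of the weight suffice, since |x| times the weight is at least 1: they yield the
  -- quadratic bound that makes the product flat.
  obtain ⟨C, m, hC, h⟩ := exists_bound_smul_flat ha k 2
  refine ⟨C * supSeminorm E m g, fun x hx => ?_⟩
  have hx0 : 0 < ‖x‖ := norm_pos_iff.2 hx
  have h1 := h g hg x hx
  have h2 : 1 ≤ ‖x‖ ^ 2 * singWeight x ^ 2 := by
    rw [← mul_pow]
    refine one_le_pow₀ ?_
    calc 1 = ‖x‖ * ‖x‖⁻¹ := by field_simp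
      _ ≤ ‖x‖ * singWeight x := by gcongr; exact norm_inv_le_singWeight x
  calc ‖iteratedFDeriv ℝ k (fun x => a x • g x) x‖
      ≤ (‖x‖ ^ 2 * singWeight x ^ 2) * ‖iteratedFDeriv ℝ k (fun x => a x • g x) x‖ :=
        le_mul_of_one_le_left (norm_nonneg _) h2
    _ = ‖x‖ ^ 2 * (singWeight x ^ 2 * ‖iteratedFDeriv ℝ k (fun x => a x • g x) x‖) := by ring
    _ ≤ ‖x‖ ^ 2 * (C * supSeminorm E m g) := by gcongr
    _ = _ := by ring

theorem exists_decay_smul_flat {a : E → ℝ} (ha : IsModerateOn ({0}ᶜ : Set E) a) (J k : ℕ) :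
    ∃ (C : ℝ) (m : ℕ × ℕ), 0 ≤ C ∧ ∀ g ∈ flatSchwartz E, ∀ x,
      ‖x‖ ^ J * ‖iteratedFDeriv ℝ k (fun x => a x • g x) x‖ ≤ C * supSeminorm E m g := by
  obtain ⟨C, m, hC, h⟩ := exists_bound_smul_flat ha k J
  refine ⟨C, m, hC, fun g hg x => ?_⟩
  rcases eq_or_ne x 0 with rfl | hx
  · simp only [(smul_flat_smooth ha hg).2 k, norm_zero, mul_zero]
    exact mul_nonneg hC (apply_nonneg _ _)
  · refine le_trans ?_ (h g hg x hx)
    gcongr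
    linarith [one_add_norm_le_singWeight x]

/-- The product of a moderate symbol with a flat Schwartz function. -/
def smulFlat {a : E → ℝ} (ha : IsModerateOn ({0}ᶜ : Set E) a) (g : flatSchwartz E) :
    flatSchwartz E :=
  ⟨{ toFun := fun x => a x • (g : 𝓢(E, ℂ)) x
     smooth' := (smul_flat_smooth ha g.2).1
     decay' := fun J k => by
      obtain ⟨C, m, -, h⟩ := exists_decay_smul_flat ha J k
      exact ⟨_, h g g.2⟩ }, (smul_flat_smooth ha g.2).2⟩

theorem smulFlat_apply {a : E → ℝ} (ha : IsModerateOn ({0}ᶜ : Set E) a) (g : flatSchwartz E)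
    (x : E) : (smulFlat ha g : 𝓢(E, ℂ)) x = a x • (g : 𝓢(E, ℂ)) x := rfl

/-- Multiplication by a moderate symbol as a linear map into the Schwartz space. -/
def smulFlatLM {a : E → ℝ} (ha : IsModerateOn ({0}ᶜ : Set E) a) :
    flatSchwartz E →ₗ[ℂ] 𝓢(E, ℂ) where
  toFun g := smulFlat ha g
  map_add' f g := by
    ext x
    simp only [add_apply, smulFlat_apply, Submodule.coe_add, smul_add]
  map_smul' c g := by
    ext x
    simp only [smul_apply, smulFlat_apply, Submodule.coe_smul, RingHom.id_apply]
    exact smul_comm _ _ _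

theorem continuous_smulFlatLM {a : E → ℝ} (ha : IsModerateOn ({0}ᶜ : Set E) a) :
    Continuous (smulFlatLM ha) := by
  refine (schwartz_withSeminorms ℂ E ℂ).continuous_of_continuous_comp _ fun i => ?_
  obtain ⟨C, m, hC, h⟩ := exists_decay_smul_flat ha i.1 i.2
  have hcont : Continuous (supSeminorm E m) :=
    Seminorm.continuous_finsetSup fun i _ => (schwartz_withSeminorms ℂ E ℂ).continuous_seminorm i
  have hcont' : Continuous ((C.toNNReal • supSeminorm E m).comp (flatSchwartz E).subtype) :=
    (hcont.const_smul C.toNNReal).comp continuous_subtype_val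
  refine Seminorm.continuous_of_le hcont' fun g => ?_
  have hval : ((C.toNNReal • supSeminorm E m).comp (flatSchwartz E).subtype) g =
      C * supSeminorm E m g := by
    simp [Seminorm.comp_apply, NNReal.smul_def, Real.coe_toNNReal C hC]
  rw [hval]
  exact SchwartzMap.seminorm_le_bound ℂ i.1 i.2 _
    (mul_nonneg hC (apply_nonneg _ _)) (h g g.2)

/-- Multiplication by a moderate symbol on flat Schwartz functions. -/
def smulFlatCLM {a : E → ℝ} (ha : IsModerateOn ({0}ᶜ : Set E) a) :
    flatSchwartz E →L[ℂ] flatSchwartz E :=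
  (⟨smulFlatLM ha, continuous_smulFlatLM ha⟩ : flatSchwartz E →L[ℂ] 𝓢(E, ℂ)).codRestrict
    (flatSchwartz E) fun g => (smulFlat ha g).2

theorem smulFlatCLM_apply {a : E → ℝ} (ha : IsModerateOn ({0}ᶜ : Set E) a) (g : flatSchwartz E)
    (x : E) : (smulFlatCLM ha g : 𝓢(E, ℂ)) x = a x • (g : 𝓢(E, ℂ)) x := rfl

end Flat

/-! ### Fourier multipliers on the Lizorkin space -/

theorem invFourierT_eq {n : ℕ} (g : Rn n → ℂ) (x : Rn n) :
    invFourierT g x = (((2 * Real.pi) ^ (-(n : ℝ) / 2) : ℝ) : ℂ) *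
      FourierTransformInv.fourierInv g ((2 * Real.pi)⁻¹ • x) := by
  unfold invFourierT
  rw [Real.fourierInv_eq']
  congr 1
  refine integral_congr_ae (Filter.Eventually.of_forall fun ξ => ?_)
  have hpi : (Real.pi : ℂ) ≠ 0 := by exact_mod_cast Real.pi_ne_zero
  simp only [smul_eq_mul, inner_smul_right, real_inner_comm x ξ]
  congr 2
  push_cast
  field_simp

/-- The dilation by `(2π)⁻¹`. -/
def dilation (n : ℕ) : Rn n ≃L[ℝ] Rn n :=
  ContinuousLinearEquiv.smulLeft (Units.mk0 (2 * Real.pi)⁻¹ (by positivity))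

/-- The Fourier transform `fourierT` on the Schwartz space. -/
def fourierTCLM (n : ℕ) : 𝓢(Rn n, ℂ) →L[ℂ] 𝓢(Rn n, ℂ) :=
  ((((2 * Real.pi) ^ (-(n : ℝ) / 2) : ℝ) : ℂ)) •
    (SchwartzMap.compCLMOfContinuousLinearEquiv ℂ (dilation n)).comp
      (FourierTransform.fourierCLM ℂ 𝓢(Rn n, ℂ))

/-- The inverse Fourier transform `invFourierT` on the Schwartz space. -/
def invFourierTCLM (n : ℕ) : 𝓢(Rn n, ℂ) →L[ℂ] 𝓢(Rn n, ℂ) :=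
  ((((2 * Real.pi) ^ (-(n : ℝ) / 2) : ℝ) : ℂ)) •
    (SchwartzMap.compCLMOfContinuousLinearEquiv ℂ (dilation n)).comp
      (FourierTransform.fourierInvCLM ℂ 𝓢(Rn n, ℂ))

theorem coe_fourierTCLM {n : ℕ} (φ : 𝓢(Rn n, ℂ)) : ⇑(fourierTCLM n φ) = fourierT φ := by
  funext ξ
  rw [fourierT_eq, ← SchwartzMap.fourier_coe]
  rfl

theorem coe_invFourierTCLM {n : ℕ} (φ : 𝓢(Rn n, ℂ)) : ⇑(invFourierTCLM n φ) = invFourierT φ := by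
  funext ξ
  rw [invFourierT_eq, ← SchwartzMap.fourierInv_coe]
  rfl

theorem two_pi_rpow_mul_self {n : ℕ} :
    (2 * Real.pi) ^ (-(n : ℝ) / 2) * (2 * Real.pi) ^ (-(n : ℝ) / 2) * (2 * Real.pi) ^ n = 1 := by
  have h : (0 : ℝ) < 2 * Real.pi := by positivity
  rw [← Real.rpow_natCast, ← Real.rpow_add h, ← Real.rpow_add h]
  ring_nf
  exact Real.rpow_zero _

theorem integral_comp_dilation {n : ℕ} (f : Rn n → ℂ) :
    ∫ x, f ((2 * Real.pi)⁻¹ • x) = (((2 * Real.pi) ^ n : ℝ) : ℂ) * ∫ x, f x := by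
  rw [Measure.integral_comp_inv_smul_of_nonneg _ _ (by positivity), finrank_euclideanSpace,
    Fintype.card_fin, Complex.real_smul]

/-- Mathlib's inversion after a dilation: the two prefactors (2π)^{-n/2} cancel the Jacobian (2π)^n.
-/
theorem fourierTCLM_invFourierTCLM {n : ℕ} (φ : 𝓢(Rn n, ℂ)) :
    fourierTCLM n (invFourierTCLM n φ) = φ := by
  ext x
  have h1 : (FourierTransform.fourier (FourierTransformInv.fourierInv φ : 𝓢(Rn n, ℂ)) :
      𝓢(Rn n, ℂ)) x = φ x := by rw [FourierTransform.fourier_fourierInv_eq]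
  rw [SchwartzMap.fourier_coe, Real.fourier_eq'] at h1
  rw [coe_fourierTCLM, coe_invFourierTCLM, fourierT]
  let g : Rn n → ℂ := fun η => Complex.exp ((-2 * Real.pi * inner ℝ η x : ℝ) * Complex.I) •
    (FourierTransformInv.fourierInv φ : 𝓢(Rn n, ℂ)) η
  change ∫ η, g η = φ x at h1
  have h2 : ∀ ξ : Rn n, Complex.exp (-Complex.I * (inner ℝ x ξ : ℝ)) * invFourierT φ ξ =
      (((2 * Real.pi) ^ (-(n : ℝ) / 2) : ℝ) : ℂ) *
      g ((2 * Real.pi)⁻¹ • ξ) := by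
    intro ξ
    have hpi : (Real.pi : ℂ) ≠ 0 := by exact_mod_cast Real.pi_ne_zero
    simp only [g, smul_eq_mul]
    rw [invFourierT_eq, ← SchwartzMap.fourierInv_coe, inner_smul_left, real_inner_comm x ξ,
      mul_left_comm]
    congr 3
    push_cast
    simp
    field_simp
  simp only [h2]
  rw [integral_const_mul, integral_comp_dilation, h1, ← mul_assoc, ← mul_assoc, ← Complex.ofReal_mul,
    ← Complex.ofReal_mul, two_pi_rpow_mul_self, Complex.ofReal_one, one_mul]

theorem mem_lizorkin_iff {n : ℕ} {φ : 𝓢(Rn n, ℂ)} :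
    φ ∈ lizorkin n ↔ fourierTCLM n φ ∈ flatSchwartz (Rn n) := by
  change (∀ k : ℕ, iteratedFDeriv ℝ k (fourierT φ) 0 = 0) ↔
    ∀ k : ℕ, iteratedFDeriv ℝ k (fourierTCLM n φ) 0 = 0
  rw [coe_fourierTCLM]

/-- The Fourier transform from the Lizorkin space to the flat Schwartz functions. -/
def lizorkinToFlat (n : ℕ) : lizorkin n →L[ℂ] flatSchwartz (Rn n) :=
  ((fourierTCLM n).comp (lizorkin n).subtypeL).codRestrict _ fun φ => mem_lizorkin_iff.1 φ.2

/-- The inverse Fourier transform from the flat Schwartz functions to the Lizorkin space. -/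
def flatToLizorkin (n : ℕ) : flatSchwartz (Rn n) →L[ℂ] lizorkin n :=
  ((invFourierTCLM n).comp (flatSchwartz (Rn n)).subtypeL).codRestrict _ fun g => by
    rw [mem_lizorkin_iff]
    change fourierTCLM n (invFourierTCLM n g) ∈ flatSchwartz (Rn n)
    rw [fourierTCLM_invFourierTCLM]
    exact g.2

theorem exists_isMultiplier {n : ℕ} {a : Rn n → ℝ} (ha : IsModerateOn ({0}ᶜ : Set (Rn n)) a) :
    ∃ T : lizorkin n →L[ℂ] lizorkin n, IsMultiplier a T := by
  refine ⟨(flatToLizorkin n).comp ((smulFlatCLM ha).comp (lizorkinToFlat n)), fun φ x => ?_⟩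
  change (invFourierTCLM n (smulFlatCLM ha (lizorkinToFlat n φ) : 𝓢(Rn n, ℂ))) x = _
  rw [coe_invFourierTCLM]
  congr 1
  funext ξ
  rw [smulFlatCLM_apply, Complex.real_smul]
  change (a ξ : ℂ) * (fourierTCLM n φ) ξ = _
  rw [coe_fourierTCLM]

theorem isMultiplier_multiplier {n : ℕ} {a : Rn n → ℝ}
    (h : ∃ T : lizorkin n →L[ℂ] lizorkin n, IsMultiplier a T) :
    IsMultiplier a (multiplier a) := by
  rw [multiplier, dif_pos h]
  exact h.choose_spec

theorem IsMultiplier.unique {n : ℕ} {a : Rn n → ℝ} {S T : lizorkin n →L[ℂ] lizorkin n}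
    (hS : IsMultiplier a S) (hT : IsMultiplier a T) : S = T := by
  ext φ x
  rw [hS φ x, hT φ x]

/-- Moderateness makes a φ̂ a Schwartz function, to which Fourier inversion can be applied; this is
what lets symbols multiply under composition. -/
theorem IsMultiplier.fourierT_apply {n : ℕ} {a : Rn n → ℝ} (ha : IsModerateOn ({0}ᶜ : Set (Rn n)) a)
    {T : lizorkin n →L[ℂ] lizorkin n} (hT : IsMultiplier a T) (φ : lizorkin n) :
    fourierT (T φ : 𝓢(Rn n, ℂ)) = fun ξ => (a ξ : ℂ) * fourierT (φ : 𝓢(Rn n, ℂ)) ξ := by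
  have h : (T φ : 𝓢(Rn n, ℂ)) =
      invFourierTCLM n (smulFlatCLM ha (lizorkinToFlat n φ) : 𝓢(Rn n, ℂ)) := by
    ext x
    rw [hT φ x, coe_invFourierTCLM]
    congr 1
    funext ξ
    rw [smulFlatCLM_apply, Complex.real_smul]
    change _ = (a ξ : ℂ) * (fourierTCLM n φ) ξ
    rw [coe_fourierTCLM]
  rw [h, ← coe_fourierTCLM, fourierTCLM_invFourierTCLM]
  funext ξ
  rw [smulFlatCLM_apply, Complex.real_smul]
  change (a ξ : ℂ) * (fourierTCLM n φ) ξ = _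
  rw [coe_fourierTCLM]

theorem IsMultiplier.comp {n : ℕ} {a b : Rn n → ℝ} (hb : IsModerateOn ({0}ᶜ : Set (Rn n)) b)
    {S T : lizorkin n →L[ℂ] lizorkin n} (hS : IsMultiplier a S) (hT : IsMultiplier b T) :
    IsMultiplier (fun ξ => a ξ * b ξ) (S.comp T) := by
  intro φ x
  rw [ContinuousLinearMap.comp_apply, hS (T φ) x, hT.fourierT_apply hb]
  congr 1
  funext ξ
  push_cast
  ring

theorem multiplier_symFracLog {n : ℕ} {s : ℝ} (h0 : 0 < s) (h1 : s < 1) :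
    IsMultiplier (symFrac s) (multiplier (n := n) (symFrac s)) ∧
    IsMultiplier symLog (multiplier (n := n) symLog) ∧
    IsMultiplier (symFracLog s) (multiplier (n := n) (symFracLog s)) ∧
    multiplier (n := n) (symFracLog s) =
      (multiplier (symFrac s)).comp (multiplier symLog) ∧
    multiplier (n := n) (symFracLog s) =
      (multiplier symLog).comp (multiplier (symFrac s)) := by
  have hF := isMultiplier_multiplier (exists_isMultiplier (isModerateOn_symFrac (n := n) h0 h1))
  have hL := isMultiplier_multiplier (exists_isMultiplier (isModerateOn_symLog (n := n)))
  have h2 : IsMultiplier (symFracLog s)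
      ((multiplier (n := n) (symFrac s)).comp (multiplier symLog)) :=
    hF.comp isModerateOn_symLog hL
  have h3 : IsMultiplier (symFracLog s)
      ((multiplier (n := n) symLog).comp (multiplier (symFrac s))) := by
    have := hL.comp (isModerateOn_symFrac h0 h1) hF
    have e : (symFracLog s : Rn n → ℝ) = fun ξ => symLog ξ * symFrac s ξ := by
      funext ξ
      rw [symFracLog, symLog, symFrac, mul_comm]
    rwa [← e] at this
  -- The composition itself witnesses that the product symbol acts on Z, so no separate estimate for
  -- |ξ|^{2s} 2 ln |ξ| is needed; uniqueness identifies both compositions with it.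
  have hM := isMultiplier_multiplier ⟨_, h2⟩
  exact ⟨hF, hL, hM, hM.unique h2, hM.unique h3⟩

end

/-! ### Assembly of the five items. -/

theorem theorem1p2 (n : ℕ) (hn : 1 ≤ n) :
    (∀ s : ℝ, 0 < s → s < 1 →
      -- the pointwise derivative defining the operator and the principal values exist, and
      -- (i) integral representation
      (∀ u : Rn n → ℝ, IsCc2 u → ∀ x : Rn n,
        DifferentiableAt ℝ (fun t : ℝ => fracLap t u x) s ∧
        HasPV x (fracIntegrand s u x) (pv x (fracIntegrand s u x)) ∧
        HasPV x (logIntegrand s u x) (opL1 s u x) ∧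
        fracLogLap s u x = cConst n s * opL1 s u x + bConst n s * fracLap s u x) ∧
      -- (ii) kernel representation
      (∀ u : Rn n → ℝ, IsCc2 u → ∀ x : Rn n,
        HasPV x (fun y => (u x - u y) * kernelSLog n s ‖x - y‖) (fracLogLap s u x)) ∧
      -- (iii) Fourier symbol
      (∀ u : Rn n → ℝ, IsCc2 u →
        Integrable (fracLogLap s u) ∧
        ∀ ξ : Rn n, fourierT (fun x => (fracLogLap s u x : ℂ)) ξ =
          ((‖ξ‖ ^ (2 * s) * (2 * Real.log ‖ξ‖) : ℝ) : ℂ) * fourierT (fun x => (u x : ℂ)) ξ) ∧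
      -- (iv) the three operators are well defined on Lizorkin distributions, and
      -- representation as a composition
      (IsMultiplier (symFrac s) (multiplier (n := n) (symFrac s)) ∧
        IsMultiplier symLog (multiplier (n := n) symLog) ∧
        IsMultiplier (symFracLog s) (multiplier (n := n) (symFracLog s)) ∧
        ∀ u : LizorkinDual n,
          opD (symFracLog s) u = opD (symFrac s) (opD symLog u) ∧
          opD (symFracLog s) u = opD symLog (opD (symFrac s) u))) ∧
    -- (v) stability in the space of bounded functions as `s → 0⁺`
    (∀ u : Rn n → ℝ, IsCc2 u →
      (∃ v : Rn n → ℝ, IsLogLap u v) ∧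
      (∀ s : ℝ, 0 < s → s < 1 → MemLp (fracLogLap s u) ∞) ∧
      ∀ v : Rn n → ℝ, IsLogLap u v →
        Tendsto (fun s : ℝ => eLpNorm (fun x => fracLogLap s u x - v x) ∞ volume)
          (𝓝[>] (0 : ℝ)) (𝓝 0)) := by
  refine ⟨fun s h0 h1 => ⟨fun u hu x => ⟨(hasDerivAt_fracLap hn h0 h1 hu x).differentiableAt, ?_, ?_,
    fracLogLap_eq hn h0 h1 hu x⟩, fun u hu x => hasPV_kernelSLog hn h0 h1 hu x,
    fun u hu => ⟨integrable_fracLogLap hn h0 h1 hu, fourierT_fracLogLap hn h0 h1 hu⟩, ?_⟩,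
    fun u hu => ⟨⟨_, isLogLap_logLap hn hu⟩, fun s h0 h1 => memLp_top_fracLogLap hn h0 h1 hu,
      fun v hv => tendsto_fracLogLap_of_isLogLap hn hu hv⟩⟩
  · have h := hasPV_powKernel hn h0 h1 hu 0 x
    rw [← fracIntegrand_eq] at h
    rwa [h.pv_eq]
  · have h := hasPV_powKernel hn h0 h1 hu 1 x
    rw [← logIntegrand_eq] at h
    rwa [opL1, h.pv_eq]
  · obtain ⟨hF, hL, hM, e1, e2⟩ := multiplier_symFracLog (n := n) h0 h1
    refine ⟨hF, hL, hM, fun u => ⟨?_, ?_⟩⟩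
    -- Operators on Z' are transposes, so the order of composition is reversed and each identity
    -- uses the opposite factorization on Z.
    · change u.comp (multiplier (symFracLog s)) =
        (u.comp (multiplier symLog)).comp (multiplier (symFrac s))
      rw [e2, ContinuousLinearMap.comp_assoc]
    · change u.comp (multiplier (symFracLog s)) =
        (u.comp (multiplier (symFrac s))).comp (multiplier symLog)
      rw [e1, ContinuousLinearMap.comp_assoc]
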